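/- **Setting.** Let $n\ge 2$, let $U\subseteq\mathbb R^n$ be open with coordinates $x^1,\dots,x^n$, and let $u,v$ be smooth functions on $U$; subscripts denote partial derivatives. Assume nondegeneracy: $u_i\neq0$, $v_i\ne0$ for all $i$, and the functions $a_i=u_i/v_i$ take pairwise distinct values at every point of $U$; put $b_i=v_i/u_i$. Consider the second-order PDE system $E_{ijkl}=0$, $F_{ijkl}=0$ for all pairwise distinct $i,j,k,l\in\{1,\dots,n\}$, where $$E_{ijkl}=\mathop{\mathfrak S}_{(jkl)}(a_i-a_j)(a_k-a_l)\Big(\frac{2u_{ij}-(a_i+a_j)v_{ij}}{u_iu_j}+\frac{2u_{kl}-(a_k+a_l)v_{kl}}{u_ku_l}\Big),$$ $$F_{ijkl}=\mathop{\mathfrak S}_{(jkl)}(b_i-b_j)(b_k-b_l)\Big(\frac{2v_{ij}-(b_i+b_j)u_{ij}}{v_iv_j}+\frac{2v_{kl}-(b_k+b_l)u_{kl}}{v_kv_l}\Big),$$ and $\mathfrak S_{(jkl)}$ is the cyclic sum. A $GL(2,\mathbb R)$ structure is a family of 1-forms $\omega(\lambda)=\omega_0+\lambda\omega_1+\dots+\lambda^{n-1}\omega_{n-1}$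 with $\omega_0,\dots,\omega_{n-1}$ a smooth coframe. It is involutive if $\omega\wedge(d\omega)^2=0$ on the $(x,\lambda)$-space, where $\omega=\omega(\lambda)$ is regarded as a single 1-form on that space (the pulled-back contact form of $\mathbb PT^*U$). On the correspondence space $\hat M=\{(x,\lambda): x\in U,\ \lambda\in\mathbb R,\ \lambda\ne a_i(x)\ \forall i\}$ consider, for $i<j<k$, the vector fields $$V_{ijk}=\tfrac{\lambda-a_i}{u_i}\Big(\tfrac1{\lambda-a_k}-\tfrac1{\lambda-a_j}\Big)\partial_{x^i}+\tfrac{\lambda-a_j}{u_j}\Big(\tfrac1{\lambda-a_i}-\tfrac1{\lambda-a_k}\Big)\partial_{x^j}+\tfrac{\lambda-a_k}{u_k}\Big(\tfrac1{\lambda-a_j}-\tfrac1{\lambda-a_i}\Big)\partial_{x^k}-S_{ijk}\,\partial_\lambda ,$$ $$\begin{aligned}S_{ijk}={}&u_{ij}\tfrac{a_j-a_i}{u_iu_j}\Big(\tfrac{\lambda}{\lambda-a_i}+\tfrac{\lambda}{\lambda-a_j}\Big)+u_{ik}\tfrac{a_i-a_k}{u_iu_k}\Big(\tfrac{\lambda}{\lambda-a_i}+\tfrac{\lambda}{\lambda-a_k}\Big)+u_{jk}\tfrac{a_k-a_j}{u_ju_k}\Big(\tfrac{\lambda}{\lambda-a_j}+\tfrac{\lambda}{\lambda-a_k}\Big)\\&-v_{ij}\tfrac{a_j-a_i}{u_iu_j}\Big(\tfrac{\lambda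 a_i}{\lambda-a_i}+\tfrac{\lambda a_j}{\lambda-a_j}\Big)-v_{ik}\tfrac{a_i-a_k}{u_iu_k}\Big(\tfrac{\lambda a_i}{\lambda-a_i}+\tfrac{\lambda a_k}{\lambda-a_k}\Big)-v_{jk}\tfrac{a_k-a_j}{u_ju_k}\Big(\tfrac{\lambda a_j}{\lambda-a_j}+\tfrac{\lambda a_k}{\lambda-a_k}\Big),\end{aligned}$$ and the distribution $V$ on $\hat M$ spanned by all the $V_{ijk}$. **Theorem.** 1. (The system governs involutivity.) $\omega(\lambda)=\sum_i\big[\prod_{j\ne i}(\lambda-a_j)\big]u_i\,dx^i$ is a $GL(2,\mathbb R)$ structure on $U$, and it is involutive if and only if $(u,v)$ solves the system. 2. (Dispersionless Lax representation.) $(u,v)$ solves the system if and only if $V$ is integrable, i.e. the smooth vector fields tangent to $V$ are closed under the Lie bracket; and $(u,v)$ solves the system if and only if $V$ has rank $n-2$ at every point of $\hat M$. In particular, modulo the system, $V$ is an integrable distribution of rank $n-2$. 3. (Hierarchy.) Varying $n$, the systems form a hierarchy, in the following sense. * For every $n$ the system is compatible (formally integrable): for each $k\ge1$ and each point, every nondegenerate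 $k$-jet of $(u,v)$ at the point that satisfies all those derivatives of the equations (including the equations themselves) that have total order at most $k$ extends to a $(k+1)$-jet that satisfies all those of total order at most $k+1$. * The systems and their Lax fields are nested: if $(u,v)$ is a nondegenerate pair in $m$ variables, then its restriction to any $n$ of the variables, the other ones being fixed, is a nondegenerate pair; its expressions $E_{ijkl}$, $F_{ijkl}$ are those of $(u,v)$ for the corresponding indices, and the inclusion carries its fields $V_{ijk}$ to those of $(u,v)$ for the corresponding indices. In particular, solutions restrict to solutions. -/

import Mathlib

open scoped ContDiff

noncomputable section

/-- The partial derivative `∂f/∂xⁱ` of a function on `ℝⁿ`. -/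
def pd {n : ℕ} (i : Fin n) (f : (Fin n → ℝ) → ℝ) (x : Fin n → ℝ) : ℝ :=
  fderiv ℝ f x (Pi.single i 1)

/-- The second partial derivative `∂²f/∂xⁱ∂xʲ`. -/
def pd2 {n : ℕ} (i j : Fin n) (f : (Fin n → ℝ) → ℝ) (x : Fin n → ℝ) : ℝ :=
  pd j (pd i f) x

/-- `aᵢ = uᵢ / vᵢ`. -/
def aRatio {n : ℕ} (u v : (Fin n → ℝ) → ℝ) (i : Fin n) (x : Fin n → ℝ) : ℝ :=
  pd i u x / pd i v x

/-- Nondegeneracy of the first derivatives at a point: all `uᵢ, vᵢ` are nonzero and the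
`aᵢ = uᵢ / vᵢ` are pairwise distinct. -/
def NondegenerateAt {n : ℕ} (u v : (Fin n → ℝ) → ℝ) (x : Fin n → ℝ) : Prop :=
  (∀ i, pd i u x ≠ 0) ∧ (∀ i, pd i v x ≠ 0) ∧
    ∀ i j, i ≠ j → aRatio u v i x ≠ aRatio u v j x

/-- A smooth nondegenerate pair `(u, v)` on `U`. -/
def NondegeneratePair {n : ℕ} (U : Set (Fin n → ℝ)) (u v : (Fin n → ℝ) → ℝ) : Prop :=
  ContDiffOn ℝ ∞ u U ∧ ContDiffOn ℝ ∞ v U ∧ ∀ x ∈ U, NondegenerateAt u v x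

/-! ### The system of PDEs -/

/-- One summand of the cyclic sum:
`(aᵢ-aⱼ)(aₖ-aₗ) ((2uᵢⱼ-(aᵢ+aⱼ)vᵢⱼ)/(uᵢuⱼ) + (2uₖₗ-(aₖ+aₗ)vₖₗ)/(uₖuₗ))`. -/
def summandE {n : ℕ} (u v : (Fin n → ℝ) → ℝ) (i j k l : Fin n) (x : Fin n → ℝ) : ℝ :=
  (aRatio u v i x - aRatio u v j x) * (aRatio u v k x - aRatio u v l x) *
    ((2 * pd2 i j u x - (aRatio u v i x + aRatio u v j x) * pd2 i j v x)
        / (pd i u x * pd j u x)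
      + (2 * pd2 k l u x - (aRatio u v k x + aRatio u v l x) * pd2 k l v x)
        / (pd k u x * pd l u x))

/-- The expression `Eᵢⱼₖₗ`: the cyclic sum over `(j, k, l)`. -/
def exprE {n : ℕ} (u v : (Fin n → ℝ) → ℝ) (i j k l : Fin n) (x : Fin n → ℝ) : ℝ :=
  summandE u v i j k l x + summandE u v i k l j x + summandE u v i l j k x

/-- The expression `Fᵢⱼₖₗ`, obtained from `Eᵢⱼₖₗ` by interchanging `u` and `v`
(so that `aᵢ` is replaced by `bᵢ = vᵢ / uᵢ`). -/
def exprF {n : ℕ} (u v : (Fin n → ℝ) → ℝ) (i j k l : Fin n) (x : Fin n → ℝ) : ℝ :=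
  exprE v u i j k l x

/-- Four indices are pairwise distinct. -/
def Distinct4 {n : ℕ} (i j k l : Fin n) : Prop :=
  i ≠ j ∧ i ≠ k ∧ i ≠ l ∧ j ≠ k ∧ j ≠ l ∧ k ≠ l

/-- The pair `(u, v)` solves the system `Eᵢⱼₖₗ = 0`, `Fᵢⱼₖₗ = 0` on `U`. -/
def SolvesSystem {n : ℕ} (U : Set (Fin n → ℝ)) (u v : (Fin n → ℝ) → ℝ) : Prop :=
  ∀ x ∈ U, ∀ i j k l : Fin n, Distinct4 i j k l →
    exprE u v i j k l x = 0 ∧ exprF u v i j k l x = 0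

/-- The `k`-jet of `(u, v)` at `x` solves the system together with all its derivatives that are
of total order at most `k`: the derivatives of `E` and `F` of order at most `k - 2` vanish
at `x`. -/
def SolvesToOrder {n : ℕ} (k : ℕ) (u v : (Fin n → ℝ) → ℝ) (x : Fin n → ℝ) : Prop :=
  ∀ i j r s : Fin n, Distinct4 i j r s → ∀ m : ℕ, m + 2 ≤ k →
    iteratedFDeriv ℝ m (exprE u v i j r s) x = 0 ∧
      iteratedFDeriv ℝ m (exprF u v i j r s) x = 0

/-- `f` and `g` have the same `k`-jet at `x`. -/
def SameJet {n : ℕ} (k : ℕ) (f g : (Fin n → ℝ) → ℝ) (x : Fin n → ℝ) : Prop :=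
  ∀ m : ℕ, m ≤ k → iteratedFDeriv ℝ m f x = iteratedFDeriv ℝ m g x

/-- Compatibility (formal integrability) of the system in `n` variables: for every `k ≥ 1`,
every nondegenerate `k`-jet that solves the system to order `k` prolongs to a `(k+1)`-jet that
solves it to order `k + 1`. -/
def SystemCompatible (n : ℕ) : Prop :=
  ∀ (x : Fin n → ℝ) (u v : (Fin n → ℝ) → ℝ) (k : ℕ), 1 ≤ k →
    ContDiff ℝ ∞ u → ContDiff ℝ ∞ v → NondegenerateAt u v x → SolvesToOrder k u v x →
    ∃ u' v' : (Fin n → ℝ) → ℝ, ContDiff ℝ ∞ u' ∧ ContDiff ℝ ∞ v' ∧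
      SameJet k u' u x ∧ SameJet k v' v x ∧ SolvesToOrder (k + 1) u' v' x

/-! ### `GL(2, ℝ)` structures and involutivity -/

/-- A family `η = ω(λ)` of 1-forms on `U ⊆ ℝⁿ` defines a `GL(2, ℝ)` structure:
`ω(λ) = ω₀ + λ ω₁ + ⋯ + λⁿ⁻¹ ωₙ₋₁` for a smooth coframe `ω₀, …, ωₙ₋₁`. -/
def IsGL2Structure {n : ℕ} (U : Set (Fin n → ℝ))
    (η : (Fin n → ℝ) → ℝ → ((Fin n → ℝ) →L[ℝ] ℝ)) : Prop :=
  ∃ w : Fin n → (Fin n → ℝ) → ((Fin n → ℝ) →L[ℝ] ℝ),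
    (∀ i, ContDiffOn ℝ ∞ (w i) U) ∧
    (∀ x ∈ U, LinearIndependent ℝ (fun i => w i x)) ∧
    ∀ x ∈ U, ∀ t : ℝ, η x t = ∑ i : Fin n, t ^ (i : ℕ) • w i x

/-- The canonical contact form of `ℙT*M` pulled back by `(x, λ) ↦ ω(λ)ₓ`: the family `ω(λ)`
regarded as one 1-form on the space with coordinates `(x, λ)`. -/
def contactForm {n : ℕ} (η : (Fin n → ℝ) → ℝ → ((Fin n → ℝ) →L[ℝ] ℝ))
    (p : (Fin n → ℝ) × ℝ) : ((Fin n → ℝ) × ℝ) →L[ℝ] ℝ :=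
  (η p.1 p.2).comp (ContinuousLinearMap.fst ℝ (Fin n → ℝ) ℝ)

/-- The exterior derivative of a 1-form `θ` at `p`, evaluated on two vectors. -/
def dForm {n : ℕ} (θ : ((Fin n → ℝ) × ℝ) → (((Fin n → ℝ) × ℝ) →L[ℝ] ℝ))
    (p X Y : (Fin n → ℝ) × ℝ) : ℝ :=
  fderiv ℝ θ p X Y - fderiv ℝ θ p Y X

/-- Involutivity: with `θ` the pulled-back contact form, `θ ∧ (dθ)² = 0`, that is, the square
`dθ ∧ dθ` of the restriction of `dθ` to the kernel of `θ` vanishes. -/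
def IsInvolutiveStructure {n : ℕ} (U : Set (Fin n → ℝ))
    (η : (Fin n → ℝ) → ℝ → ((Fin n → ℝ) →L[ℝ] ℝ)) : Prop :=
  ∀ p : (Fin n → ℝ) × ℝ, p.1 ∈ U → ∀ X₁ X₂ X₃ X₄ : (Fin n → ℝ) × ℝ,
    contactForm η p X₁ = 0 → contactForm η p X₂ = 0 →
    contactForm η p X₃ = 0 → contactForm η p X₄ = 0 →
    dForm (contactForm η) p X₁ X₂ * dForm (contactForm η) p X₃ X₄
      - dForm (contactForm η) p X₁ X₃ * dForm (contactForm η) p X₂ X₄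
      + dForm (contactForm η) p X₁ X₄ * dForm (contactForm η) p X₂ X₃ = 0

/-- The structure defined by `(u, v)`: `ω(λ) = ∑ᵢ (∏_{j ≠ i} (λ - aⱼ)) uᵢ dxⁱ`, which is
`∑ᵢ uᵢ / (λ - aᵢ) dxⁱ` with the denominators cleared. -/
def structureForm {n : ℕ} (u v : (Fin n → ℝ) → ℝ) (x : Fin n → ℝ) (t : ℝ) :
    (Fin n → ℝ) →L[ℝ] ℝ :=
  ∑ i : Fin n, ((∏ j ∈ Finset.univ.erase i, (t - aRatio u v j x)) * pd i u x) •
    (ContinuousLinearMap.proj i : (Fin n → ℝ) →L[ℝ] ℝ)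

/-! ### The Lax distribution -/

/-- The coefficient `Sᵢⱼₖ`, at the point `(x, t)`. -/
def coeffS {n : ℕ} (u v : (Fin n → ℝ) → ℝ) (i j k : Fin n) (x : Fin n → ℝ) (t : ℝ) : ℝ :=
  let a := fun r : Fin n => aRatio u v r x
  pd2 i j u x * ((a j - a i) / (pd i u x * pd j u x)) * (t / (t - a i) + t / (t - a j))
  + pd2 i k u x * ((a i - a k) / (pd i u x * pd k u x)) * (t / (t - a i) + t / (t - a k))
  + pd2 j k u x * ((a k - a j) / (pd j u x * pd k u x)) * (t / (t - a j) + t / (t - a k))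
  - pd2 i j v x * ((a j - a i) / (pd i u x * pd j u x))
      * (t * a i / (t - a i) + t * a j / (t - a j))
  - pd2 i k v x * ((a i - a k) / (pd i u x * pd k u x))
      * (t * a i / (t - a i) + t * a k / (t - a k))
  - pd2 j k v x * ((a k - a j) / (pd j u x * pd k u x))
      * (t * a j / (t - a j) + t * a k / (t - a k))

/-- The vector field `Vᵢⱼₖ` on the correspondence space, with coordinates `(x, λ)`. -/
def laxField {n : ℕ} (u v : (Fin n → ℝ) → ℝ) (i j k : Fin n) (p : (Fin n → ℝ) × ℝ) :
    (Fin n → ℝ) × ℝ :=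
  let a := fun r : Fin n => aRatio u v r p.1
  let t := p.2
  (((t - a i) / pd i u p.1 * (1 / (t - a k) - 1 / (t - a j))) • (Pi.single i 1 : Fin n → ℝ)
    + ((t - a j) / pd j u p.1 * (1 / (t - a i) - 1 / (t - a k))) • (Pi.single j 1 : Fin n → ℝ)
    + ((t - a k) / pd k u p.1 * (1 / (t - a j) - 1 / (t - a i))) • (Pi.single k 1 : Fin n → ℝ),
   - coeffS u v i j k p.1 t)

/-- The correspondence space over `U`: the points `(x, λ)` at which the fields `Vᵢⱼₖ` have no
poles. -/
def corrSpace {n : ℕ} (U : Set (Fin n → ℝ)) (u v : (Fin n → ℝ) → ℝ) :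
    Set ((Fin n → ℝ) × ℝ) :=
  {p | p.1 ∈ U ∧ ∀ i, p.2 ≠ aRatio u v i p.1}

/-- The distribution spanned by the fields `Vᵢⱼₖ`, `i < j < k`. -/
def laxDistribution {n : ℕ} (u v : (Fin n → ℝ) → ℝ) (p : (Fin n → ℝ) × ℝ) :
    Submodule ℝ ((Fin n → ℝ) × ℝ) :=
  Submodule.span ℝ {w | ∃ i j k : Fin n, i < j ∧ j < k ∧ w = laxField u v i j k p}

/-- A distribution `D` is integrable on `Ω` (in the sense of Frobenius): the smooth vector fields
tangent to `D` are closed under the Lie bracket. -/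
def IsIntegrableOn {n : ℕ} (D : ((Fin n → ℝ) × ℝ) → Submodule ℝ ((Fin n → ℝ) × ℝ))
    (Ω : Set ((Fin n → ℝ) × ℝ)) : Prop :=
  ∀ X Y : ((Fin n → ℝ) × ℝ) → ((Fin n → ℝ) × ℝ),
    ContDiffOn ℝ ∞ X Ω → ContDiffOn ℝ ∞ Y Ω →
    (∀ p ∈ Ω, X p ∈ D p) → (∀ p ∈ Ω, Y p ∈ D p) →
    ∀ p ∈ Ω, VectorField.lieBracket ℝ X Y p ∈ D p

/-! ### Nestedness -/

/-- The inclusion of the coordinate `n`-plane through `c ∈ ℝᵐ` in the directions `ι`: the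
coordinates in the range of `ι` are those of `y`, the other ones are those of `c`. -/
def slice {n m : ℕ} (ι : Fin n ↪ Fin m) (c : Fin m → ℝ) (y : Fin n → ℝ) : Fin m → ℝ :=
  Function.extend ι y c

/-- The systems and the Lax fields are nested: for `(u, v)` on `U ⊆ ℝᵐ`, restricting to any
coordinate `n`-plane (the other coordinates being fixed parameters) gives a nondegenerate pair
whose expressions `E`, `F` are the corresponding ones of `(u, v)`, and whose fields `Vᵢⱼₖ` are
carried by the inclusion to the corresponding ones of `(u, v)`. -/
def NestedStructure (n m : ℕ) : Prop :=
  ∀ (ι : Fin n ↪ Fin m) (c : Fin m → ℝ) (U : Set (Fin m → ℝ)) (u v : (Fin m → ℝ) → ℝ),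
    IsOpen U → NondegeneratePair U u v →
    NondegeneratePair (slice ι c ⁻¹' U) (u ∘ slice ι c) (v ∘ slice ι c) ∧
    ∀ y : Fin n → ℝ, slice ι c y ∈ U →
      (∀ i j k l : Fin n,
        exprE u v (ι i) (ι j) (ι k) (ι l) (slice ι c y)
            = exprE (u ∘ slice ι c) (v ∘ slice ι c) i j k l y ∧
        exprF u v (ι i) (ι j) (ι k) (ι l) (slice ι c y)
            = exprF (u ∘ slice ι c) (v ∘ slice ι c) i j k l y) ∧
      ∀ (i j k : Fin n) (t : ℝ),
        laxField u v (ι i) (ι j) (ι k) (slice ι c y, t)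
          = (slice ι 0 (laxField (u ∘ slice ι c) (v ∘ slice ι c) i j k (y, t)).1,
             (laxField (u ∘ slice ι c) (v ∘ slice ι c) i j k (y, t)).2)

end

/-!
**The geometry.** On the correspondence space put `pᵢ = 1 / (λ - aᵢ)`, `qᵢ = uᵢ / (λ - aᵢ)`,
`ω = ∑ qᵢ dxⁱ` and `τ = -∂_λ ω = ∑ pᵢ qᵢ dxⁱ`. The form `ω(λ)` of the theorem is `∏ (λ - aⱼ)`
times `ω`, and a factor only rescales `dω` on the kernel. In the coframe `eⁱ = qᵢ dxⁱ` one has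
`dω = ∑_{i<j} Aᵢⱼ eⁱ ∧ eʲ - dλ ∧ τ` with explicit components `Aᵢⱼ` (`curv`, `dForm_omegaForm`). As
`dλ` is independent of the `dxⁱ`, the condition `ω ∧ (dω)² = 0` amounts to `ω ∧ τ ∧ A = 0`, and
the components of this 4-form (`wedge4`) are `λEᵢⱼₖₗ + aᵢaⱼaₖaₗ Fᵢⱼₖₗ` up to factors without zeros
off `λ = 0`. These are affine in `λ`, so the system is equivalent to involutivity
(`system_iff_wedge4`, `isInvolutiveStructure_iff`; the zeros of the `λ - aᵢ` are reached by
continuity).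

**The Lax fields.** In the frame dual to the `eⁱ` the field `Vᵢⱼₖ` is the vector
`(pₖ-pⱼ)eᵢ + (pᵢ-pₖ)eⱼ + (pⱼ-pᵢ)eₖ - (Aᵢⱼ+Aⱼₖ+Aₖᵢ)∂_λ`. These vectors span a space that projects
onto `ker ω ∩ ker τ`, which has dimension `n - 2`, and an alternating combination of four of them
is the multiple `wedge4` of `∂_λ` (`charVec_relation`). If the system holds, they span the Cauchy
characteristics of `ω`, the kernel of `dω` on `ker ω`, which do not contain `∂_λ`; so the rank is
`n - 2` and the distribution is integrable (`lieBracket_characteristic`). If it fails at a point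
`x`, then for generic `λ` `∂_λ` belongs to the distribution at `(x, λ)`, which raises the rank;
and integrability is contradicted by the bracket of the multiple `wedge4` of `∂_λ` with `Vᵢⱼₖ`,
which would have to lie in `ker τ`.

**Compatibility.** Prolonging a `k`-jet means solving linear equations for the derivatives of
order `k + 1` of `(u, v)`, which are functions `φ` and `ψ` on multisets of indices. Fix two
indices `z` and `o`. Since `ω ∧ T = τ ∧ T = 0` for `T = ω ∧ τ ∧ A`, the equations with indices
`z, o, k, l` imply the others (`IsWedge.eq_zero`), and differentiated along a multiset `s` they
determine `φ` and `ψ` at `{k, l} + s` through the values at multisets with fewer indices other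
than `z` and `o`. A multiset may be written as `{k, l} + s` in several ways, so the values are
overdetermined. They are consistent because of a differential syzygy:
`d(ω ∧ τ ∧ dω) = τ ∧ dω ∧ dω - ω ∧ dω ∧ dτ`, and the right-hand side is an algebraic combination
of the components of `ω ∧ τ ∧ A` (`d_wedgeD_coeff`), so it contains no derivatives of the
equations. For distinct `k, l, m` the syzygy becomes an identity `(λ-aₖ)² X = (λ-aₗ)² Y` with `X`
and `Y` affine in `λ`, which forces `X = Y = 0` (`SolvesAt.exchange`). Induction on the number of
indices other than `z` and `o` gives the prolongation (`exists_prolongation`, `systemCompatible`).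

**Nestedness** is the chain rule for the affine inclusion of a coordinate plane.
-/

noncomputable section

/-! ### Linear algebra of the characteristics of a 1-form -/

section Linear

variable {n : ℕ} (p q : Fin n → ℝ) (A : Fin n → Fin n → ℝ)

/-- The cyclic sum `Aᵢⱼ + Aⱼₖ + Aₖᵢ`. -/
def cyc (i j k : Fin n) : ℝ := A i j + A j k + A k i

/-- The vector `(pₖ-pⱼ)eᵢ + (pᵢ-pₖ)eⱼ + (pⱼ-pᵢ)eₖ - (Aᵢⱼ+Aⱼₖ+Aₖᵢ)∂_λ` in the frame
`eᵢ = qᵢ⁻¹ ∂ᵢ`. -/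
def charVec (i j k : Fin n) : (Fin n → ℝ) × ℝ :=
  (((p k - p j) / q i) • (Pi.single i 1 : Fin n → ℝ)
    + ((p i - p k) / q j) • (Pi.single j 1 : Fin n → ℝ)
    + ((p j - p i) / q k) • (Pi.single k 1 : Fin n → ℝ), - cyc A i j k)

/-- The `(i, j, k, l)` component of `ω ∧ τ ∧ A` in the coframe `eⁱ = qᵢ dxⁱ`, where `ω = ∑ eⁱ` and
`τ = ∑ pᵢ eⁱ`. -/
def wedge4 (i j k l : Fin n) : ℝ :=
  (p j - p i) * A k l - (p k - p i) * A j l + (p l - p i) * A j k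
    + (p k - p j) * A i l - (p l - p j) * A i k + (p l - p k) * A i j

/-- The span of the vectors `charVec p q A i j k` with `i < j < k`. -/
def charSpan : Submodule ℝ ((Fin n → ℝ) × ℝ) :=
  Submodule.span ℝ {w | ∃ i j k : Fin n, i < j ∧ j < k ∧ w = charVec p q A i j k}

/-- The 2-form `∑_{i<j} Aᵢⱼ eⁱ ∧ eʲ - dλ ∧ τ`. -/
def twoForm (X Y : (Fin n → ℝ) × ℝ) : ℝ :=
  ∑ i, ∑ j, A i j * (q i * X.1 i) * (q j * Y.1 j)
    - (X.2 * ∑ i, p i * (q i * Y.1 i) - Y.2 * ∑ i, p i * (q i * X.1 i))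

variable {p q A}

lemma charVec_swap₁ (hA : ∀ i j, A i j = - A j i) (i j k : Fin n) :
    charVec p q A j i k = - charVec p q A i j k := by
  refine Prod.ext ?_ ?_
  · funext r
    simp only [charVec, Pi.add_apply, Pi.smul_apply, smul_eq_mul, Prod.fst_neg, Pi.neg_apply]
    ring
  · simp only [charVec, cyc, Prod.snd_neg]
    linarith [hA i j, hA j k, hA k i]

lemma charVec_swap₂ (hA : ∀ i j, A i j = - A j i) (i j k : Fin n) :
    charVec p q A i k j = - charVec p q A i j k := by
  refine Prod.ext ?_ ?_
  · funext r
    simp only [charVec, Pi.add_apply, Pi.smul_apply, smul_eq_mul, Prod.fst_neg, Pi.neg_apply]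
    ring
  · simp only [charVec, cyc, Prod.snd_neg]
    linarith [hA i j, hA j k, hA k i]

lemma charVec_eq_zero (hA : ∀ i j, A i j = - A j i) (i j : Fin n) :
    charVec p q A i i j = 0 := by
  have h := charVec_swap₁ (p := p) (q := q) hA i i j
  exact self_eq_neg.mp h

lemma charVec_mem_charSpan (hA : ∀ i j, A i j = - A j i) (i j k : Fin n) :
    charVec p q A i j k ∈ charSpan p q A := by
  have base : ∀ {i j k : Fin n}, i < j → j < k → charVec p q A i j k ∈ charSpan p q A :=
    fun {i j k} h1 h2 => Submodule.subset_span ⟨i, j, k, h1, h2, rfl⟩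
  have s1 : ∀ {i j k : Fin n}, charVec p q A i j k ∈ charSpan p q A →
      charVec p q A j i k ∈ charSpan p q A := fun {i j k} h => by
    rw [charVec_swap₁ hA i j k]; exact neg_mem h
  have s2 : ∀ {i j k : Fin n}, charVec p q A i j k ∈ charSpan p q A →
      charVec p q A i k j ∈ charSpan p q A := fun {i j k} h => by
    rw [charVec_swap₂ hA i j k]; exact neg_mem h
  have z : ∀ i j : Fin n, charVec p q A i i j ∈ charSpan p q A := fun i j => by
    rw [charVec_eq_zero hA]; exact zero_mem _
  rcases lt_trichotomy i j with h1 | rfl | h1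
  · rcases lt_trichotomy j k with h2 | rfl | h2
    · exact base h1 h2
    · exact s1 (s2 (z _ _))
    · rcases lt_trichotomy i k with h3 | rfl | h3
      · exact s2 (base h3 h2)
      · exact s2 (z _ _)
      · exact s2 (s1 (base h3 h1))
  · exact z _ _
  · rcases lt_trichotomy i k with h2 | rfl | h2
    · exact s1 (base h1 h2)
    · exact s2 (z _ _)
    · rcases lt_trichotomy j k with h3 | rfl | h3
      · exact s1 (s2 (base h3 h2))
      · exact s1 (s2 (z _ _))
      · exact s1 (s2 (s1 (base h3 h1)))

/-- The relation between four of the vectors whose right-hand side is the obstruction `wedge4`. -/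
lemma charVec_relation (hA : ∀ i j, A i j = - A j i) (i j k l : Fin n) :
    p i • charVec p q A j k l - p j • charVec p q A i k l + p k • charVec p q A i j l
      - p l • charVec p q A i j k = (0, wedge4 p A i j k l) := by
  refine Prod.ext ?_ ?_
  · funext r
    simp only [charVec, Pi.add_apply, Pi.smul_apply, smul_eq_mul, Prod.fst_add, Prod.fst_sub,
      Pi.sub_apply, Prod.smul_fst, Pi.zero_apply]
    ring
  · simp only [charVec, cyc, Prod.snd_add, Prod.snd_sub, Prod.smul_snd, smul_eq_mul, wedge4]
    rw [hA l j, hA l i, hA k i]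
    ring

lemma wedge4_mem_charSpan (hA : ∀ i j, A i j = - A j i) (i j k l : Fin n) :
    ((0, wedge4 p A i j k l) : (Fin n → ℝ) × ℝ) ∈ charSpan p q A := by
  rw [← charVec_relation (q := q) hA]
  have h := fun i j k => charVec_mem_charSpan (p := p) (q := q) hA i j k
  exact sub_mem (add_mem (sub_mem (Submodule.smul_mem _ _ (h _ _ _))
    (Submodule.smul_mem _ _ (h _ _ _))) (Submodule.smul_mem _ _ (h _ _ _)))
    (Submodule.smul_mem _ _ (h _ _ _))

/-- Pairing a vector `charVec p q A i j k` with a weighted sum. -/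
lemma sum_mul_charVec (hq : ∀ i, q i ≠ 0) (c : Fin n → ℝ) (i j k : Fin n) :
    ∑ r, c r * (q r * (charVec p q A i j k).1 r)
      = c i * (p k - p j) + c j * (p i - p k) + c k * (p j - p i) := by
  have e : ∀ r, c r * (q r * (charVec p q A i j k).1 r)
      = c r * q r * ((p k - p j) / q i) * (Pi.single i 1 : Fin n → ℝ) r
        + c r * q r * ((p i - p k) / q j) * (Pi.single j 1 : Fin n → ℝ) r
        + c r * q r * ((p j - p i) / q k) * (Pi.single k 1 : Fin n → ℝ) r := fun r => by
    simp only [charVec, Pi.add_apply, Pi.smul_apply, smul_eq_mul]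
    ring
  simp only [e, Finset.sum_add_distrib, Pi.single_apply, mul_ite, mul_one, mul_zero,
    Finset.sum_ite_eq', Finset.mem_univ, if_true]
  have := hq i; have := hq j; have := hq k
  field_simp

lemma omega_charVec (hq : ∀ i, q i ≠ 0) (i j k : Fin n) :
    ∑ r, q r * (charVec p q A i j k).1 r = 0 := by
  have := sum_mul_charVec (p := p) (A := A) hq (fun _ => 1) i j k
  simp only [one_mul] at this
  rw [this]; ring

lemma tau_charVec (hq : ∀ i, q i ≠ 0) (i j k : Fin n) :
    ∑ r, p r * (q r * (charVec p q A i j k).1 r) = 0 := by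
  rw [sum_mul_charVec hq]; ring

/-- If `ω ∧ τ ∧ A = 0`, the vectors `charVec p q A i j k` are characteristic. -/
lemma twoForm_charVec (hq : ∀ i, q i ≠ 0) (hA : ∀ i j, A i j = - A j i)
    (hw : ∀ i j k l, wedge4 p A i j k l = 0) (i j k : Fin n) (Y : (Fin n → ℝ) × ℝ)
    (hY : ∑ r, q r * Y.1 r = 0) : twoForm p q A (charVec p q A i j k) Y = 0 := by
  have h1 : ∑ r, ∑ s, A r s * (q r * (charVec p q A i j k).1 r) * (q s * Y.1 s)
      = ∑ s, (A i s * (p k - p j) + A j s * (p i - p k) + A k s * (p j - p i)) * (q s * Y.1 s) := by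
    rw [Finset.sum_comm]
    refine Finset.sum_congr rfl fun s _ => ?_
    rw [← Finset.sum_mul, sum_mul_charVec hq (fun r => A r s)]
  have h2 : ∀ s, A i s * (p k - p j) + A j s * (p i - p k) + A k s * (p j - p i)
      = (p i * A j k + p j * A k i + p k * A i j) - p s * cyc A i j k := fun s => by
    have := hw i j k s
    simp only [wedge4] at this
    simp only [cyc]
    rw [hA k i]
    linear_combination this
  simp only [twoForm, h1, tau_charVec hq, h2]
  simp only [sub_mul, Finset.sum_sub_distrib, ← Finset.mul_sum, hY, mul_assoc]
  simp only [charVec]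
  have : ∀ s, p s * (cyc A i j k * (q s * Y.1 s)) = cyc A i j k * (p s * (q s * Y.1 s)) :=
    fun s => by ring
  simp only [this, ← Finset.mul_sum]
  ring

lemma twoForm_add_left (X X' Y : (Fin n → ℝ) × ℝ) :
    twoForm p q A (X + X') Y = twoForm p q A X Y + twoForm p q A X' Y := by
  simp only [twoForm, Prod.fst_add, Prod.snd_add, Pi.add_apply, mul_add, add_mul,
    Finset.sum_add_distrib]
  ring

lemma twoForm_smul_left (c : ℝ) (X Y : (Fin n → ℝ) × ℝ) :
    twoForm p q A (c • X) Y = c * twoForm p q A X Y := by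
  have e1 : ∀ i j, A i j * (q i * (c * X.1 i)) * (q j * Y.1 j)
      = c * (A i j * (q i * X.1 i) * (q j * Y.1 j)) := fun i j => by ring
  have e2 : ∀ i, p i * (q i * (c * X.1 i)) = c * (p i * (q i * X.1 i)) := fun i => by ring
  simp only [twoForm, Prod.smul_fst, Prod.smul_snd, Pi.smul_apply, smul_eq_mul, e1, e2,
    ← Finset.mul_sum]
  ring

/-- The characteristics of the 1-form `ω = ∑ qᵢ dxⁱ` with differential `twoForm p q A`: the kernel
of the restriction of the 2-form to `ker ω`. -/
def IsCharacteristic (p q : Fin n → ℝ) (A : Fin n → Fin n → ℝ) (X : (Fin n → ℝ) × ℝ) : Prop :=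
  ∑ r, q r * X.1 r = 0 ∧
    ∀ Y : (Fin n → ℝ) × ℝ, ∑ r, q r * Y.1 r = 0 → twoForm p q A X Y = 0

lemma isCharacteristic_of_mem (hq : ∀ i, q i ≠ 0) (hA : ∀ i j, A i j = - A j i)
    (hw : ∀ i j k l, wedge4 p A i j k l = 0) {X : (Fin n → ℝ) × ℝ} (hX : X ∈ charSpan p q A) :
    IsCharacteristic p q A X := by
  induction hX using Submodule.span_induction with
  | mem x hx =>
    obtain ⟨i, j, k, -, -, rfl⟩ := hx
    exact ⟨omega_charVec hq i j k, fun Y hY => twoForm_charVec hq hA hw i j k Y hY⟩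
  | zero => exact ⟨by simp, fun Y _ => by simp [twoForm]⟩
  | add x y _ _ hx hy =>
    refine ⟨?_, fun Y hY => ?_⟩
    · simp only [Prod.fst_add, Pi.add_apply, mul_add, Finset.sum_add_distrib, hx.1, hy.1, add_zero]
    · rw [twoForm_add_left, hx.2 Y hY, hy.2 Y hY, add_zero]
  | smul c x _ hx =>
    refine ⟨?_, fun Y hY => ?_⟩
    · have : ∀ r, q r * (c • x).1 r = c * (q r * x.1 r) := fun r => by
        simp only [Prod.smul_fst, Pi.smul_apply, smul_eq_mul]; ring
      simp only [this, ← Finset.mul_sum, hx.1, mul_zero]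
    · rw [twoForm_smul_left, hx.2 Y hY, mul_zero]

lemma omega_tau_of_mem (hq : ∀ i, q i ≠ 0) {X : (Fin n → ℝ) × ℝ} (hX : X ∈ charSpan p q A) :
    ∑ r, q r * X.1 r = 0 ∧ ∑ r, p r * (q r * X.1 r) = 0 := by
  induction hX using Submodule.span_induction with
  | mem x hx =>
    obtain ⟨i, j, k, -, -, rfl⟩ := hx
    exact ⟨omega_charVec hq i j k, tau_charVec hq i j k⟩
  | zero => simp
  | add x y _ _ hx hy =>
    simp only [Prod.fst_add, Pi.add_apply, mul_add, Finset.sum_add_distrib, hx.1, hy.1, hx.2, hy.2,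
      add_zero, and_self]
  | smul c x _ hx =>
    have e1 : ∀ r, q r * (c • x).1 r = c * (q r * x.1 r) := fun r => by
      simp only [Prod.smul_fst, Pi.smul_apply, smul_eq_mul]; ring
    have e2 : ∀ r, p r * (c * (q r * x.1 r)) = c * (p r * (q r * x.1 r)) := fun r => by ring
    simp only [e1, e2, ← Finset.mul_sum, hx.1, hx.2, mul_zero, and_self]

/-- A vector of `ker ω ∩ ker τ` has at least three nonzero components or vanishes. -/
lemma eq_zero_of_two_components (hq : ∀ i, q i ≠ 0) (hp : ∀ i j, i ≠ j → p i ≠ p j)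
    {a b : Fin n} (hab : a ≠ b) {h : Fin n → ℝ} (h0 : ∀ r, r ≠ a → r ≠ b → h r = 0)
    (h1 : ∑ r, q r * h r = 0) (h2 : ∑ r, p r * (q r * h r) = 0) : h = 0 := by
  have key : ∀ c : Fin n → ℝ, (∀ r, r ≠ a → r ≠ b → c r = 0) → ∑ r, c r = c a + c b := by
    intro c hc
    rw [← Finset.sum_pair hab]
    symm
    refine Finset.sum_subset (Finset.subset_univ _) fun r _ hr => ?_
    simp only [Finset.mem_insert, Finset.mem_singleton, not_or] at hr
    exact hc r hr.1 hr.2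
  rw [key _ fun r ha hb => by rw [h0 r ha hb, mul_zero]] at h1
  rw [key _ fun r ha hb => by rw [h0 r ha hb, mul_zero, mul_zero]] at h2
  have hb : (p a - p b) * (q b * h b) = 0 := by linear_combination p a * h1 - h2
  have hb' : h b = 0 := by
    rcases mul_eq_zero.mp hb with h | h
    · exact absurd (sub_eq_zero.mp h) (hp a b hab)
    · exact (mul_eq_zero.mp h).resolve_left (hq b)
  have ha' : h a = 0 := by
    rw [hb', mul_zero, add_zero] at h1
    exact (mul_eq_zero.mp h1).resolve_left (hq a)
  funext r
  by_cases hra : r = a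
  · rw [hra, ha']; rfl
  by_cases hrb : r = b
  · rw [hrb, hb']; rfl
  · exact h0 r hra hrb

/-- The span of the vectors `charVec p q A i j k` projects onto `ker ω ∩ ker τ`. -/
lemma exists_mem_charSpan (hn : 2 ≤ n) (hq : ∀ i, q i ≠ 0) (hp : ∀ i j, i ≠ j → p i ≠ p j)
    (hA : ∀ i j, A i j = - A j i) {h : Fin n → ℝ}
    (h1 : ∑ r, q r * h r = 0) (h2 : ∑ r, p r * (q r * h r) = 0) :
    ∃ s : ℝ, ((h, s) : (Fin n → ℝ) × ℝ) ∈ charSpan p q A := by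
  let a : Fin n := ⟨0, by omega⟩
  let b : Fin n := ⟨1, by omega⟩
  have hab : a ≠ b := by simp [a, b, Fin.ext_iff]
  have hpab : p b - p a ≠ 0 := sub_ne_zero.mpr (hp b a hab.symm)
  let Z : (Fin n → ℝ) × ℝ := ∑ k, (if k = a ∨ k = b then 0 else q k * h k / (p b - p a)) •
    charVec p q A a b k
  have hZ : Z ∈ charSpan p q A :=
    Submodule.sum_mem _ fun k _ => Submodule.smul_mem _ _ (charVec_mem_charSpan hA _ _ _)
  obtain ⟨hZ1, hZ2⟩ := omega_tau_of_mem hq hZ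
  have hzero : h - Z.1 = 0 := by
    refine eq_zero_of_two_components hq hp hab (fun r hra hrb => ?_) ?_ ?_
    · have : Z.1 r = ∑ k, (if k = a ∨ k = b then 0 else q k * h k / (p b - p a)) *
          (((p b - p a) / q k) * (Pi.single k 1 : Fin n → ℝ) r) := by
        simp only [Z, Prod.fst_sum, Finset.sum_apply, Prod.smul_fst, Pi.smul_apply, smul_eq_mul]
        refine Finset.sum_congr rfl fun k _ => ?_
        simp only [charVec, Pi.add_apply, Pi.smul_apply, smul_eq_mul, Pi.single_apply, hra, hrb,
          if_false, mul_zero, zero_add]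
      rw [Pi.sub_apply, this]
      simp only [Pi.single_apply, mul_ite, mul_one, mul_zero, Finset.sum_ite_eq, Finset.mem_univ,
        if_true, hra, hrb, or_self, if_false]
      have := hq r
      field_simp
      ring
    · simp only [Pi.sub_apply, mul_sub, Finset.sum_sub_distrib, h1, hZ1, sub_zero]
    · simp only [Pi.sub_apply, mul_sub, Finset.sum_sub_distrib, h2, hZ2, sub_zero]
  refine ⟨Z.2, ?_⟩
  rw [sub_eq_zero.mp hzero]
  exact hZ

/-- Pairing the vector `e_b - e_a` of `ker ω` with a weighted sum. -/
lemma sum_mul_frame_sub (hq : ∀ i, q i ≠ 0) (c : Fin n → ℝ) (a b : Fin n) :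
    ∑ r, c r * (q r * ((Pi.single b (q b)⁻¹ - Pi.single a (q a)⁻¹ : Fin n → ℝ) r)) = c b - c a := by
  simp only [Pi.sub_apply, mul_sub, Finset.sum_sub_distrib, Pi.single_apply, mul_ite, mul_zero,
    Finset.sum_ite_eq', Finset.mem_univ, if_true]
  rw [mul_inv_cancel₀ (hq a), mul_inv_cancel₀ (hq b), mul_one, mul_one]

/-- A characteristic vector annihilates `τ`. -/
lemma IsCharacteristic.tau {X : (Fin n → ℝ) × ℝ} (hX : IsCharacteristic p q A X) :
    ∑ r, p r * (q r * X.1 r) = 0 := by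
  have := hX.2 (0, 1) (by simp)
  simpa [twoForm] using this

/-- `∂_λ` is not characteristic. -/
lemma IsCharacteristic.eq_zero_of_vertical (hn : 2 ≤ n) (hq : ∀ i, q i ≠ 0)
    (hp : ∀ i j, i ≠ j → p i ≠ p j) {s : ℝ} (hX : IsCharacteristic p q A (0, s)) : s = 0 := by
  let a : Fin n := ⟨0, by omega⟩
  let b : Fin n := ⟨1, by omega⟩
  have hab : a ≠ b := by simp [a, b, Fin.ext_iff]
  have h1 := sum_mul_frame_sub hq (fun _ => 1) a b
  have h2 := sum_mul_frame_sub hq p a b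
  simp only [one_mul, sub_self] at h1
  have := hX.2 (_, 0) h1
  simp only [twoForm, h2, Pi.zero_apply, mul_zero, zero_mul, Finset.sum_const_zero, zero_sub,
    sub_zero, neg_eq_zero] at this
  exact (mul_eq_zero.mp this).resolve_right (sub_ne_zero.mpr (hp b a hab.symm))

/-- If `ω ∧ τ ∧ A = 0`, the vectors `charVec p q A i j k` span the characteristics. -/
lemma mem_charSpan_iff (hn : 2 ≤ n) (hq : ∀ i, q i ≠ 0) (hp : ∀ i j, i ≠ j → p i ≠ p j)
    (hA : ∀ i j, A i j = - A j i) (hw : ∀ i j k l, wedge4 p A i j k l = 0)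
    (X : (Fin n → ℝ) × ℝ) : X ∈ charSpan p q A ↔ IsCharacteristic p q A X := by
  refine ⟨isCharacteristic_of_mem hq hA hw, fun hX => ?_⟩
  obtain ⟨s, hs⟩ := exists_mem_charSpan hn hq hp hA hX.1 hX.tau
  have hc := isCharacteristic_of_mem hq hA hw hs
  have h0 : IsCharacteristic p q A (0, X.2 - s) := by
    have e : ((0, X.2 - s) : (Fin n → ℝ) × ℝ) = X + (-1 : ℝ) • (X.1, s) := by
      refine Prod.ext ?_ ?_
      · simp
      · simp only [Prod.snd_add, Prod.smul_snd, smul_eq_mul]; ring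
    refine ⟨by simp, fun Y hY => ?_⟩
    rw [e, twoForm_add_left, twoForm_smul_left, hX.2 Y hY, hc.2 Y hY]
    ring
  have hs0 := h0.eq_zero_of_vertical hn hq hp
  have : X = (X.1, s) := Prod.ext rfl (by simpa using sub_eq_zero.mp hs0)
  rw [this]; exact hs

/-- The map `(ω, τ)` into `ℝ²`, whose kernel is `ker ω ∩ ker τ`. -/
def omegaTau (p q : Fin n → ℝ) : (Fin n → ℝ) →ₗ[ℝ] (Fin 2 → ℝ) where
  toFun h := ![∑ r, q r * h r, ∑ r, p r * (q r * h r)]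
  map_add' x y := by
    funext i
    fin_cases i <;> simp [mul_add, Finset.sum_add_distrib]
  map_smul' c x := by
    have e1 : ∀ r, q r * (c * x r) = c * (q r * x r) := fun r => by ring
    have e2 : ∀ r, p r * (c * (q r * x r)) = c * (p r * (q r * x r)) := fun r => by ring
    funext i
    fin_cases i <;> simp [e1, e2, Finset.mul_sum]

lemma mem_ker_omegaTau (h : Fin n → ℝ) : h ∈ LinearMap.ker (omegaTau p q) ↔
    ∑ r, q r * h r = 0 ∧ ∑ r, p r * (q r * h r) = 0 := by
  rw [LinearMap.mem_ker]
  constructor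
  · intro hh
    exact ⟨congrFun hh 0, congrFun hh 1⟩
  · rintro ⟨h1, h2⟩
    funext i
    fin_cases i
    · exact h1
    · exact h2

lemma finrank_ker_omegaTau (hn : 2 ≤ n) (hq : ∀ i, q i ≠ 0) (hp : ∀ i j, i ≠ j → p i ≠ p j) :
    Module.finrank ℝ (LinearMap.ker (omegaTau p q)) + 2 = n := by
  let a : Fin n := ⟨0, by omega⟩
  let b : Fin n := ⟨1, by omega⟩
  have hab : a ≠ b := by simp [a, b, Fin.ext_iff]
  have hpab : p b - p a ≠ 0 := sub_ne_zero.mpr (hp b a hab.symm)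
  have hsurj : LinearMap.range (omegaTau p q) = ⊤ := by
    rw [LinearMap.range_eq_top]
    intro y
    refine ⟨Pi.single a ((p b * y 0 - y 1) / (p b - p a) / q a)
      + Pi.single b ((y 1 - p a * y 0) / (p b - p a) / q b), ?_⟩
    have := hq a; have := hq b
    funext i
    fin_cases i
    · simp [omegaTau, mul_add, Finset.sum_add_distrib, Pi.single_apply, Finset.sum_ite_eq']
      field_simp
      ring
    · simp [omegaTau, mul_add, Finset.sum_add_distrib, Pi.single_apply, Finset.sum_ite_eq']
      field_simp
      ring
  have := LinearMap.finrank_range_add_finrank_ker (omegaTau p q)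
  rw [hsurj, finrank_top, Module.finrank_fin_fun, Module.finrank_fin_fun] at this
  omega

/-- The rank of the span is `n - 2` precisely when it does not contain `∂_λ`. -/
lemma finrank_charSpan_iff (hn : 2 ≤ n) (hq : ∀ i, q i ≠ 0) (hp : ∀ i j, i ≠ j → p i ≠ p j)
    (hA : ∀ i j, A i j = - A j i) :
    Module.finrank ℝ (charSpan p q A) + 2 = n ↔
      ∀ s : ℝ, ((0, s) : (Fin n → ℝ) × ℝ) ∈ charSpan p q A → s = 0 := by
  let π : charSpan p q A →ₗ[ℝ] (Fin n → ℝ) := (LinearMap.fst ℝ _ _).domRestrict _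
  have hrange : LinearMap.range π = LinearMap.ker (omegaTau p q) := by
    ext h
    rw [mem_ker_omegaTau, LinearMap.mem_range]
    constructor
    · rintro ⟨X, rfl⟩
      exact omega_tau_of_mem hq X.2
    · rintro ⟨h1, h2⟩
      obtain ⟨s, hs⟩ := exists_mem_charSpan hn hq hp hA h1 h2
      exact ⟨⟨_, hs⟩, rfl⟩
  have hk := finrank_ker_omegaTau hn hq hp
  have hrn := LinearMap.finrank_range_add_finrank_ker π
  rw [hrange] at hrn
  have hker : LinearMap.ker π = ⊥ ↔
      ∀ s : ℝ, ((0, s) : (Fin n → ℝ) × ℝ) ∈ charSpan p q A → s = 0 := by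
    rw [LinearMap.ker_eq_bot']
    constructor
    · intro h s hs
      have := h ⟨_, hs⟩ rfl
      exact congrArg (fun X => X.1.2) this
    · rintro h ⟨⟨X, s⟩, hX⟩ h0
      have hX0 : X = 0 := h0
      subst hX0
      have := h s hX
      subst this
      rfl
  rw [← hker, ← Submodule.finrank_eq_zero (R := ℝ)]
  omega

lemma finrank_charSpan_iff_wedge4 (hn : 2 ≤ n) (hq : ∀ i, q i ≠ 0)
    (hp : ∀ i j, i ≠ j → p i ≠ p j) (hA : ∀ i j, A i j = - A j i) :
    Module.finrank ℝ (charSpan p q A) + 2 = n ↔ ∀ i j k l, wedge4 p A i j k l = 0 := by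
  rw [finrank_charSpan_iff hn hq hp hA]
  refine ⟨fun h i j k l => h _ (wedge4_mem_charSpan hA i j k l), fun hw s hs => ?_⟩
  exact (isCharacteristic_of_mem hq hA hw hs).eq_zero_of_vertical hn hq hp

/-- Half of the 4-form `β ∧ β`, for a 2-form `β`, evaluated on four vectors. -/
def pfaff {E : Type*} (β : E → E → ℝ) (X₁ X₂ X₃ X₄ : E) : ℝ :=
  β X₁ X₂ * β X₃ X₄ - β X₁ X₃ * β X₂ X₄ + β X₁ X₄ * β X₂ X₃

/-- If the square of the 2-form vanishes on `ker ω` then `ω ∧ τ ∧ A = 0`: insert `∂_λ` and the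
differences of the frame vectors. -/
lemma wedge4_eq_zero_of_pfaff (hq : ∀ i, q i ≠ 0) (hA : ∀ i j, A i j = - A j i)
    (h : ∀ X₁ X₂ X₃ X₄ : (Fin n → ℝ) × ℝ, ∑ r, q r * X₁.1 r = 0 → ∑ r, q r * X₂.1 r = 0 →
      ∑ r, q r * X₃.1 r = 0 → ∑ r, q r * X₄.1 r = 0 → pfaff (twoForm p q A) X₁ X₂ X₃ X₄ = 0)
    (i j k l : Fin n) : wedge4 p A i j k l = 0 := by
  let e : Fin n → (Fin n → ℝ) × ℝ := fun b => (Pi.single b (q b)⁻¹ - Pi.single i (q i)⁻¹, 0)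
  have he : ∀ (c : Fin n → ℝ) b, ∑ r, c r * (q r * (e b).1 r) = c b - c i :=
    fun c b => sum_mul_frame_sub hq c i b
  have hω : ∀ b, ∑ r, q r * (e b).1 r = 0 := fun b => by
    have := he (fun _ => 1) b
    simpa using this
  have hv : ∀ b, twoForm p q A (0, 1) (e b) = - (p b - p i) := fun b => by
    simp [twoForm, he]
  have hh : ∀ b c, twoForm p q A (e b) (e c) = A b c - A i c - A b i + A i i := fun b c => by
    have e1 : ∀ r, ∑ s, A r s * (q r * (e b).1 r) * (q s * (e c).1 s)
        = (A r c - A r i) * (q r * (e b).1 r) := fun r => by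
      have := he (fun s => A r s) c
      rw [← this, Finset.sum_mul]
      exact Finset.sum_congr rfl fun s _ => by ring
    have e2 : (e b).2 = 0 := rfl
    have e3 : (e c).2 = 0 := rfl
    simp only [twoForm, e1, he (fun r => A r c - A r i), e2, e3]
    ring
  have := h (0, 1) (e j) (e k) (e l) (by simp) (hω j) (hω k) (hω l)
  simp only [pfaff, hv, hh] at this
  have hii : A i i = 0 := self_eq_neg.mp (hA i i)
  rw [hA k i, hA j i, hii] at this
  simp only [wedge4]
  linear_combination -this

/-- If `ω ∧ τ ∧ A = 0`, the 2-form is decomposable on `ker ω`. -/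
lemma pfaff_eq_zero_of_wedge4 (hn : 2 ≤ n) (hp : ∀ i j, i ≠ j → p i ≠ p j)
    (hA : ∀ i j, A i j = - A j i) (hw : ∀ i j k l, wedge4 p A i j k l = 0)
    {X₁ X₂ X₃ X₄ : (Fin n → ℝ) × ℝ} (h₁ : ∑ r, q r * X₁.1 r = 0) (h₂ : ∑ r, q r * X₂.1 r = 0)
    (h₃ : ∑ r, q r * X₃.1 r = 0) (h₄ : ∑ r, q r * X₄.1 r = 0) :
    pfaff (twoForm p q A) X₁ X₂ X₃ X₄ = 0 := by
  let a : Fin n := ⟨0, by omega⟩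
  let b : Fin n := ⟨1, by omega⟩
  have hab : a ≠ b := by simp [a, b, Fin.ext_iff]
  have hpab : p b - p a ≠ 0 := sub_ne_zero.mpr (hp b a hab.symm)
  let τ : (Fin n → ℝ) × ℝ → ℝ := fun X => ∑ r, p r * (q r * X.1 r)
  let σ : (Fin n → ℝ) × ℝ → ℝ := fun X =>
    (∑ r, cyc A a b r * (q r * X.1 r)) / (p b - p a) + X.2
  -- `ω ∧ τ ∧ A = 0` expresses `A` through its components with index `a` or `b`
  have hAkl : ∀ k l, A k l = ((p k) * cyc A a b l - p l * cyc A a b k) / (p b - p a)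
      + (A a l - A a k - p a * (cyc A a b l - cyc A a b k) / (p b - p a)) := fun k l => by
    have := hw a b k l
    simp only [wedge4] at this
    simp only [cyc]
    rw [hA l a, hA k a]
    field_simp
    linear_combination this
  have hdec : ∀ X Y : (Fin n → ℝ) × ℝ, ∑ r, q r * X.1 r = 0 → ∑ r, q r * Y.1 r = 0 →
      twoForm p q A X Y = τ X * σ Y - τ Y * σ X := by
    intro X Y hX hY
    have e1 : ∀ k, ∑ l, A k l * (q k * X.1 k) * (q l * Y.1 l)
        = (p k * (q k * X.1 k)) * (∑ r, cyc A a b r * (q r * Y.1 r)) / (p b - p a)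
          - (cyc A a b k * (q k * X.1 k)) * τ Y / (p b - p a)
          + (q k * X.1 k) * ∑ l, (A a l - p a * cyc A a b l / (p b - p a)) * (q l * Y.1 l) := by
      intro k
      have e2 : ∀ l, A k l * (q k * X.1 k) * (q l * Y.1 l)
          = (p k * (q k * X.1 k)) / (p b - p a) * (cyc A a b l * (q l * Y.1 l))
            - (cyc A a b k * (q k * X.1 k)) / (p b - p a) * (p l * (q l * Y.1 l))
            + (q k * X.1 k) * ((A a l - p a * cyc A a b l / (p b - p a)) * (q l * Y.1 l))
            + (q k * X.1 k) * (- A a k + p a * cyc A a b k / (p b - p a)) * (q l * Y.1 l) := by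
        intro l
        rw [hAkl k l]
        ring
      simp only [e2, Finset.sum_add_distrib, Finset.sum_sub_distrib, ← Finset.mul_sum, hY]
      simp only [τ]
      ring
    simp only [twoForm, e1, Finset.sum_add_distrib, Finset.sum_sub_distrib, ← Finset.sum_mul,
      ← Finset.sum_div, hX]
    simp only [τ, σ]
    ring
  simp only [pfaff, hdec _ _ h₁ h₂, hdec _ _ h₁ h₃, hdec _ _ h₁ h₄, hdec _ _ h₂ h₃, hdec _ _ h₂ h₄,
    hdec _ _ h₃ h₄]
  ring

end Linear

/-! ### Partial derivatives -/

section PartialDerivatives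

variable {n : ℕ} {f g : (Fin n → ℝ) → ℝ} {x : Fin n → ℝ}

lemma contDiffAt_pd (i : Fin n) (hf : ContDiffAt ℝ ∞ f x) : ContDiffAt ℝ ∞ (pd i f) x :=
  (hf.fderiv_right (m := ∞) (by simp)).clm_apply contDiffAt_const

lemma contDiffAt_pd2 (i j : Fin n) (hf : ContDiffAt ℝ ∞ f x) : ContDiffAt ℝ ∞ (pd2 i j f) x :=
  contDiffAt_pd j (contDiffAt_pd i hf)

lemma ContDiffAt.differentiableAt_infty {E F : Type*} [NormedAddCommGroup E] [NormedSpace ℝ E]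
    [NormedAddCommGroup F] [NormedSpace ℝ F] {f : E → F} {x : E} (hf : ContDiffAt ℝ ∞ f x) :
    DifferentiableAt ℝ f x := hf.differentiableAt (by simp)

lemma ContDiffAt.eventually_infty {E F : Type*} [NormedAddCommGroup E] [NormedSpace ℝ E]
    [FiniteDimensional ℝ E] [NormedAddCommGroup F] [NormedSpace ℝ F] {f : E → F} {x : E}
    (hf : ContDiffAt ℝ ∞ f x) : ∀ᶠ y in nhds x, DifferentiableAt ℝ f y := by
  have := (hf.of_le (m := 1) (by simp)).eventually (by simp)
  exact this.mono fun y hy => hy.differentiableAt (by simp)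

lemma fderiv_eq_sum_pd (h : Fin n → ℝ) : fderiv ℝ f x h = ∑ i, h i * pd i f x := by
  conv_lhs => rw [pi_eq_sum_univ' h]
  simp [pd, map_sum]

lemma pd2_comm_of_contDiffAt_two (i j : Fin n) (hf : ContDiffAt ℝ 2 f x) :
    pd2 i j f x = pd2 j i f x := by
  have hd : DifferentiableAt ℝ (fderiv ℝ f) x :=
    (hf.fderiv_right (m := 1) (by norm_num)).differentiableAt (by simp)
  have h : ∀ i j : Fin n, pd2 i j f x
      = fderiv ℝ (fderiv ℝ f) x (Pi.single j 1) (Pi.single i 1) := fun i j => by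
    unfold pd2
    change fderiv ℝ (fun y => fderiv ℝ f y (Pi.single i 1)) x (Pi.single j 1) = _
    rw [fderiv_clm_apply hd (differentiableAt_const _)]
    simp
  rw [h, h]
  refine hf.isSymmSndFDerivAt ?_ _ _
  rw [minSmoothness_of_isRCLikeNormedField]

lemma contDiffAt_two_of_infty (hf : ContDiffAt ℝ ∞ f x) : ContDiffAt ℝ 2 f x :=
  hf.of_le (WithTop.coe_le_coe.mpr le_top)

lemma pd2_comm (i j : Fin n) (hf : ContDiffAt ℝ ∞ f x) : pd2 i j f x = pd2 j i f x :=
  pd2_comm_of_contDiffAt_two i j (contDiffAt_two_of_infty hf)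

lemma pd_pd_comm_eventuallyEq (i j : Fin n) (hf : ContDiffAt ℝ ∞ f x) :
    pd j (pd i f) =ᶠ[nhds x] pd i (pd j f) :=
  ((contDiffAt_two_of_infty hf).eventually (by simp)).mono fun _ hy =>
    pd2_comm_of_contDiffAt_two i j hy

lemma pd_congr (i : Fin n) (h : f =ᶠ[nhds x] g) : pd i f =ᶠ[nhds x] pd i g :=
  h.eventuallyEq_nhds.mono fun y hy => by simp only [pd, hy.fderiv_eq]

end PartialDerivatives

/-! ### The coframe and the structure functions -/

section Structure

variable {n : ℕ} (u v : (Fin n → ℝ) → ℝ)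

/-- `pᵢ = 1 / (λ - aᵢ)`. -/
def pole (x : Fin n → ℝ) (t : ℝ) (i : Fin n) : ℝ := (t - aRatio u v i x)⁻¹

/-- `qᵢ = uᵢ / (λ - aᵢ)`, the coefficient of `dxⁱ` in `ω(λ)` with the denominators kept. -/
def coeffQ (x : Fin n → ℝ) (t : ℝ) (i : Fin n) : ℝ := pd i u x * pole u v x t i

/-- `(2uᵢⱼ - (aᵢ+aⱼ)vᵢⱼ) / (uᵢuⱼ)`, the building block of `exprE`. -/
def termE (i j : Fin n) (x : Fin n → ℝ) : ℝ :=
  (2 * pd2 i j u x - (aRatio u v i x + aRatio u v j x) * pd2 i j v x) / (pd i u x * pd j u x)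

/-- `(2aᵢaⱼvᵢⱼ - (aᵢ+aⱼ)uᵢⱼ) / (uᵢuⱼ)`, the building block of `exprF` expressed through the `aᵢ`. -/
def termF (i j : Fin n) (x : Fin n → ℝ) : ℝ :=
  (2 * (aRatio u v i x * aRatio u v j x) * pd2 i j v x
    - (aRatio u v i x + aRatio u v j x) * pd2 i j u x) / (pd i u x * pd j u x)

/-- The components of the horizontal part of `dω`, for `ω = ∑ qᵢ dxⁱ`, in the coframe `qᵢ dxⁱ`. -/
def curv (x : Fin n → ℝ) (t : ℝ) (i j : Fin n) : ℝ :=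
  t * (pole u v x t j - pole u v x t i) * (t * termE u v i j x + termF u v i j x)

/-- `aᵢaⱼaₖaₗ Fᵢⱼₖₗ`. -/
def scaledF (i j k l : Fin n) (x : Fin n → ℝ) : ℝ :=
  aRatio u v i x * aRatio u v j x * aRatio u v k x * aRatio u v l x * exprF u v i j k l x

variable {u v} {x : Fin n → ℝ} {t : ℝ}

lemma NondegenerateAt.aRatio_ne_zero (hx : NondegenerateAt u v x) (i : Fin n) :
    aRatio u v i x ≠ 0 := div_ne_zero (hx.1 i) (hx.2.1 i)

lemma NondegenerateAt.swap (hx : NondegenerateAt u v x) : NondegenerateAt v u x := by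
  refine ⟨hx.2.1, hx.1, fun i j hij h => hx.2.2 i j hij ?_⟩
  have := congrArg (·⁻¹) h
  simpa [aRatio, inv_div] using this

lemma termE_comm (hu : ContDiffAt ℝ ∞ u x) (hv : ContDiffAt ℝ ∞ v x) (i j : Fin n) :
    termE u v i j x = termE u v j i x := by
  simp only [termE]
  rw [pd2_comm i j hu, pd2_comm i j hv, add_comm, mul_comm (pd i u x)]

lemma termF_comm (hu : ContDiffAt ℝ ∞ u x) (hv : ContDiffAt ℝ ∞ v x) (i j : Fin n) :
    termF u v i j x = termF u v j i x := by
  simp only [termF]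
  rw [pd2_comm i j hu, pd2_comm i j hv, add_comm (aRatio u v i x), mul_comm (pd i u x),
    mul_comm (aRatio u v i x)]

lemma curv_antisymm (hu : ContDiffAt ℝ ∞ u x) (hv : ContDiffAt ℝ ∞ v x) (i j : Fin n) :
    curv u v x t i j = - curv u v x t j i := by
  simp only [curv]
  rw [termE_comm hu hv i j, termF_comm hu hv i j]
  ring

lemma pole_ne_zero {i : Fin n} (ht : t ≠ aRatio u v i x) : pole u v x t i ≠ 0 :=
  inv_ne_zero (sub_ne_zero.mpr ht)

lemma pole_injective (hx : NondegenerateAt u v x) (i j : Fin n)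
    (hij : i ≠ j) : pole u v x t i ≠ pole u v x t j := fun h =>
  hx.2.2 i j hij (by
    have := inv_injective h
    linarith)

lemma coeffQ_ne_zero (hx : NondegenerateAt u v x) {i : Fin n} (ht : t ≠ aRatio u v i x) :
    coeffQ u v x t i ≠ 0 := mul_ne_zero (hx.1 i) (pole_ne_zero ht)

lemma pole_sub_pole {i j : Fin n} (hi : t ≠ aRatio u v i x)
    (hj : t ≠ aRatio u v j x) : pole u v x t j - pole u v x t i
      = (aRatio u v j x - aRatio u v i x) * (pole u v x t i * pole u v x t j) := by
  have := sub_ne_zero.mpr hi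
  have := sub_ne_zero.mpr hj
  simp only [pole]
  field_simp
  ring

lemma summandE_eq (i j k l : Fin n) : summandE u v i j k l x
    = (aRatio u v i x - aRatio u v j x) * (aRatio u v k x - aRatio u v l x)
      * (termE u v i j x + termE u v k l x) := rfl

lemma scaledF_eq (hx : NondegenerateAt u v x) (i j k l : Fin n) : scaledF u v i j k l x
    = (aRatio u v i x - aRatio u v j x) * (aRatio u v k x - aRatio u v l x)
        * (termF u v i j x + termF u v k l x)
      + (aRatio u v i x - aRatio u v k x) * (aRatio u v l x - aRatio u v j x)
        * (termF u v i k x + termF u v l j x)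
      + (aRatio u v i x - aRatio u v l x) * (aRatio u v j x - aRatio u v k x)
        * (termF u v i l x + termF u v j k x) := by
  have key : ∀ i j k l : Fin n, aRatio u v i x * aRatio u v j x * aRatio u v k x * aRatio u v l x
      * summandE v u i j k l x = (aRatio u v i x - aRatio u v j x)
        * (aRatio u v k x - aRatio u v l x) * (termF u v i j x + termF u v k l x) := by
    intro i j k l
    have := hx.1 i; have := hx.1 j; have := hx.1 k; have := hx.1 l
    have := hx.2.1 i; have := hx.2.1 j; have := hx.2.1 k; have := hx.2.1 l
    simp only [summandE, aRatio, termF]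
    field_simp
    ring
  rw [← key, ← key, ← key, scaledF, exprF, exprE]
  ring

lemma wedge4_curv (hu : ContDiffAt ℝ ∞ u x) (hv : ContDiffAt ℝ ∞ v x)
    (hx : NondegenerateAt u v x) (ht : ∀ i, t ≠ aRatio u v i x) (i j k l : Fin n) :
    wedge4 (pole u v x t) (curv u v x t) i j k l
      = t * (pole u v x t i * pole u v x t j * pole u v x t k * pole u v x t l)
        * (t * exprE u v i j k l x + scaledF u v i j k l x) := by
  have h := fun i j => pole_sub_pole (ht i) (ht j)
  rw [scaledF_eq hx, exprE]
  simp only [summandE_eq, wedge4, curv, h]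
  rw [termE_comm hu hv l j, termF_comm hu hv l j]
  ring

/-- An expression that is affine in `λ` and vanishes away from the `aᵢ` vanishes identically. -/
lemma eq_zero_of_affine {ι : Type*} [Finite ι] {a : ι → ℝ} {e f : ℝ}
    (h : ∀ t : ℝ, t ≠ 0 → (∀ i, t ≠ a i) → t * e + f = 0) : e = 0 ∧ f = 0 := by
  have hfin : (insert 0 (Set.range a)).Finite := (Set.finite_range a).insert 0
  obtain ⟨t, ht⟩ := hfin.infinite_compl.nonempty
  obtain ⟨s, hs⟩ := (hfin.insert t).infinite_compl.nonempty
  simp only [Set.mem_compl_iff, Set.mem_insert_iff, Set.mem_range, not_or, not_exists] at ht hs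
  have h1 := h t ht.1 fun i hi => ht.2 i hi.symm
  have h2 := h s hs.2.1 fun i hi => hs.2.2 i hi.symm
  have he : e = 0 := by
    have : (s - t) * e = 0 := by linarith
    exact (mul_eq_zero.mp this).resolve_left (sub_ne_zero.mpr hs.1)
  refine ⟨he, ?_⟩
  rw [he] at h1
  linarith

lemma wedge4_eq_zero_of_not_distinct {p : Fin n → ℝ} {A : Fin n → Fin n → ℝ}
    (hA : ∀ i j, A i j = - A j i) {i j k l : Fin n} (h : ¬ Distinct4 i j k l) :
    wedge4 p A i j k l = 0 := by
  have hii : ∀ i, A i i = 0 := fun i => self_eq_neg.mp (hA i i)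
  have key : i = j ∨ i = k ∨ i = l ∨ j = k ∨ j = l ∨ k = l := by
    by_contra hc
    push Not at hc
    exact h hc
  simp only [wedge4]
  rcases key with rfl | rfl | rfl | rfl | rfl | rfl
  · rw [hii]; ring
  · rw [hA j i, hii]; ring
  · rw [hA j i, hA k i, hii]; ring
  · rw [hii]; ring
  · rw [hA k j, hii]; ring
  · rw [hii]; ring

/-- The system is `ω ∧ τ ∧ dω = 0` for all `λ`: the components of this form are
`λEᵢⱼₖₗ + aᵢaⱼaₖaₗ Fᵢⱼₖₗ` up to factors without zeros off `λ = 0`. -/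
lemma system_iff_wedge4 (hu : ContDiffAt ℝ ∞ u x) (hv : ContDiffAt ℝ ∞ v x)
    (hx : NondegenerateAt u v x) :
    (∀ i j k l : Fin n, Distinct4 i j k l → exprE u v i j k l x = 0 ∧ exprF u v i j k l x = 0) ↔
      ∀ t : ℝ, (∀ i, t ≠ aRatio u v i x) →
        ∀ i j k l, wedge4 (pole u v x t) (curv u v x t) i j k l = 0 := by
  constructor
  · intro h t ht i j k l
    by_cases hd : Distinct4 i j k l
    · obtain ⟨h1, h2⟩ := h i j k l hd
      rw [wedge4_curv hu hv hx ht, scaledF, h1, h2]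
      ring
    · exact wedge4_eq_zero_of_not_distinct (curv_antisymm hu hv) hd
  · intro h i j k l _
    have : exprE u v i j k l x = 0 ∧ scaledF u v i j k l x = 0 := by
      refine eq_zero_of_affine (a := fun i => aRatio u v i x) fun t ht0 ht => ?_
      have := h t ht i j k l
      rw [wedge4_curv hu hv hx ht] at this
      refine (mul_eq_zero.mp this).resolve_left (mul_ne_zero ht0 ?_)
      exact mul_ne_zero (mul_ne_zero (mul_ne_zero (pole_ne_zero (ht i)) (pole_ne_zero (ht j)))
        (pole_ne_zero (ht k))) (pole_ne_zero (ht l))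
    refine ⟨this.1, (mul_eq_zero.mp this.2).resolve_left ?_⟩
    have ha := hx.aRatio_ne_zero
    exact mul_ne_zero (mul_ne_zero (mul_ne_zero (ha i) (ha j)) (ha k)) (ha l)

/-- The Lax fields are the characteristic vectors in the frame dual to the `qᵢ dxⁱ`. -/
lemma laxField_eq_charVec (hu : ContDiffAt ℝ ∞ u x) (hv : ContDiffAt ℝ ∞ v x)
    (hx : NondegenerateAt u v x) (ht : ∀ i, t ≠ aRatio u v i x) (i j k : Fin n) :
    laxField u v i j k (x, t)
      = charVec (pole u v x t) (coeffQ u v x t) (curv u v x t) i j k := by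
  have e : ∀ i, (t - aRatio u v i x) / pd i u x = 1 / coeffQ u v x t i := fun i => by
    simp only [coeffQ, pole]
    rw [one_div, mul_inv, inv_inv, div_eq_mul_inv, mul_comm]
  refine Prod.ext ?_ ?_
  · funext r
    simp only [laxField, charVec, Pi.add_apply, Pi.smul_apply, smul_eq_mul, e]
    simp only [pole]
    ring
  · simp only [laxField, charVec, coeffS, cyc, curv, neg_inj]
    rw [termE_comm hu hv k i, termF_comm hu hv k i]
    have := sub_ne_zero.mpr (ht i)
    have := sub_ne_zero.mpr (ht j)
    have := sub_ne_zero.mpr (ht k)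
    have := hx.1 i; have := hx.1 j; have := hx.1 k
    simp only [pole, termE, termF]
    generalize aRatio u v i x = a at *
    generalize aRatio u v j x = b at *
    generalize aRatio u v k x = c at *
    have key : ∀ a b U V y z : ℝ, t - a ≠ 0 → t - b ≠ 0 → y ≠ 0 → z ≠ 0 →
        U * ((b - a) / (y * z)) * (t / (t - a) + t / (t - b))
          - V * ((b - a) / (y * z)) * (t * a / (t - a) + t * b / (t - b))
        = t * ((t - b)⁻¹ - (t - a)⁻¹) * (t * ((2 * U - (a + b) * V) / (y * z))
            + (2 * (a * b) * V - (a + b) * U) / (y * z)) := by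
      intro a b U V y z _ _ _ _
      field_simp
      ring
    have k1 := key a b (pd2 i j u x) (pd2 i j v x) (pd i u x) (pd j u x)
      ‹_› ‹_› ‹_› ‹_›
    have k2 := key b c (pd2 j k u x) (pd2 j k v x) (pd j u x) (pd k u x)
      ‹_› ‹_› ‹_› ‹_›
    have k3 := key a c (pd2 i k u x) (pd2 i k v x) (pd i u x) (pd k u x)
      ‹_› ‹_› ‹_› ‹_›
    linear_combination k1 + k2 - k3

lemma laxDistribution_eq_charSpan (hu : ContDiffAt ℝ ∞ u x) (hv : ContDiffAt ℝ ∞ v x)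
    (hx : NondegenerateAt u v x) (ht : ∀ i, t ≠ aRatio u v i x) :
    laxDistribution u v (x, t)
      = charSpan (pole u v x t) (coeffQ u v x t) (curv u v x t) := by
  simp only [laxDistribution, charSpan, laxField_eq_charVec hu hv hx ht]

end Structure

/-! ### Smoothness on the correspondence space -/

section Smoothness

variable {n : ℕ} {u v : (Fin n → ℝ) → ℝ} {x : Fin n → ℝ}

lemma contDiffAt_aRatio (hu : ContDiffAt ℝ ∞ u x) (hv : ContDiffAt ℝ ∞ v x)
    {i : Fin n} (hx : pd i v x ≠ 0) : ContDiffAt ℝ ∞ (aRatio u v i) x :=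
  (contDiffAt_pd i hu).div (contDiffAt_pd i hv) hx

lemma contDiffAt_pole (hu : ContDiffAt ℝ ∞ u x) (hv : ContDiffAt ℝ ∞ v x) {i : Fin n}
    (hx : pd i v x ≠ 0) {t : ℝ} (ht : t ≠ aRatio u v i x) :
    ContDiffAt ℝ ∞ (fun p : (Fin n → ℝ) × ℝ => pole u v p.1 p.2 i) (x, t) := by
  have h1 : ContDiffAt ℝ ∞ (fun p : (Fin n → ℝ) × ℝ => aRatio u v i p.1) (x, t) :=
    (contDiffAt_aRatio hu hv hx).comp (x, t) contDiffAt_fst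
  exact (contDiffAt_snd.sub h1).inv (sub_ne_zero.mpr ht)

lemma contDiffAt_coeffQ (hu : ContDiffAt ℝ ∞ u x) (hv : ContDiffAt ℝ ∞ v x) {i : Fin n}
    (hx : pd i v x ≠ 0) {t : ℝ} (ht : t ≠ aRatio u v i x) :
    ContDiffAt ℝ ∞ (fun p : (Fin n → ℝ) × ℝ => coeffQ u v p.1 p.2 i) (x, t) :=
  ContDiffAt.mul (ContDiffAt.comp (x, t) (contDiffAt_pd i hu) contDiffAt_fst)
    (contDiffAt_pole hu hv hx ht)

lemma contDiffAt_termE (hu : ContDiffAt ℝ ∞ u x) (hv : ContDiffAt ℝ ∞ v x)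
    (hx : NondegenerateAt u v x) (i j : Fin n) : ContDiffAt ℝ ∞ (termE u v i j) x := by
  have ha := fun i => contDiffAt_aRatio hu hv (hx.2.1 i)
  refine ContDiffAt.div ?_ ((contDiffAt_pd i hu).mul (contDiffAt_pd j hu))
    (mul_ne_zero (hx.1 i) (hx.1 j))
  exact (contDiffAt_const.mul (contDiffAt_pd2 i j hu)).sub
    (((ha i).add (ha j)).mul (contDiffAt_pd2 i j hv))

lemma contDiffAt_termF (hu : ContDiffAt ℝ ∞ u x) (hv : ContDiffAt ℝ ∞ v x)
    (hx : NondegenerateAt u v x) (i j : Fin n) : ContDiffAt ℝ ∞ (termF u v i j) x := by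
  have ha := fun i => contDiffAt_aRatio hu hv (hx.2.1 i)
  refine ContDiffAt.div ?_ ((contDiffAt_pd i hu).mul (contDiffAt_pd j hu))
    (mul_ne_zero (hx.1 i) (hx.1 j))
  exact ((contDiffAt_const.mul ((ha i).mul (ha j))).mul (contDiffAt_pd2 i j hv)).sub
    (((ha i).add (ha j)).mul (contDiffAt_pd2 i j hu))

lemma contDiffAt_exprE (hu : ContDiffAt ℝ ∞ u x) (hv : ContDiffAt ℝ ∞ v x)
    (hx : NondegenerateAt u v x) (i j k l : Fin n) : ContDiffAt ℝ ∞ (exprE u v i j k l) x := by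
  have ha := fun i => contDiffAt_aRatio hu hv (hx.2.1 i)
  have hE := contDiffAt_termE hu hv hx
  have hs : ∀ i j k l, ContDiffAt ℝ ∞ (summandE u v i j k l) x := fun i j k l =>
    (((ha i).sub (ha j)).mul ((ha k).sub (ha l))).mul ((hE i j).add (hE k l))
  exact ((hs i j k l).add (hs i k l j)).add (hs i l j k)

lemma contDiffAt_curv (hu : ContDiffAt ℝ ∞ u x) (hv : ContDiffAt ℝ ∞ v x)
    (hx : NondegenerateAt u v x) {t : ℝ} (ht : ∀ i, t ≠ aRatio u v i x) (i j : Fin n) :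
    ContDiffAt ℝ ∞ (fun p : (Fin n → ℝ) × ℝ => curv u v p.1 p.2 i j) (x, t) := by
  have hp := fun i => contDiffAt_pole hu hv (hx.2.1 i) (ht i)
  have hE : ContDiffAt ℝ ∞ (fun p : (Fin n → ℝ) × ℝ => termE u v i j p.1) (x, t) :=
    ContDiffAt.comp (x, t) (contDiffAt_termE hu hv hx i j) contDiffAt_fst
  have hF : ContDiffAt ℝ ∞ (fun p : (Fin n → ℝ) × ℝ => termF u v i j p.1) (x, t) :=
    ContDiffAt.comp (x, t) (contDiffAt_termF hu hv hx i j) contDiffAt_fst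
  exact (contDiffAt_snd.mul ((hp j).sub (hp i))).mul ((contDiffAt_snd.mul hE).add hF)

lemma NondegeneratePair.contDiffAt {U : Set (Fin n → ℝ)} (hU : IsOpen U)
    (h : NondegeneratePair U u v) (hx : x ∈ U) : ContDiffAt ℝ ∞ u x ∧ ContDiffAt ℝ ∞ v x :=
  ⟨h.1.contDiffAt (hU.mem_nhds hx), h.2.1.contDiffAt (hU.mem_nhds hx)⟩

lemma corrSpace_mem_nhds {U : Set (Fin n → ℝ)} (hU : IsOpen U) (h : NondegeneratePair U u v)
    {p : (Fin n → ℝ) × ℝ} (hp : p ∈ corrSpace U u v) : corrSpace U u v ∈ nhds p := by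
  have hd := h.contDiffAt hU hp.1
  have h1 : ∀ᶠ p' : (Fin n → ℝ) × ℝ in nhds p, p'.1 ∈ U :=
    continuousAt_fst.eventually (hU.mem_nhds hp.1)
  have h2 : ∀ᶠ p' : (Fin n → ℝ) × ℝ in nhds p, ∀ i, p'.2 ≠ aRatio u v i p'.1 := by
    rw [Filter.eventually_all]
    intro i
    have hc : ContinuousAt (fun p' : (Fin n → ℝ) × ℝ => aRatio u v i p'.1) p :=
      ContinuousAt.comp (f := Prod.fst) (g := aRatio u v i)
        (contDiffAt_aRatio hd.1 hd.2 ((h.2.2 _ hp.1).2.1 i)).continuousAt continuousAt_fst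
    exact continuousAt_snd.ne_iff_eventually_ne hc |>.mp (hp.2 i)
  exact h1.and h2

end Smoothness

/-! ### The 1-form `ω(λ)` and its differential -/

section Forms

variable {n : ℕ}

/-- The derivative of `qᵢ = uᵢ / (λ - aᵢ)`. -/
lemma fderiv_coeffQ {u v : (Fin n → ℝ) → ℝ} {x : Fin n → ℝ}
    (hu : ContDiffAt ℝ ∞ u x) (hv : ContDiffAt ℝ ∞ v x) {i : Fin n}
    (hx : pd i v x ≠ 0) {t : ℝ} (ht : t ≠ aRatio u v i x) (X : (Fin n → ℝ) × ℝ) :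
    fderiv ℝ (fun p : (Fin n → ℝ) × ℝ => coeffQ u v p.1 p.2 i) (x, t) X
      = ∑ j, X.1 j * (pole u v x t i ^ 2 * (t * pd2 i j u x - aRatio u v i x ^ 2 * pd2 i j v x))
        - X.2 * (pd i u x * pole u v x t i ^ 2) := by
  have hdu : HasFDerivAt (fun p : (Fin n → ℝ) × ℝ => pd i u p.1)
      ((fderiv ℝ (pd i u) x).comp (ContinuousLinearMap.fst ℝ (Fin n → ℝ) ℝ)) (x, t) :=
    HasFDerivAt.comp (x, t) (f := Prod.fst)
      (contDiffAt_pd i hu).differentiableAt_infty.hasFDerivAt hasFDerivAt_fst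
  have hdv : HasFDerivAt (fun p : (Fin n → ℝ) × ℝ => pd i v p.1)
      ((fderiv ℝ (pd i v) x).comp (ContinuousLinearMap.fst ℝ (Fin n → ℝ) ℝ)) (x, t) :=
    HasFDerivAt.comp (x, t) (f := Prod.fst)
      (contDiffAt_pd i hv).differentiableAt_infty.hasFDerivAt hasFDerivAt_fst
  have hvi : HasFDerivAt (fun p : (Fin n → ℝ) × ℝ => (pd i v p.1)⁻¹) _ (x, t) :=
    (hasDerivAt_inv hx).comp_hasFDerivAt (x, t) hdv
  have hpi : HasFDerivAt (fun p : (Fin n → ℝ) × ℝ => (p.2 - pd i u p.1 * (pd i v p.1)⁻¹)⁻¹)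
      _ (x, t) :=
    (hasDerivAt_inv (by
      rw [← div_eq_mul_inv]; exact sub_ne_zero.mpr ht)).comp_hasFDerivAt (x, t)
      (hasFDerivAt_snd.fun_sub (hdu.fun_mul hvi))
  have hq := hdu.fun_mul hpi
  have e : (fun p : (Fin n → ℝ) × ℝ => coeffQ u v p.1 p.2 i)
      = fun p => pd i u p.1 * (p.2 - pd i u p.1 * (pd i v p.1)⁻¹)⁻¹ := by
    funext p
    simp only [coeffQ, pole, aRatio, div_eq_mul_inv]
  rw [e, hq.fderiv]
  have e1 : ∑ j, X.1 j * (pole u v x t i ^ 2 *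
        (t * pd2 i j u x - aRatio u v i x ^ 2 * pd2 i j v x))
      = pole u v x t i ^ 2 * (t * fderiv ℝ (pd i u) x X.1
        - aRatio u v i x ^ 2 * fderiv ℝ (pd i v) x X.1) := by
    rw [fderiv_eq_sum_pd, fderiv_eq_sum_pd, Finset.mul_sum, Finset.mul_sum,
      ← Finset.sum_sub_distrib, Finset.mul_sum]
    exact Finset.sum_congr rfl fun j _ => by simp only [pd2]; ring
  rw [e1]
  simp only [add_apply, smul_apply, smul_eq_mul,
    sub_apply, ContinuousLinearMap.comp_apply, ContinuousLinearMap.coe_fst',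
    ContinuousLinearMap.coe_snd', pole, aRatio]
  have h1 : t * pd i v x - pd i u x ≠ 0 := by
    intro h
    apply ht
    rw [aRatio, eq_div_iff hx]
    linarith
  have h2 : t - pd i u x / pd i v x = (t * pd i v x - pd i u x) / pd i v x := by
    field_simp
  rw [← div_eq_mul_inv, h2]
  field_simp
  ring

/-- The 1-form `∑ cᵢ dxⁱ` on the `(x, λ)`-space. -/
def horizontalForm (c : Fin n → (Fin n → ℝ) × ℝ → ℝ) (p : (Fin n → ℝ) × ℝ) :
    ((Fin n → ℝ) × ℝ) →L[ℝ] ℝ :=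
  ∑ i, c i p • (ContinuousLinearMap.proj i : (Fin n → ℝ) →L[ℝ] ℝ).comp
    (ContinuousLinearMap.fst ℝ (Fin n → ℝ) ℝ)

lemma horizontalForm_apply (c : Fin n → (Fin n → ℝ) × ℝ → ℝ) (p X : (Fin n → ℝ) × ℝ) :
    horizontalForm c p X = ∑ i, c i p * X.1 i := by
  simp [horizontalForm]

lemma hasFDerivAt_horizontalForm {c : Fin n → (Fin n → ℝ) × ℝ → ℝ} {p : (Fin n → ℝ) × ℝ}
    (hc : ∀ i, DifferentiableAt ℝ (c i) p) :
    HasFDerivAt (horizontalForm c) (∑ i, (fderiv ℝ (c i) p).smulRight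
      ((ContinuousLinearMap.proj i : (Fin n → ℝ) →L[ℝ] ℝ).comp
        (ContinuousLinearMap.fst ℝ (Fin n → ℝ) ℝ))) p := by
  unfold horizontalForm
  exact HasFDerivAt.fun_sum fun i _ => (hc i).hasFDerivAt.smul_const
    ((ContinuousLinearMap.proj i : (Fin n → ℝ) →L[ℝ] ℝ).comp
      (ContinuousLinearMap.fst ℝ (Fin n → ℝ) ℝ))

lemma dForm_horizontalForm {c : Fin n → (Fin n → ℝ) × ℝ → ℝ} {p : (Fin n → ℝ) × ℝ}
    (hc : ∀ i, DifferentiableAt ℝ (c i) p) (X Y : (Fin n → ℝ) × ℝ) :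
    dForm (horizontalForm c) p X Y
      = ∑ i, (fderiv ℝ (c i) p X * Y.1 i - fderiv ℝ (c i) p Y * X.1 i) := by
  rw [dForm, (hasFDerivAt_horizontalForm hc).fderiv]
  simp [Finset.sum_sub_distrib]

lemma dForm_congr {θ θ' : ((Fin n → ℝ) × ℝ) → (((Fin n → ℝ) × ℝ) →L[ℝ] ℝ)}
    {p : (Fin n → ℝ) × ℝ} (h : θ =ᶠ[nhds p] θ') (X Y : (Fin n → ℝ) × ℝ) :
    dForm θ p X Y = dForm θ' p X Y := by
  simp only [dForm, h.fderiv_eq]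

lemma contactForm_structureForm (u v : (Fin n → ℝ) → ℝ) :
    contactForm (structureForm u v) = horizontalForm
      (fun i p => (∏ j ∈ Finset.univ.erase i, (p.2 - aRatio u v j p.1)) * pd i u p.1) := by
  funext p
  ext X <;> simp [contactForm, structureForm, horizontalForm]

/-- The 1-form `∑ uᵢ / (λ - aᵢ) dxⁱ`. -/
def omegaForm (u v : (Fin n → ℝ) → ℝ) :
    (Fin n → ℝ) × ℝ → (((Fin n → ℝ) × ℝ) →L[ℝ] ℝ) :=
  horizontalForm fun i p => coeffQ u v p.1 p.2 i

variable {u v : (Fin n → ℝ) → ℝ} {x : Fin n → ℝ} {t : ℝ}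

/-- The differential of `∑ uᵢ / (λ - aᵢ) dxⁱ` has the components `curv` in the coframe
`uᵢ / (λ - aᵢ) dxⁱ`. -/
lemma dForm_omegaForm (hu : ContDiffAt ℝ ∞ u x) (hv : ContDiffAt ℝ ∞ v x)
    (hx : NondegenerateAt u v x) (ht : ∀ i, t ≠ aRatio u v i x) (X Y : (Fin n → ℝ) × ℝ) :
    dForm (omegaForm u v) (x, t) X Y
      = twoForm (pole u v x t) (coeffQ u v x t) (curv u v x t) X Y := by
  rw [omegaForm, dForm_horizontalForm fun i =>
    (contDiffAt_coeffQ hu hv (hx.2.1 i) (ht i)).differentiableAt_infty]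
  simp only [fderiv_coeffQ hu hv (hx.2.1 _) (ht _)]
  set B : Fin n → Fin n → ℝ := fun i j =>
    pole u v x t i ^ 2 * (t * pd2 i j u x - aRatio u v i x ^ 2 * pd2 i j v x) with hB
  have hAB : ∀ i j, curv u v x t i j * coeffQ u v x t i * coeffQ u v x t j = B j i - B i j := by
    intro i j
    have := sub_ne_zero.mpr (ht i)
    have := sub_ne_zero.mpr (ht j)
    have := hx.1 i; have := hx.1 j
    simp only [hB, curv, coeffQ, pole, termE, termF]
    rw [pd2_comm j i hu, pd2_comm j i hv]
    generalize aRatio u v i x = a at *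
    generalize aRatio u v j x = b at *
    field_simp
    ring
  have e1 : ∀ i, ∑ j, curv u v x t i j * (coeffQ u v x t i * X.1 i) * (coeffQ u v x t j * Y.1 j)
      = ∑ j, B j i * X.1 i * Y.1 j - ∑ j, B i j * X.1 i * Y.1 j := by
    intro i
    rw [← Finset.sum_sub_distrib]
    exact Finset.sum_congr rfl fun j _ => by
      linear_combination (X.1 i * Y.1 j) * hAB i j
  simp only [twoForm, e1, Finset.sum_sub_distrib]
  rw [Finset.sum_comm (f := fun i j => B j i * X.1 i * Y.1 j)]
  simp only [sub_mul, Finset.sum_sub_distrib, Finset.sum_mul, Finset.mul_sum]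
  have e2 : ∀ i, pole u v x t i * (coeffQ u v x t i * Y.1 i)
      = pd i u x * pole u v x t i ^ 2 * Y.1 i := fun i => by simp only [coeffQ]; ring
  have e3 : ∀ i, pole u v x t i * (coeffQ u v x t i * X.1 i)
      = pd i u x * pole u v x t i ^ 2 * X.1 i := fun i => by simp only [coeffQ]; ring
  simp only [e2, e3]
  have e4 : ∀ i j, pole u v x t i ^ 2 *
      (t * pd2 i j u x - aRatio u v i x ^ 2 * pd2 i j v x) = B i j := fun i j => rfl
  simp only [e4]
  have e5 : ∀ i j, Y.1 j * B i j * X.1 i = B i j * X.1 i * Y.1 j := fun i j => by ring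
  have e6 : ∀ i j, X.1 j * B i j * Y.1 i = B i j * X.1 j * Y.1 i := fun i j => by ring
  simp only [e5, e6]
  ring_nf

/-- On the correspondence space `ω(λ)` is `∏ (λ - aⱼ)` times `∑ uᵢ / (λ - aᵢ) dxⁱ`. -/
lemma contactForm_eq_smul (ht : ∀ i, t ≠ aRatio u v i x) :
    contactForm (structureForm u v) (x, t)
      = (∏ j, (t - aRatio u v j x)) • omegaForm u v (x, t) := by
  rw [contactForm_structureForm, omegaForm, horizontalForm, horizontalForm, Finset.smul_sum]
  refine Finset.sum_congr rfl fun i _ => ?_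
  rw [smul_smul]
  congr 1
  rw [← Finset.mul_prod_erase _ _ (Finset.mem_univ i)]
  have := sub_ne_zero.mpr (ht i)
  simp only [coeffQ, pole]
  field_simp

lemma contDiffAt_structure_coeff (hu : ContDiffAt ℝ ∞ u x) (hv : ContDiffAt ℝ ∞ v x)
    (hx : NondegenerateAt u v x) (i : Fin n) :
    ContDiffAt ℝ ∞ (fun p : (Fin n → ℝ) × ℝ =>
      (∏ j ∈ Finset.univ.erase i, (p.2 - aRatio u v j p.1)) * pd i u p.1) (x, t) := by
  refine ContDiffAt.mul (contDiffAt_prod fun j _ => contDiffAt_snd.sub ?_) ?_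
  · exact ContDiffAt.comp (x, t) (contDiffAt_aRatio hu hv (hx.2.1 j)) contDiffAt_fst
  · exact ContDiffAt.comp (x, t) (contDiffAt_pd i hu) contDiffAt_fst

lemma contDiffAt_horizontalForm {c : Fin n → (Fin n → ℝ) × ℝ → ℝ} {p : (Fin n → ℝ) × ℝ}
    (hc : ∀ i, ContDiffAt ℝ ∞ (c i) p) : ContDiffAt ℝ ∞ (horizontalForm c) p := by
  unfold horizontalForm
  exact ContDiffAt.sum fun i _ => (hc i).smul contDiffAt_const

end Forms

/-! ### The `GL(2, ℝ)` structure -/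

section GL2

variable {n : ℕ} {u v : (Fin n → ℝ) → ℝ} {U : Set (Fin n → ℝ)}

lemma contDiffOn_coeff_prod {ι E : Type*} [NormedAddCommGroup E] [NormedSpace ℝ E] {U : Set E}
    {a : ι → E → ℝ} (ha : ∀ i, ContDiffOn ℝ ∞ (a i) U) (s : Finset ι) :
    ∀ m : ℕ, ContDiffOn ℝ ∞
      (fun x => (∏ j ∈ s, (Polynomial.X - Polynomial.C (a j x))).coeff m) U := by
  classical
  induction s using Finset.induction_on with
  | empty =>
    intro m
    simp only [Finset.prod_empty]
    exact contDiffOn_const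
  | insert i s his ih =>
    intro m
    simp only [Finset.prod_insert his, sub_mul, Polynomial.coeff_sub, Polynomial.coeff_C_mul]
    cases m with
    | zero =>
      simp only [Polynomial.coeff_X_mul_zero, zero_sub]
      exact ((ha i).mul (ih 0)).neg
    | succ m =>
      simp only [Polynomial.coeff_X_mul]
      exact (ih m).sub ((ha i).mul (ih (m + 1)))

lemma isGL2Structure_structureForm (hU : IsOpen U) (h : NondegeneratePair U u v) :
    IsGL2Structure U (structureForm u v) := by
  let P : Fin n → (Fin n → ℝ) → Polynomial ℝ := fun i x =>
    ∏ j ∈ Finset.univ.erase i, (Polynomial.X - Polynomial.C (aRatio u v j x))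
  let w : Fin n → (Fin n → ℝ) → ((Fin n → ℝ) →L[ℝ] ℝ) := fun m x =>
    ∑ i, ((P i x).coeff m * pd i u x) • (ContinuousLinearMap.proj i : (Fin n → ℝ) →L[ℝ] ℝ)
  have hw : ∀ m x X, w m x X = ∑ i, ((P i x).coeff m * pd i u x) * X i := fun m x X => by
    simp [w]
  have hη : ∀ x X t, structureForm u v x t X
      = ∑ i, (∏ j ∈ Finset.univ.erase i, (t - aRatio u v j x)) * pd i u x * X i :=
    fun x X t => by simp [structureForm]
  have hsum : ∀ x X (t : ℝ), structureForm u v x t X = ∑ m : Fin n, t ^ (m : ℕ) * w m x X := by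
    intro x X t
    simp only [hw, hη, Finset.mul_sum]
    rw [Finset.sum_comm]
    refine Finset.sum_congr rfl fun i _ => ?_
    have hdeg : (P i x).natDegree < n := by
      have : (P i x).natDegree = (Finset.univ.erase i).card :=
        Polynomial.natDegree_finsetProd_X_sub_C_eq_card _ _
      rw [this, Finset.card_erase_of_mem (Finset.mem_univ i), Finset.card_univ, Fintype.card_fin]
      have := i.pos
      omega
    have heval : ∏ j ∈ Finset.univ.erase i, (t - aRatio u v j x) = (P i x).eval t := by
      simp [P, Polynomial.eval_prod]
    rw [heval, Polynomial.eval_eq_sum_range' hdeg, ← Fin.sum_univ_eq_sum_range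
      (fun m => (P i x).coeff m * t ^ m), Finset.sum_mul, Finset.sum_mul]
    exact Finset.sum_congr rfl fun m _ => by ring
  refine ⟨w, fun m => ?_, fun x hx => ?_, fun x _ t => ?_⟩
  · have ha : ∀ i, ContDiffOn ℝ ∞ (aRatio u v i) U := fun i x hx =>
      (contDiffAt_aRatio (h.contDiffAt hU hx).1 (h.contDiffAt hU hx).2
        ((h.2.2 x hx).2.1 i)).contDiffWithinAt
    have hpd : ∀ i, ContDiffOn ℝ ∞ (pd i u) U := fun i x hx =>
      (contDiffAt_pd i (h.contDiffAt hU hx).1).contDiffWithinAt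
    exact ContDiffOn.sum fun i _ =>
      ((contDiffOn_coeff_prod ha _ m).mul (hpd i)).smul contDiffOn_const
  · -- the forms have no common kernel, as is seen by putting `λ = aᵢ`
    let T : (Fin n → ℝ) →ₗ[ℝ] (Fin n → ℝ) := LinearMap.pi fun m => (w m x).toLinearMap
    have hT : Function.Injective T := by
      rw [injective_iff_map_eq_zero]
      intro X hX
      have hX' : ∀ m, w m x X = 0 := fun m => congrFun hX m
      funext i
      have h0 : structureForm u v x (aRatio u v i x) X = 0 := by simp [hsum, hX']
      rw [hη, Finset.sum_eq_single i] at h0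
      · refine (mul_eq_zero.mp h0).resolve_left (mul_ne_zero ?_ ((h.2.2 x hx).1 i))
        refine Finset.prod_ne_zero_iff.mpr fun j hj => sub_ne_zero.mpr ?_
        exact (h.2.2 x hx).2.2 i j (Finset.ne_of_mem_erase hj).symm
      · intro j _ hji
        rw [Finset.prod_eq_zero (Finset.mem_erase.mpr ⟨hji.symm, Finset.mem_univ i⟩)
          (sub_self _), zero_mul, zero_mul]
      · exact fun hi => absurd (Finset.mem_univ i) hi
    have hTs : Function.Surjective T := LinearMap.surjective_of_injective hT
    rw [Fintype.linearIndependent_iff]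
    intro c hc m
    obtain ⟨X, hX⟩ := hTs (Pi.single m 1)
    have h0 : ∑ i, c i * w i x X = 0 := by
      have := congrArg (fun φ : (Fin n → ℝ) →L[ℝ] ℝ => φ X) hc
      simpa using this
    have hX' : ∀ i, w i x X = (Pi.single m 1 : Fin n → ℝ) i := fun i => congrFun hX i
    simpa [hX', Pi.single_apply] using h0
  · ext1 X
    rw [hsum]
    simp

end GL2

/-! ### Involutivity -/

section Involutivity

variable {n : ℕ} {u v : (Fin n → ℝ) → ℝ} {U : Set (Fin n → ℝ)} {x : Fin n → ℝ} {t : ℝ}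

lemma contactForm_eq_zero_iff (ht : ∀ i, t ≠ aRatio u v i x) (X : (Fin n → ℝ) × ℝ) :
    contactForm (structureForm u v) (x, t) X = 0 ↔ ∑ r, coeffQ u v x t r * X.1 r = 0 := by
  rw [contactForm_eq_smul ht, smul_apply, smul_eq_mul, mul_eq_zero,
    or_iff_right (Finset.prod_ne_zero_iff.mpr fun i _ => sub_ne_zero.mpr (ht i)), omegaForm,
    horizontalForm_apply]

/-- On the kernel of `ω(λ)` clearing the denominators multiplies `dω` by `∏ (λ - aⱼ)`. -/
lemma dForm_contactForm (hU : IsOpen U) (h : NondegeneratePair U u v)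
    (hp : (x, t) ∈ corrSpace U u v) {X Y : (Fin n → ℝ) × ℝ}
    (hX : ∑ r, coeffQ u v x t r * X.1 r = 0) (hY : ∑ r, coeffQ u v x t r * Y.1 r = 0) :
    dForm (contactForm (structureForm u v)) (x, t) X Y
      = (∏ j, (t - aRatio u v j x))
        * twoForm (pole u v x t) (coeffQ u v x t) (curv u v x t) X Y := by
  obtain ⟨hu, hv⟩ := h.contDiffAt hU hp.1
  have hx := h.2.2 x hp.1
  have hq := fun i => (contDiffAt_coeffQ hu hv (hx.2.1 i) (hp.2 i)).differentiableAt_infty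
  let P : (Fin n → ℝ) × ℝ → ℝ := fun p => ∏ j, (p.2 - aRatio u v j p.1)
  have hP : DifferentiableAt ℝ P (x, t) := by
    have : ContDiffAt ℝ ∞ P (x, t) := contDiffAt_prod fun j _ => contDiffAt_snd.sub
      (ContDiffAt.comp (x, t) (contDiffAt_aRatio hu hv (hx.2.1 j)) contDiffAt_fst)
    exact this.differentiableAt_infty
  have hev : contactForm (structureForm u v) =ᶠ[nhds (x, t)]
      horizontalForm fun i p => P p * coeffQ u v p.1 p.2 i := by
    filter_upwards [corrSpace_mem_nhds hU h hp] with p hp'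
    have := contactForm_eq_smul (u := u) (v := v) (x := p.1) (t := p.2) hp'.2
    rw [Prod.mk.eta] at this
    rw [this, omegaForm, horizontalForm, horizontalForm, Finset.smul_sum]
    exact Finset.sum_congr rfl fun i _ => smul_smul _ _ _
  rw [← dForm_omegaForm hu hv hx hp.2, omegaForm, dForm_horizontalForm hq, dForm_congr hev,
    dForm_horizontalForm fun i => hP.fun_mul (hq i)]
  have e : ∀ (i) (Z : (Fin n → ℝ) × ℝ),
      fderiv ℝ (fun p : (Fin n → ℝ) × ℝ => P p * coeffQ u v p.1 p.2 i) (x, t) Z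
      = P (x, t) * fderiv ℝ (fun p : (Fin n → ℝ) × ℝ => coeffQ u v p.1 p.2 i) (x, t) Z
        + fderiv ℝ P (x, t) Z * coeffQ u v x t i := fun i Z => by
    rw [fderiv_fun_mul hP (hq i)]
    simp only [add_apply, smul_apply, smul_eq_mul]
    ring
  have e' : ∀ i, P (x, t) * (fderiv ℝ (fun p : (Fin n → ℝ) × ℝ => coeffQ u v p.1 p.2 i) (x, t) X
        * Y.1 i - fderiv ℝ (fun p : (Fin n → ℝ) × ℝ => coeffQ u v p.1 p.2 i) (x, t) Y * X.1 i)
        + fderiv ℝ P (x, t) X * (coeffQ u v x t i * Y.1 i)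
        - fderiv ℝ P (x, t) Y * (coeffQ u v x t i * X.1 i)
      = fderiv ℝ (fun p : (Fin n → ℝ) × ℝ => P p * coeffQ u v p.1 p.2 i) (x, t) X * Y.1 i
        - fderiv ℝ (fun p : (Fin n → ℝ) × ℝ => P p * coeffQ u v p.1 p.2 i) (x, t) Y * X.1 i :=
    fun i => by rw [e, e]; ring
  simp only [← e']
  rw [Finset.sum_sub_distrib, Finset.sum_add_distrib, ← Finset.mul_sum, ← Finset.mul_sum,
    ← Finset.mul_sum, hX, hY]
  ring

lemma pfaff_dForm (hU : IsOpen U) (h : NondegeneratePair U u v)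
    (hp : (x, t) ∈ corrSpace U u v) {X₁ X₂ X₃ X₄ : (Fin n → ℝ) × ℝ}
    (h₁ : ∑ r, coeffQ u v x t r * X₁.1 r = 0) (h₂ : ∑ r, coeffQ u v x t r * X₂.1 r = 0)
    (h₃ : ∑ r, coeffQ u v x t r * X₃.1 r = 0) (h₄ : ∑ r, coeffQ u v x t r * X₄.1 r = 0) :
    pfaff (dForm (contactForm (structureForm u v)) (x, t)) X₁ X₂ X₃ X₄
      = (∏ j, (t - aRatio u v j x)) ^ 2
        * pfaff (twoForm (pole u v x t) (coeffQ u v x t) (curv u v x t)) X₁ X₂ X₃ X₄ := by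
  simp only [pfaff, dForm_contactForm hU h hp h₁ h₂, dForm_contactForm hU h hp h₁ h₃,
    dForm_contactForm hU h hp h₁ h₄, dForm_contactForm hU h hp h₂ h₃,
    dForm_contactForm hU h hp h₂ h₄, dForm_contactForm hU h hp h₃ h₄]
  ring

lemma continuousAt_dForm {θ : ((Fin n → ℝ) × ℝ) → (((Fin n → ℝ) × ℝ) →L[ℝ] ℝ)}
    {p : (Fin n → ℝ) × ℝ} (hθ : ContDiffAt ℝ ∞ θ p)
    {X Y : (Fin n → ℝ) × ℝ → (Fin n → ℝ) × ℝ} (hX : ContinuousAt X p) (hY : ContinuousAt Y p) :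
    ContinuousAt (fun p' => dForm θ p' (X p') (Y p')) p := by
  have hc : ContinuousAt (fderiv ℝ θ) p :=
    (hθ.fderiv_right (m := 0) (by simp)).continuousAt
  exact ((hc.clm_apply hX).clm_apply hY).sub ((hc.clm_apply hY).clm_apply hX)

lemma dForm_smul (θ : ((Fin n → ℝ) × ℝ) → (((Fin n → ℝ) × ℝ) →L[ℝ] ℝ))
    (p X Y : (Fin n → ℝ) × ℝ) (c : ℝ) : dForm θ p (c • X) (c • Y) = c ^ 2 * dForm θ p X Y := by
  simp only [dForm, map_smul, smul_apply, smul_eq_mul]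
  ring

lemma contactForm_ne_zero (hx : NondegenerateAt u v x) (hn : 2 ≤ n) :
    ∃ N, contactForm (structureForm u v) (x, t) N ≠ 0 := by
  by_cases ht : ∃ i, t = aRatio u v i x
  · obtain ⟨i, rfl⟩ := ht
    refine ⟨(Pi.single i 1, 0), ?_⟩
    rw [contactForm_structureForm, horizontalForm_apply, Finset.sum_eq_single i]
    · simp only [Pi.single_eq_same, mul_one]
      refine mul_ne_zero (Finset.prod_ne_zero_iff.mpr fun j hj => sub_ne_zero.mpr ?_) (hx.1 i)
      exact hx.2.2 i j (Finset.ne_of_mem_erase hj).symm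
    · intro j _ hji
      simp [hji]
    · exact fun hi => absurd (Finset.mem_univ i) hi
  · push Not at ht
    refine ⟨(Pi.single ⟨0, by omega⟩ 1, 0), ?_⟩
    rw [Ne, contactForm_eq_zero_iff ht]
    simpa [Pi.single_apply] using coeffQ_ne_zero hx (ht _)

/-- The 5-form `θ ∧ (dθ)²` is continuous, so involutivity need only be checked off the zeros of
the `λ - aᵢ`. -/
lemma pfaff_dForm_eq_zero_of_generic (hn : 2 ≤ n) (hU : IsOpen U) (h : NondegeneratePair U u v)
    (hgen : ∀ t, (x, t) ∈ corrSpace U u v → ∀ X₁ X₂ X₃ X₄ : (Fin n → ℝ) × ℝ,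
      contactForm (structureForm u v) (x, t) X₁ = 0 →
      contactForm (structureForm u v) (x, t) X₂ = 0 →
      contactForm (structureForm u v) (x, t) X₃ = 0 →
      contactForm (structureForm u v) (x, t) X₄ = 0 →
      pfaff (dForm (contactForm (structureForm u v)) (x, t)) X₁ X₂ X₃ X₄ = 0)
    (hxU : x ∈ U) (t : ℝ) {X₁ X₂ X₃ X₄ : (Fin n → ℝ) × ℝ}
    (h₁ : contactForm (structureForm u v) (x, t) X₁ = 0)
    (h₂ : contactForm (structureForm u v) (x, t) X₂ = 0)
    (h₃ : contactForm (structureForm u v) (x, t) X₃ = 0)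
    (h₄ : contactForm (structureForm u v) (x, t) X₄ = 0) :
    pfaff (dForm (contactForm (structureForm u v)) (x, t)) X₁ X₂ X₃ X₄ = 0 := by
  obtain ⟨hu, hv⟩ := h.contDiffAt hU hxU
  have hx := h.2.2 x hxU
  set θ := contactForm (structureForm u v) with hθ
  obtain ⟨N, hN⟩ := contactForm_ne_zero (t := t) hx hn
  rw [← hθ] at hN
  have hsm : ContDiffAt ℝ ∞ θ (x, t) := by
    rw [hθ, contactForm_structureForm]
    exact contDiffAt_horizontalForm fun i => contDiffAt_structure_coeff hu hv hx i
  -- the projection of `X` to the kernel of `θ` along `N`, up to the factor `θ(N)`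
  let K : (Fin n → ℝ) × ℝ → (Fin n → ℝ) × ℝ → (Fin n → ℝ) × ℝ := fun X p =>
    θ p N • X - θ p X • N
  have hK0 : ∀ X p, θ p (K X p) = 0 := fun X p => by
    simp only [K, map_sub, map_smul, smul_eq_mul]; ring
  have hK1 : ∀ X, θ (x, t) X = 0 → K X (x, t) = θ (x, t) N • X := fun X hX => by
    simp only [K, hX, zero_smul, sub_zero]
  have hKc : ∀ X, ContinuousAt (K X) (x, t) := fun X =>
    ((hsm.continuousAt.clm_apply continuousAt_const).smul continuousAt_const).sub
      ((hsm.continuousAt.clm_apply continuousAt_const).smul continuousAt_const)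
  let g : ℝ → ℝ := fun s => pfaff (dForm θ (x, s)) (K X₁ (x, s)) (K X₂ (x, s)) (K X₃ (x, s))
    (K X₄ (x, s))
  have hd := fun X Y => continuousAt_dForm hsm (hKc X) (hKc Y)
  have hline : ContinuousAt (fun s : ℝ => (x, s)) t := by fun_prop
  have hgc : ContinuousAt g t := by
    refine ContinuousAt.comp (f := fun s : ℝ => (x, s)) (x := t)
      (g := fun p => pfaff (dForm θ p) (K X₁ p) (K X₂ p) (K X₃ p) (K X₄ p)) ?_ hline
    exact (((hd _ _).mul (hd _ _)).sub ((hd _ _).mul (hd _ _))).add ((hd _ _).mul (hd _ _))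
  have hg0 : ∀ᶠ s in nhdsWithin t {t}ᶜ, g s = 0 := by
    have hfin : (Set.range (fun i => aRatio u v i x) \ {t}).Finite :=
      (Set.finite_range _).sdiff
    have hne : ∀ᶠ s in nhdsWithin t {t}ᶜ, s ∉ Set.range (fun i => aRatio u v i x) \ {t} :=
      nhdsWithin_le_nhds (hfin.isClosed.isOpen_compl.mem_nhds (by simp))
    filter_upwards [hne, self_mem_nhdsWithin] with s hs hst
    refine hgen s ⟨hxU, fun i hi => hs ⟨⟨i, hi.symm⟩, hst⟩⟩ _ _ _ _ (hK0 _ _) (hK0 _ _) (hK0 _ _)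
      (hK0 _ _)
  have hlim : g t = 0 := by
    have h1 : Filter.Tendsto g (nhdsWithin t {t}ᶜ) (nhds (g t)) :=
      hgc.tendsto.mono_left nhdsWithin_le_nhds
    have h2 : Filter.Tendsto g (nhdsWithin t {t}ᶜ) (nhds 0) :=
      tendsto_const_nhds.congr' (hg0.mono fun s hs => hs.symm)
    exact tendsto_nhds_unique h1 h2
  simp only [g, hK1 _ h₁, hK1 _ h₂, hK1 _ h₃, hK1 _ h₄, pfaff, dForm_smul] at hlim
  have : θ (x, t) N ^ 4 * pfaff (dForm θ (x, t)) X₁ X₂ X₃ X₄ = 0 := by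
    rw [← hlim, pfaff]; ring
  exact (mul_eq_zero.mp this).resolve_left (pow_ne_zero 4 hN)

/-- Involutivity is `ω ∧ τ ∧ dω = 0` on the correspondence space. -/
lemma isInvolutiveStructure_iff (hn : 2 ≤ n) (hU : IsOpen U) (h : NondegeneratePair U u v) :
    IsInvolutiveStructure U (structureForm u v) ↔ ∀ p ∈ corrSpace U u v, ∀ i j k l,
      wedge4 (pole u v p.1 p.2) (curv u v p.1 p.2) i j k l = 0 := by
  constructor
  · rintro hi ⟨x, t⟩ hp
    obtain ⟨hu, hv⟩ := h.contDiffAt hU hp.1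
    have hx := h.2.2 x hp.1
    refine wedge4_eq_zero_of_pfaff (q := coeffQ u v x t) (fun i => coeffQ_ne_zero hx (hp.2 i))
      (curv_antisymm hu hv) fun X₁ X₂ X₃ X₄ h₁ h₂ h₃ h₄ => ?_
    have := hi (x, t) hp.1 X₁ X₂ X₃ X₄ ((contactForm_eq_zero_iff hp.2 _).mpr h₁)
      ((contactForm_eq_zero_iff hp.2 _).mpr h₂) ((contactForm_eq_zero_iff hp.2 _).mpr h₃)
      ((contactForm_eq_zero_iff hp.2 _).mpr h₄)
    have h' : pfaff (dForm (contactForm (structureForm u v)) (x, t)) X₁ X₂ X₃ X₄ = 0 := this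
    rw [pfaff_dForm hU h hp h₁ h₂ h₃ h₄] at h'
    exact (mul_eq_zero.mp h').resolve_left (pow_ne_zero 2
      (Finset.prod_ne_zero_iff.mpr fun i _ => sub_ne_zero.mpr (hp.2 i)))
  · rintro hw ⟨x, t⟩ hxU X₁ X₂ X₃ X₄ h₁ h₂ h₃ h₄
    refine pfaff_dForm_eq_zero_of_generic hn hU h (fun t hp X₁ X₂ X₃ X₄ h₁ h₂ h₃ h₄ => ?_)
      hxU t h₁ h₂ h₃ h₄
    obtain ⟨hu, hv⟩ := h.contDiffAt hU hp.1
    have hx := h.2.2 x hp.1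
    rw [contactForm_eq_zero_iff hp.2] at h₁ h₂ h₃ h₄
    rw [pfaff_dForm hU h hp h₁ h₂ h₃ h₄, pfaff_eq_zero_of_wedge4 hn (pole_injective hx)
      (curv_antisymm hu hv) (hw (x, t) hp) h₁ h₂ h₃ h₄, mul_zero]

lemma solvesSystem_iff (hU : IsOpen U) (h : NondegeneratePair U u v) :
    SolvesSystem U u v ↔ ∀ p ∈ corrSpace U u v, ∀ i j k l,
      wedge4 (pole u v p.1 p.2) (curv u v p.1 p.2) i j k l = 0 := by
  constructor
  · rintro hs ⟨x, t⟩ hp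
    obtain ⟨hu, hv⟩ := h.contDiffAt hU hp.1
    exact (system_iff_wedge4 hu hv (h.2.2 x hp.1)).mp (hs x hp.1) t hp.2
  · intro hw x hx
    obtain ⟨hu, hv⟩ := h.contDiffAt hU hx
    exact (system_iff_wedge4 hu hv (h.2.2 x hx)).mpr fun t ht => hw (x, t) ⟨hx, ht⟩

/-! ### The rank of the Lax distribution -/

lemma laxDistribution_rank_iff (hn : 2 ≤ n) (hU : IsOpen U) (h : NondegeneratePair U u v) :
    SolvesSystem U u v ↔
      ∀ p ∈ corrSpace U u v, Module.finrank ℝ (laxDistribution u v p) + 2 = n := by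
  rw [solvesSystem_iff hU h]
  refine forall₂_congr ?_
  rintro ⟨x, t⟩ hp
  obtain ⟨hu, hv⟩ := h.contDiffAt hU hp.1
  have hx := h.2.2 x hp.1
  rw [laxDistribution_eq_charSpan hu hv hx hp.2]
  exact (finrank_charSpan_iff_wedge4 hn (fun i => coeffQ_ne_zero hx (hp.2 i)) (pole_injective hx)
    (curv_antisymm hu hv)).symm

end Involutivity

/-! ### Integrability of the Lax distribution -/

section Integrability

variable {n : ℕ}

/-- Cauchy characteristics are closed under the Lie bracket: if `X` and `Y` take values in the
kernel of the restriction of `dw` to `ker w`, so does `[X, Y]`. -/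
lemma lieBracket_characteristic {w : (Fin n → ℝ) × ℝ → (((Fin n → ℝ) × ℝ) →L[ℝ] ℝ)}
    {X Y : (Fin n → ℝ) × ℝ → (Fin n → ℝ) × ℝ} {p : (Fin n → ℝ) × ℝ}
    (hw : ContDiffAt ℝ ∞ w p) (hX : DifferentiableAt ℝ X p) (hY : DifferentiableAt ℝ Y p)
    {N : (Fin n → ℝ) × ℝ} (hN : w p N ≠ 0)
    (hcX : ∀ᶠ p' in nhds p, w p' (X p') = 0 ∧ ∀ e, w p' e = 0 → dForm w p' (X p') e = 0)
    (hcY : ∀ᶠ p' in nhds p, w p' (Y p') = 0 ∧ ∀ e, w p' e = 0 → dForm w p' (Y p') e = 0) :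
    w p (VectorField.lieBracket ℝ X Y p) = 0 ∧
      ∀ e, w p e = 0 → dForm w p (VectorField.lieBracket ℝ X Y p) e = 0 := by
  have hdw : DifferentiableAt ℝ w p := hw.differentiableAt_infty
  have hdD : DifferentiableAt ℝ (fderiv ℝ w) p :=
    (hw.fderiv_right (m := ∞) (by simp)).differentiableAt_infty
  set D := fderiv ℝ w with hD
  set D2 := fderiv ℝ D p with hD2
  have hsymm : ∀ a b, D2 a b = D2 b a := by
    refine hw.isSymmSndFDerivAt ?_
    rw [minSmoothness_of_isRCLikeNormedField]
    exact WithTop.coe_le_coe.mpr le_top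
  have hDd : ∀ {Z Z' : (Fin n → ℝ) × ℝ → (Fin n → ℝ) × ℝ}, DifferentiableAt ℝ Z p →
      DifferentiableAt ℝ Z' p → HasFDerivAt (fun p' => D p' (Z p') (Z' p'))
        ((D p (Z p)).comp (fderiv ℝ Z' p)
          + (((D p).comp (fderiv ℝ Z p) + D2.flip (Z p)).flip (Z' p))) p :=
    fun hZ hZ' => (hdD.hasFDerivAt.clm_apply hZ.hasFDerivAt).clm_apply hZ'.hasFDerivAt
  have hdd : ∀ {Z Z' : (Fin n → ℝ) × ℝ → (Fin n → ℝ) × ℝ}, DifferentiableAt ℝ Z p →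
      DifferentiableAt ℝ Z' p → ∀ a, fderiv ℝ (fun p' => dForm w p' (Z p') (Z' p')) p a
        = D2 a (Z p) (Z' p) + D p (fderiv ℝ Z p a) (Z' p) + D p (Z p) (fderiv ℝ Z' p a)
          - D2 a (Z' p) (Z p) - D p (fderiv ℝ Z' p a) (Z p) - D p (Z' p) (fderiv ℝ Z p a) := by
    intro Z Z' hZ hZ' a
    have := ((hDd hZ hZ').fun_sub (hDd hZ' hZ)).fderiv
    unfold dForm
    rw [← hD, this]
    simp only [sub_apply, add_apply, ContinuousLinearMap.comp_apply,
      ContinuousLinearMap.flip_apply]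
    ring
  -- the factor `f` in `dw(Z, ·) = f w`
  have key : ∀ {Z : (Fin n → ℝ) × ℝ → (Fin n → ℝ) × ℝ}, DifferentiableAt ℝ Z p →
      (∀ᶠ p' in nhds p, w p' (Z p') = 0 ∧ ∀ e, w p' e = 0 → dForm w p' (Z p') e = 0) →
      ∃ (f : ℝ) (f' : (Fin n → ℝ) × ℝ → ℝ), (∀ e, dForm w p (Z p) e = f * w p e) ∧
        (∀ a, D p a (Z p) + w p (fderiv ℝ Z p a) = 0) ∧
        ∀ a e, D2 a (Z p) e + D p (fderiv ℝ Z p a) e - D2 a e (Z p) - D p e (fderiv ℝ Z p a)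
          = f' a * w p e + f * D p a e := by
    intro Z hZ hcZ
    let f : (Fin n → ℝ) × ℝ → ℝ := fun p' => dForm w p' (Z p') N * (w p' N)⁻¹
    have hne : ∀ᶠ p' in nhds p, w p' N ≠ 0 :=
      (hw.continuousAt.clm_apply continuousAt_const).eventually_ne hN
    have hf : ∀ᶠ p' in nhds p, ∀ e, dForm w p' (Z p') e = f p' * w p' e := by
      filter_upwards [hne, hcZ] with p' hp' hc e
      have h1 : w p' (e - (w p' e * (w p' N)⁻¹) • N) = 0 := by
        rw [map_sub, map_smul, smul_eq_mul, mul_assoc, inv_mul_cancel₀ hp', mul_one, sub_self]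
      have h2 := hc.2 _ h1
      have h3 : dForm w p' (Z p') (e - (w p' e * (w p' N)⁻¹) • N)
          = dForm w p' (Z p') e - w p' e * (w p' N)⁻¹ * dForm w p' (Z p') N := by
        simp only [dForm, map_sub, map_smul, sub_apply, smul_apply, smul_eq_mul]
        ring
      rw [h3] at h2
      simp only [f]
      linear_combination h2
    have hfd : DifferentiableAt ℝ f p := by
      refine DifferentiableAt.mul ?_ (DifferentiableAt.inv ?_ hN)
      · exact ((hDd hZ (differentiableAt_const N)).fun_sub
          (hDd (differentiableAt_const N) hZ)).differentiableAt
      · exact hdw.clm_apply (differentiableAt_const N)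
    refine ⟨f p, fun a => fderiv ℝ f p a, hf.self_of_nhds, fun a => ?_, fun a e => ?_⟩
    · have h0 : (fun p' => w p' (Z p')) =ᶠ[nhds p] fun _ => 0 := hcZ.mono fun p' h => h.1
      have h1 := h0.fderiv_eq (𝕜 := ℝ)
      rw [(hdw.hasFDerivAt.clm_apply hZ.hasFDerivAt).fderiv] at h1
      have := congrArg (fun L : ((Fin n → ℝ) × ℝ) →L[ℝ] ℝ => L a) h1
      simp only [add_apply, ContinuousLinearMap.comp_apply, ContinuousLinearMap.flip_apply,
        fderiv_fun_const, Pi.zero_apply, zero_apply] at this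
      linarith
    · have h0 : (fun p' => dForm w p' (Z p') e) =ᶠ[nhds p] fun p' => f p' * w p' e :=
        hf.mono fun p' h => h e
      have h1 := congrArg (fun L : ((Fin n → ℝ) × ℝ) →L[ℝ] ℝ => L a) (h0.fderiv_eq (𝕜 := ℝ))
      have h2 := hdd hZ (differentiableAt_const e) a
      rw [h2] at h1
      have h3 : HasFDerivAt (fun p' => w p' e)
          ((w p).comp (0 : ((Fin n → ℝ) × ℝ) →L[ℝ] (Fin n → ℝ) × ℝ) + (D p).flip e) p :=
        hdw.hasFDerivAt.clm_apply (hasFDerivAt_const e p)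
      rw [(hfd.hasFDerivAt.fun_mul h3).fderiv] at h1
      simp only [fderiv_fun_const, Pi.zero_apply, zero_apply, map_zero, add_apply, smul_apply,
        smul_eq_mul, ContinuousLinearMap.comp_apply, ContinuousLinearMap.flip_apply] at h1
      linear_combination h1
  obtain ⟨f, f', hf, hwX, hfX⟩ := key hX hcX
  obtain ⟨g, g', hg, hwY, hgY⟩ := key hY hcY
  have hX0 := hcX.self_of_nhds.1
  have hY0 := hcY.self_of_nhds.1
  have hXY : ∀ a, D2 a (X p) (Y p) + D p (fderiv ℝ X p a) (Y p) + D p (X p) (fderiv ℝ Y p a)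
      - D2 a (Y p) (X p) - D p (fderiv ℝ Y p a) (X p) - D p (Y p) (fderiv ℝ X p a) = 0 := by
    intro a
    rw [← hdd hX hY a]
    have h0 : (fun p' => dForm w p' (X p') (Y p')) =ᶠ[nhds p] fun _ => 0 :=
      (hcX.and hcY).mono fun p' h => h.1.2 _ h.2.1
    rw [h0.fderiv_eq, fderiv_fun_const]
    rfl
  have dXY := hf (Y p)
  rw [hY0, mul_zero] at dXY
  simp only [dForm, ← hD] at hf hg dXY ⊢
  simp only [VectorField.lieBracket_eq]
  refine ⟨?_, fun e he => ?_⟩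
  · rw [map_sub]
    linear_combination hwY (X p) - hwX (Y p) - dXY
  · simp only [map_sub, sub_apply]
    have h1 := hgY (X p) e
    have h2 := hfX (Y p) e
    have h3 := hXY e
    have h4 := hf (fderiv ℝ Y p e)
    have h5 := hg (fderiv ℝ X p e)
    have h6 := hwX e
    have h7 := hwY e
    have h8 := hf e
    have h9 := hg e
    rw [he] at h1 h2 h8 h9
    rw [hsymm e (X p), hsymm e (Y p)] at h3
    rw [hsymm (Y p) (X p)] at h2
    linear_combination h1 - h2 + h3 - h4 + h5 - f * h7 + g * h6 + g * h8 - f * h9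

variable {u v : (Fin n → ℝ) → ℝ} {U : Set (Fin n → ℝ)}

lemma isCharacteristic_iff {x : Fin n → ℝ} {t : ℝ} (hu : ContDiffAt ℝ ∞ u x)
    (hv : ContDiffAt ℝ ∞ v x) (hx : NondegenerateAt u v x) (ht : ∀ i, t ≠ aRatio u v i x)
    (X : (Fin n → ℝ) × ℝ) :
    IsCharacteristic (pole u v x t) (coeffQ u v x t) (curv u v x t) X ↔
      omegaForm u v (x, t) X = 0 ∧ ∀ e, omegaForm u v (x, t) e = 0 →
        dForm (omegaForm u v) (x, t) X e = 0 := by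
  simp only [IsCharacteristic, dForm_omegaForm hu hv hx ht]
  simp only [omegaForm, horizontalForm_apply]

lemma isIntegrableOn_laxDistribution (hn : 2 ≤ n) (hU : IsOpen U) (h : NondegeneratePair U u v)
    (hs : SolvesSystem U u v) : IsIntegrableOn (laxDistribution u v) (corrSpace U u v) := by
  rw [solvesSystem_iff hU h] at hs
  have hmem : ∀ p ∈ corrSpace U u v, ∀ X, X ∈ laxDistribution u v p ↔
      omegaForm u v p X = 0 ∧ ∀ e, omegaForm u v p e = 0 → dForm (omegaForm u v) p X e = 0 := by
    rintro ⟨x, t⟩ hp X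
    obtain ⟨hu, hv⟩ := h.contDiffAt hU hp.1
    have hx := h.2.2 x hp.1
    rw [laxDistribution_eq_charSpan hu hv hx hp.2, ← isCharacteristic_iff hu hv hx hp.2]
    exact mem_charSpan_iff hn (fun i => coeffQ_ne_zero hx (hp.2 i)) (pole_injective hx)
      (curv_antisymm hu hv) (hs (x, t) hp) X
  intro X Y hX hY hXD hYD p hp
  have hnhds := corrSpace_mem_nhds hU h hp
  rw [hmem p hp]
  obtain ⟨hu, hv⟩ := h.contDiffAt hU hp.1
  have hx := h.2.2 _ hp.1
  refine lieBracket_characteristic (N := (Pi.single ⟨0, by omega⟩ 1, 0)) ?_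
    (hX.contDiffAt hnhds).differentiableAt_infty (hY.contDiffAt hnhds).differentiableAt_infty
    ?_ ?_ ?_
  · exact contDiffAt_horizontalForm fun i => contDiffAt_coeffQ hu hv (hx.2.1 i) (hp.2 i)
  · rw [omegaForm, horizontalForm_apply]
    simpa [Pi.single_apply] using coeffQ_ne_zero hx (hp.2 _)
  · filter_upwards [hnhds] with p' hp'
    exact (hmem p' hp' _).mp (hXD p' hp')
  · filter_upwards [hnhds] with p' hp'
    exact (hmem p' hp' _).mp (hYD p' hp')

lemma contDiffOn_laxField (hU : IsOpen U) (h : NondegeneratePair U u v) (i j k : Fin n) :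
    ContDiffOn ℝ ∞ (laxField u v i j k) (corrSpace U u v) := by
  have e : ∀ p ∈ corrSpace U u v, laxField u v i j k p
      = charVec (pole u v p.1 p.2) (coeffQ u v p.1 p.2) (curv u v p.1 p.2) i j k := by
    rintro ⟨x, t⟩ hp
    obtain ⟨hu, hv⟩ := h.contDiffAt hU hp.1
    exact laxField_eq_charVec hu hv (h.2.2 x hp.1) hp.2 i j k
  refine ContDiffOn.congr (fun p hp => ContDiffAt.contDiffWithinAt ?_) e
  obtain ⟨hu, hv⟩ := h.contDiffAt hU hp.1
  have hx := h.2.2 _ hp.1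
  have hpole := fun i => contDiffAt_pole hu hv (hx.2.1 i) (hp.2 i)
  have hq := fun i => contDiffAt_coeffQ hu hv (hx.2.1 i) (hp.2 i)
  have hq0 := fun i => coeffQ_ne_zero hx (hp.2 i)
  have hA := contDiffAt_curv hu hv hx hp.2
  have hc : ∀ i j k, ContDiffAt ℝ ∞ (fun p : (Fin n → ℝ) × ℝ =>
      (pole u v p.1 p.2 k - pole u v p.1 p.2 j) / coeffQ u v p.1 p.2 i) p := fun i j k =>
    ((hpole k).sub (hpole j)).div (hq i) (hq0 i)
  refine ContDiffAt.prodMk ?_ ?_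
  · exact (((hc i j k).smul contDiffAt_const).add ((hc j k i).smul contDiffAt_const)).add
      ((hc k i j).smul contDiffAt_const)
  · exact (((hA i j).add (hA j k)).add (hA k i)).neg

lemma contDiffOn_wedge4 (hU : IsOpen U) (h : NondegeneratePair U u v) (i j k l : Fin n) :
    ContDiffOn ℝ ∞ (fun p : (Fin n → ℝ) × ℝ =>
      wedge4 (pole u v p.1 p.2) (curv u v p.1 p.2) i j k l) (corrSpace U u v) := by
  intro p hp
  refine ContDiffAt.contDiffWithinAt ?_
  obtain ⟨hu, hv⟩ := h.contDiffAt hU hp.1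
  have hx := h.2.2 _ hp.1
  have hpole := fun i => contDiffAt_pole hu hv (hx.2.1 i) (hp.2 i)
  have hA := contDiffAt_curv hu hv hx hp.2
  have hm : ∀ i j k l, ContDiffAt ℝ ∞ (fun p : (Fin n → ℝ) × ℝ =>
      (pole u v p.1 p.2 j - pole u v p.1 p.2 i) * curv u v p.1 p.2 k l) p := fun i j k l =>
    ((hpole j).sub (hpole i)).mul (hA k l)
  exact (((((hm _ _ _ _).sub (hm _ _ _ _)).add (hm _ _ _ _)).add (hm _ _ _ _)).sub
    (hm _ _ _ _)).add (hm _ _ _ _)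

/-- If the distribution is integrable it does not contain `∂_λ` at any point: the bracket of
`∂_λ` with `charVec` does not satisfy `τ = 0`. -/
lemma solvesSystem_of_isIntegrableOn (hU : IsOpen U) (h : NondegeneratePair U u v)
    (hI : IsIntegrableOn (laxDistribution u v) (corrSpace U u v)) : SolvesSystem U u v := by
  rw [solvesSystem_iff hU h]
  by_contra hcon
  push Not at hcon
  obtain ⟨⟨x, t⟩, hp, i, j, k, l, hQ⟩ := hcon
  obtain ⟨hu, hv⟩ := h.contDiffAt hU hp.1
  have hx := h.2.2 x hp.1
  have hnhds := corrSpace_mem_nhds hU h hp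
  have hd : Distinct4 i j k l := by
    by_contra hd
    exact hQ (wedge4_eq_zero_of_not_distinct (curv_antisymm hu hv) hd)
  let Q : (Fin n → ℝ) × ℝ → ℝ := fun p =>
    wedge4 (pole u v p.1 p.2) (curv u v p.1 p.2) i j k l
  let W : (Fin n → ℝ) × ℝ → (Fin n → ℝ) × ℝ := fun p => (0, Q p)
  let X : (Fin n → ℝ) × ℝ → (Fin n → ℝ) × ℝ := laxField u v i j k
  have hspan : ∀ p ∈ corrSpace U u v, laxDistribution u v p
      = charSpan (pole u v p.1 p.2) (coeffQ u v p.1 p.2) (curv u v p.1 p.2) := by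
    rintro ⟨x, t⟩ hp
    obtain ⟨hu, hv⟩ := h.contDiffAt hU hp.1
    exact laxDistribution_eq_charSpan hu hv (h.2.2 x hp.1) hp.2
  have hanti : ∀ p ∈ corrSpace U u v, ∀ i j, curv u v p.1 p.2 i j = - curv u v p.1 p.2 j i :=
    fun p hp => curv_antisymm (h.contDiffAt hU hp.1).1 (h.contDiffAt hU hp.1).2
  have hq0 : ∀ p ∈ corrSpace U u v, ∀ i, coeffQ u v p.1 p.2 i ≠ 0 :=
    fun p hp i => coeffQ_ne_zero (h.2.2 _ hp.1) (hp.2 i)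
  have hXval : ∀ p ∈ corrSpace U u v, X p
      = charVec (pole u v p.1 p.2) (coeffQ u v p.1 p.2) (curv u v p.1 p.2) i j k := by
    rintro ⟨x, t⟩ hp
    obtain ⟨hu, hv⟩ := h.contDiffAt hU hp.1
    exact laxField_eq_charVec hu hv (h.2.2 x hp.1) hp.2 i j k
  have hXs := contDiffOn_laxField hU h i j k
  have hQs := contDiffOn_wedge4 hU h i j k l
  have hb := hI W X (contDiffOn_const.prodMk hQs) hXs
    (fun p hp => by rw [hspan p hp]; exact wedge4_mem_charSpan (hanti p hp) i j k l)
    (fun p hp => by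
      rw [hspan p hp, hXval p hp]; exact charVec_mem_charSpan (hanti p hp) i j k) (x, t) hp
  rw [hspan _ hp] at hb
  have hτ := (omega_tau_of_mem (hq0 _ hp) hb).2
  have hXd : DifferentiableAt ℝ X (x, t) := (hXs.contDiffAt hnhds).differentiableAt_infty
  have hQd : DifferentiableAt ℝ Q (x, t) := (hQs.contDiffAt hnhds).differentiableAt_infty
  have hW : HasFDerivAt W ((0 : ((Fin n → ℝ) × ℝ) →L[ℝ] (Fin n → ℝ)).prod (fderiv ℝ Q (x, t)))
      (x, t) := (hasFDerivAt_const (0 : Fin n → ℝ) (x, t)).prodMk hQd.hasFDerivAt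
  have hfst : (VectorField.lieBracket ℝ W X (x, t)).1
      = Q (x, t) • (fderiv ℝ X (x, t) (0, 1)).1 := by
    have e : W (x, t) = Q (x, t) • ((0, 1) : (Fin n → ℝ) × ℝ) := by simp [W]
    rw [VectorField.lieBracket_eq]
    simp only [hW.fderiv, e, map_smul]
    simp
  rw [hfst] at hτ
  have hτ' : ∑ r, pole u v x t r * (coeffQ u v x t r * (fderiv ℝ X (x, t) (0, 1)).1 r) = 0 := by
    have e : ∀ r, pole u v x t r * (coeffQ u v x t r *
        (Q (x, t) • (fderiv ℝ X (x, t) (0, 1)).1) r)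
        = Q (x, t) * (pole u v x t r * (coeffQ u v x t r *
          (fderiv ℝ X (x, t) (0, 1)).1 r)) := fun r => by
      simp only [Pi.smul_apply, smul_eq_mul]; ring
    simp only [e, ← Finset.mul_sum] at hτ
    exact (mul_eq_zero.mp hτ).resolve_left hQ
  -- differentiate `τ(X) = 0` along the `λ`-line
  have hline : HasDerivAt (fun s : ℝ => (x, s)) ((0, 1) : (Fin n → ℝ) × ℝ) t :=
    (hasDerivAt_const t x).prodMk (hasDerivAt_id t)
  have hXline : ∀ r, HasDerivAt (fun s : ℝ => (X (x, s)).1 r)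
      ((fderiv ℝ X (x, t) (0, 1)).1 r) t := by
    intro r
    have h1 : HasDerivAt (fun s : ℝ => X (x, s)) (fderiv ℝ X (x, t) (0, 1)) t :=
      hXd.hasFDerivAt.comp_hasDerivAt t hline
    exact hasDerivAt_pi.mp (HasFDerivAt.comp_hasDerivAt (f := fun s : ℝ => X (x, s)) t
      hasFDerivAt_fst h1) r
  have hTline : ∀ r, HasDerivAt (fun s : ℝ => pole u v x s r * coeffQ u v x s r)
      (-2 * (pole u v x t r ^ 2 * coeffQ u v x t r)) t := by
    intro r
    have h0 := sub_ne_zero.mpr (hp.2 r)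
    have h1 : HasDerivAt (fun s : ℝ => pole u v x s r) (-(pole u v x t r) ^ 2) t := by
      have := ((hasDerivAt_id t).sub_const (aRatio u v r x)).fun_inv h0
      refine this.congr_deriv ?_
      simp only [id, pole]
      field_simp
    have h2 : HasDerivAt (fun s : ℝ => coeffQ u v x s r)
        (pd r u x * -(pole u v x t r) ^ 2) t := h1.const_mul (pd r u x)
    refine (h1.fun_mul h2).congr_deriv ?_
    simp only [coeffQ]
    ring
  have hsum : HasDerivAt (fun s : ℝ => ∑ r, pole u v x s r * coeffQ u v x s r * (X (x, s)).1 r)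
      (∑ r, (-2 * (pole u v x t r ^ 2 * coeffQ u v x t r) * (X (x, t)).1 r
        + pole u v x t r * coeffQ u v x t r * (fderiv ℝ X (x, t) (0, 1)).1 r)) t :=
    HasDerivAt.fun_sum fun r _ => (hTline r).fun_mul (hXline r)
  have hzero : (fun s : ℝ => ∑ r, pole u v x s r * coeffQ u v x s r * (X (x, s)).1 r)
      =ᶠ[nhds t] fun _ => 0 := by
    have : ∀ᶠ s in nhds t, (x, s) ∈ corrSpace U u v := hline.continuousAt.eventually hnhds
    filter_upwards [this] with s hs
    rw [hXval _ hs]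
    simp only [mul_assoc]
    exact tau_charVec (hq0 _ hs) i j k
  have hder := hsum.unique ((hasDerivAt_const t (0 : ℝ)).congr_of_eventuallyEq hzero)
  rw [Finset.sum_add_distrib] at hder
  simp only [mul_assoc] at hder
  rw [hτ', add_zero, ← Finset.mul_sum, hXval _ hp,
    sum_mul_charVec (hq0 _ hp) (fun r => pole u v x t r ^ 2)] at hder
  have hij := sub_ne_zero.mpr (pole_injective (t := t) hx i j hd.1)
  have hik := sub_ne_zero.mpr (pole_injective (t := t) hx i k hd.2.1)
  have hjk := sub_ne_zero.mpr (pole_injective (t := t) hx j k hd.2.2.2.1)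
  refine mul_ne_zero (mul_ne_zero hij hik) hjk ?_
  linear_combination (1 / 2) * hder

lemma laxDistribution_integrable_iff (hn : 2 ≤ n) (hU : IsOpen U)
    (h : NondegeneratePair U u v) :
    SolvesSystem U u v ↔ IsIntegrableOn (laxDistribution u v) (corrSpace U u v) :=
  ⟨isIntegrableOn_laxDistribution hn hU h, solvesSystem_of_isIntegrableOn hU h⟩

end Integrability

/-! ### Restriction to coordinate planes -/

section Nested

variable {n m : ℕ} (ι : Fin n ↪ Fin m) (c : Fin m → ℝ)

lemma slice_apply (y : Fin n → ℝ) (i : Fin n) : slice ι c y (ι i) = y i :=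
  ι.injective.extend_apply y c i

lemma slice_single (i : Fin n) (r : ℝ) :
    slice ι 0 (Pi.single i r) = Pi.single (ι i) r := by
  funext s
  by_cases hs : ∃ k, ι k = s
  · obtain ⟨k, rfl⟩ := hs
    rw [slice_apply]
    by_cases hk : k = i
    · subst hk; simp
    · rw [Pi.single_eq_of_ne hk, Pi.single_eq_of_ne fun h => hk (ι.injective h)]
  · rw [slice, Function.extend_apply' _ _ _ hs, Pi.single_eq_of_ne fun h => hs ⟨i, h.symm⟩]
    rfl

/-- The linear part of the inclusion of a coordinate plane. -/
def sliceLinear : (Fin n → ℝ) →ₗ[ℝ] (Fin m → ℝ) where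
  toFun := slice ι 0
  map_add' x y := by
    funext s
    by_cases hs : ∃ k, ι k = s
    · obtain ⟨k, rfl⟩ := hs
      simp only [slice_apply, Pi.add_apply]
    · simp only [slice, Pi.add_apply, Function.extend_apply' _ _ _ hs, Pi.zero_apply, add_zero]
  map_smul' r x := by
    funext s
    by_cases hs : ∃ k, ι k = s
    · obtain ⟨k, rfl⟩ := hs
      simp only [slice_apply, Pi.smul_apply, RingHom.id_apply]
    · simp only [slice, Pi.smul_apply, Function.extend_apply' _ _ _ hs, Pi.zero_apply, smul_zero]

lemma slice_eq (y : Fin n → ℝ) : slice ι c y = sliceLinear ι y + slice ι c 0 := by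
  funext s
  by_cases hs : ∃ k, ι k = s
  · obtain ⟨k, rfl⟩ := hs
    simp [sliceLinear, slice_apply]
  · simp [sliceLinear, slice, Function.extend_apply' _ _ _ hs]

lemma hasFDerivAt_slice (y : Fin n → ℝ) :
    HasFDerivAt (slice ι c) (sliceLinear ι).toContinuousLinearMap y := by
  have e : slice ι c = fun y => (sliceLinear ι).toContinuousLinearMap y + slice ι c 0 :=
    funext fun y => slice_eq ι c y
  rw [e]
  exact (ContinuousLinearMap.hasFDerivAt _).add_const _

lemma contDiff_slice : ContDiff ℝ ∞ (slice ι c) := by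
  have e : slice ι c = fun y => (sliceLinear ι).toContinuousLinearMap y + slice ι c 0 :=
    funext fun y => slice_eq ι c y
  rw [e]
  exact (ContinuousLinearMap.contDiff _).add contDiff_const

variable {ι c}

lemma pd_comp_slice {f : (Fin m → ℝ) → ℝ} {y : Fin n → ℝ}
    (hf : DifferentiableAt ℝ f (slice ι c y)) (i : Fin n) :
    pd i (f ∘ slice ι c) y = pd (ι i) f (slice ι c y) := by
  rw [pd, (hf.hasFDerivAt.comp y (hasFDerivAt_slice ι c y)).fderiv, pd,
    ContinuousLinearMap.comp_apply]
  congr 1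
  exact slice_single ι i 1

lemma pd2_comp_slice {f : (Fin m → ℝ) → ℝ} {y : Fin n → ℝ}
    (hf : ContDiffAt ℝ ∞ f (slice ι c y)) (i j : Fin n) :
    pd2 i j (f ∘ slice ι c) y = pd2 (ι i) (ι j) f (slice ι c y) := by
  have hev : pd i (f ∘ slice ι c) =ᶠ[nhds y] pd (ι i) f ∘ slice ι c := by
    filter_upwards [(contDiff_slice ι c).continuous.continuousAt.eventually
      hf.eventually_infty] with z hz
    exact pd_comp_slice hz i
  rw [pd2, (pd_congr j hev).self_of_nhds,
    pd_comp_slice (contDiffAt_pd (ι i) hf).differentiableAt_infty j, pd2]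

lemma nestedStructure (n m : ℕ) : NestedStructure n m := by
  intro ι c U u v hU h
  have hat : ∀ {y}, slice ι c y ∈ U → ContDiffAt ℝ ∞ u (slice ι c y) ∧
      ContDiffAt ℝ ∞ v (slice ι c y) := fun hy => h.contDiffAt hU hy
  have hpu : ∀ {y}, slice ι c y ∈ U → ∀ i,
      pd i (u ∘ slice ι c) y = pd (ι i) u (slice ι c y) := fun hy i =>
    pd_comp_slice (hat hy).1.differentiableAt_infty i
  have hpv : ∀ {y}, slice ι c y ∈ U → ∀ i,
      pd i (v ∘ slice ι c) y = pd (ι i) v (slice ι c y) := fun hy i =>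
    pd_comp_slice (hat hy).2.differentiableAt_infty i
  have ha : ∀ {y}, slice ι c y ∈ U → ∀ i, aRatio (u ∘ slice ι c) (v ∘ slice ι c) i y
      = aRatio u v (ι i) (slice ι c y) := fun hy i => by
    simp only [aRatio, hpu hy, hpv hy]
  have hb : ∀ {y}, slice ι c y ∈ U → ∀ i, aRatio (v ∘ slice ι c) (u ∘ slice ι c) i y
      = aRatio v u (ι i) (slice ι c y) := fun hy i => by
    simp only [aRatio, hpu hy, hpv hy]
  refine ⟨⟨?_, ?_, fun y hy => ⟨fun i => ?_, fun i => ?_, fun i j hij => ?_⟩⟩, fun y hy => ?_⟩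
  · exact h.1.comp (contDiff_slice ι c).contDiffOn fun y hy => hy
  · exact h.2.1.comp (contDiff_slice ι c).contDiffOn fun y hy => hy
  · rw [hpu hy]; exact (h.2.2 _ hy).1 _
  · rw [hpv hy]; exact (h.2.2 _ hy).2.1 _
  · rw [ha hy, ha hy]
    exact (h.2.2 _ hy).2.2 _ _ fun he => hij (ι.injective he)
  · have hp2u := fun i j => pd2_comp_slice (hat hy).1 i j
    have hp2v := fun i j => pd2_comp_slice (hat hy).2 i j
    refine ⟨fun i j k l => ⟨?_, ?_⟩, fun i j k t => Prod.ext ?_ ?_⟩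
    · simp only [exprE, summandE, ha hy, hpu hy, hp2u, hp2v]
    · simp only [exprF, exprE, summandE, hb hy, hpv hy, hp2u, hp2v]
    · have hlin : ∀ z, slice ι 0 z = sliceLinear ι z := fun z => rfl
      simp only [laxField, hlin, map_add, map_smul]
      simp only [← hlin, slice_single, ha hy, hpu hy]
    · simp only [laxField, coeffS, ha hy, hpu hy, hp2u, hp2v]

end Nested

/-! ### Functions that vanish to a given order, and their leading jets -/

section Jets

variable {n : ℕ} {f g c : (Fin n → ℝ) → ℝ} {x : Fin n → ℝ} {N : ℕ}

lemma pd_add (i : Fin n) (hf : DifferentiableAt ℝ f x) (hg : DifferentiableAt ℝ g x) :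
    pd i (fun y => f y + g y) x = pd i f x + pd i g x := by
  simp only [pd, fderiv_fun_add hf hg, add_apply]

lemma pd_sub (i : Fin n) (hf : DifferentiableAt ℝ f x) (hg : DifferentiableAt ℝ g x) :
    pd i (fun y => f y - g y) x = pd i f x - pd i g x := by
  simp only [pd, fderiv_fun_sub hf hg, sub_apply]

lemma pd_mul (i : Fin n) (hf : DifferentiableAt ℝ f x) (hg : DifferentiableAt ℝ g x) :
    pd i (fun y => f y * g y) x = pd i f x * g x + f x * pd i g x := by
  simp only [pd, fderiv_fun_mul hf hg, add_apply, smul_apply, smul_eq_mul]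
  ring

lemma pd_const (i : Fin n) (r : ℝ) : pd i (fun _ : Fin n → ℝ => r) = fun _ => 0 := by
  funext y
  simp [pd]

/-- `f` is smooth near `x`, and it vanishes at `x` together with its derivatives of order less
than `N`. The recursion on partial derivatives makes the Leibniz rule directly applicable. -/
def Flat : ℕ → ((Fin n → ℝ) → ℝ) → (Fin n → ℝ) → Prop
  | 0, f, x => ContDiffAt ℝ ∞ f x
  | N + 1, f, x => ContDiffAt ℝ ∞ f x ∧ f x = 0 ∧ ∀ i, Flat N (pd i f) x

lemma Flat.contDiffAt (hf : Flat N f x) : ContDiffAt ℝ ∞ f x := by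
  cases N with
  | zero => exact hf
  | succ N => exact hf.1

lemma Flat.of_succ (hf : Flat (N + 1) f x) : Flat N f x := by
  induction N generalizing f with
  | zero => exact hf.1
  | succ N ih => exact ⟨hf.1, hf.2.1, fun i => ih (hf.2.2 i)⟩

lemma Flat.congr (hf : Flat N f x) (h : f =ᶠ[nhds x] g) : Flat N g x := by
  induction N generalizing f g with
  | zero => exact ContDiffAt.congr_of_eventuallyEq hf h.symm
  | succ N ih =>
    exact ⟨hf.1.congr_of_eventuallyEq h.symm, by rw [← h.self_of_nhds]; exact hf.2.1,
      fun i => ih (hf.2.2 i) (pd_congr i h)⟩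

lemma Flat.add (hf : Flat N f x) (hg : Flat N g x) : Flat N (fun y => f y + g y) x := by
  induction N generalizing f g with
  | zero => exact ContDiffAt.add hf hg
  | succ N ih =>
    refine ⟨hf.1.add hg.1, by simp [hf.2.1, hg.2.1], fun i => (ih (hf.2.2 i) (hg.2.2 i)).congr ?_⟩
    filter_upwards [hf.1.eventually_infty, hg.1.eventually_infty] with y h1 h2
    exact (pd_add i h1 h2).symm

lemma flat_zero (N : ℕ) : Flat N (fun _ : Fin n → ℝ => 0) x := by
  induction N with
  | zero => exact contDiffAt_const
  | succ N ih => exact ⟨contDiffAt_const, rfl, fun i => by rw [pd_const]; exact ih⟩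

lemma pd_mul_eventuallyEq (i : Fin n) (hf : ContDiffAt ℝ ∞ f x) (hg : ContDiffAt ℝ ∞ g x) :
    pd i (fun y => f y * g y) =ᶠ[nhds x] fun y => pd i f y * g y + f y * pd i g y := by
  filter_upwards [hf.eventually_infty, hg.eventually_infty] with y h1 h2
  exact pd_mul i h1 h2

lemma Flat.smooth_mul (hg : Flat N g x) (hc : ContDiffAt ℝ ∞ c x) :
    Flat N (fun y => c y * g y) x := by
  induction N generalizing c g with
  | zero => exact ContDiffAt.mul hc hg
  | succ N ih =>
    refine ⟨hc.mul hg.1, by simp [hg.2.1], fun i => ?_⟩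
    exact ((ih hg.of_succ (contDiffAt_pd i hc)).add (ih (hg.2.2 i) hc)).congr
      (pd_mul_eventuallyEq i hc hg.1).symm

/-- A product gains an order of vanishing from a factor that vanishes. -/
lemma Flat.mul_of_eq_zero (hg : Flat N g x) (hf : ContDiffAt ℝ ∞ f x) (hf0 : f x = 0) :
    Flat (N + 1) (fun y => f y * g y) x := by
  induction N generalizing g with
  | zero =>
    exact ⟨hf.mul hg, by simp [hf0], fun i => contDiffAt_pd i (hf.mul hg)⟩
  | succ N ih =>
    refine ⟨hf.mul hg.1, by simp [hf0], fun i => ?_⟩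
    exact ((hg.smooth_mul (contDiffAt_pd i hf)).add (ih (hg.2.2 i))).congr
      (pd_mul_eventuallyEq i hf hg.1).symm

lemma Flat.neg (hf : Flat N f x) : Flat N (fun y => - f y) x :=
  (hf.smooth_mul (c := fun _ => -1) contDiffAt_const).congr
    (Filter.Eventually.of_forall fun y => by ring)

lemma Flat.sub (hf : Flat N f x) (hg : Flat N g x) : Flat N (fun y => f y - g y) x :=
  (hf.add hg.neg).congr (Filter.Eventually.of_forall fun y => by ring)

lemma Flat.of_smooth_mul (hc : ContDiffAt ℝ ∞ c x) (hc0 : c x ≠ 0)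
    (h : Flat N (fun y => c y * f y) x) : Flat N f x := by
  refine (h.smooth_mul (hc.inv hc0)).congr ?_
  filter_upwards [hc.continuousAt.eventually_ne hc0] with y hy
  simp only [Pi.inv_apply]
  field_simp

lemma iteratedFDeriv_fderiv_eq_zero_iff (hf : ContDiffAt ℝ ∞ f x) (m : ℕ) :
    iteratedFDeriv ℝ m (fderiv ℝ f) x = 0 ↔ ∀ i, iteratedFDeriv ℝ m (pd i f) x = 0 := by
  have hm : (m : WithTop ℕ∞) ≤ ∞ := WithTop.coe_le_coe.mpr le_top
  have hd : ContDiffAt ℝ ∞ (fderiv ℝ f) x := hf.fderiv_right (m := ∞) (by simp)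
  constructor
  · intro h i
    have e : pd i f = ContinuousLinearMap.apply ℝ ℝ (Pi.single i 1 : Fin n → ℝ) ∘ fderiv ℝ f := by
      funext y
      simp [pd]
    rw [e, ContinuousLinearMap.iteratedFDeriv_comp_left _ hd hm, h]
    ext; simp
  · intro h
    let L : Fin n → (ℝ →L[ℝ] ((Fin n → ℝ) →L[ℝ] ℝ)) := fun i =>
      ContinuousLinearMap.smulRight (1 : ℝ →L[ℝ] ℝ)
        (ContinuousLinearMap.proj i : (Fin n → ℝ) →L[ℝ] ℝ)
    have e : fderiv ℝ f = ∑ i, (L i) ∘ (pd i f) := by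
      funext y
      ext1 z
      rw [fderiv_eq_sum_pd]
      simp [L, mul_comm]
    have hc : ∀ i, ContDiffAt ℝ m ((L i) ∘ (pd i f)) x := fun i =>
      ((L i).contDiff.contDiffAt.comp x (contDiffAt_pd i hf)).of_le hm
    rw [e, iteratedFDeriv_sum_apply fun i _ => hc i]
    refine Finset.sum_eq_zero fun i _ => ?_
    rw [ContinuousLinearMap.iteratedFDeriv_comp_left _ (contDiffAt_pd i hf) hm, h i]
    ext; simp

lemma flat_iff_iteratedFDeriv (hf : ContDiffAt ℝ ∞ f x) :
    Flat N f x ↔ ∀ m < N, iteratedFDeriv ℝ m f x = 0 := by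
  induction N generalizing f with
  | zero => exact ⟨fun _ m hm => absurd hm (Nat.not_lt_zero m), fun _ => hf⟩
  | succ N ih =>
    have h0 : iteratedFDeriv ℝ 0 f x = 0 ↔ f x = 0 := by
      rw [← norm_eq_zero, norm_iteratedFDeriv_zero, norm_eq_zero]
    have hs : ∀ m, iteratedFDeriv ℝ (m + 1) f x = 0 ↔
        ∀ i, iteratedFDeriv ℝ m (pd i f) x = 0 := fun m => by
      rw [← iteratedFDeriv_fderiv_eq_zero_iff hf, ← norm_eq_zero, ← norm_iteratedFDeriv_fderiv,
        norm_eq_zero]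
    constructor
    · rintro ⟨-, h1, h2⟩ m hm
      cases m with
      | zero => exact h0.mpr h1
      | succ m =>
        exact (hs m).mpr fun i => (ih (contDiffAt_pd i hf)).mp (h2 i) m (Nat.lt_of_succ_lt_succ hm)
    · intro h
      refine ⟨hf, h0.mp (h 0 (Nat.succ_pos N)), fun i => ?_⟩
      exact (ih (contDiffAt_pd i hf)).mpr fun m hm =>
        (hs m).mp (h (m + 1) (Nat.succ_lt_succ hm)) i

/-! ### Iterated partial derivatives at a point -/

/-- The iterated partial derivative at `x` along a list of directions. -/
def jetList (x : Fin n → ℝ) : List (Fin n) → ((Fin n → ℝ) → ℝ) → ℝ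
  | [], f => f x
  | i :: l, f => jetList x l (pd i f)

lemma jetList_congr (l : List (Fin n)) (h : f =ᶠ[nhds x] g) : jetList x l f = jetList x l g := by
  induction l generalizing f g with
  | nil => exact h.self_of_nhds
  | cons i l ih => exact ih (pd_congr i h)

lemma jetList_perm {l l' : List (Fin n)} (h : l.Perm l') (hf : ContDiffAt ℝ ∞ f x) :
    jetList x l f = jetList x l' f := by
  induction h generalizing f with
  | nil => rfl
  | cons i _ ih => exact ih (contDiffAt_pd i hf)
  | swap i j l => exact jetList_congr l (pd_pd_comm_eventuallyEq j i hf)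
  | trans _ _ ih1 ih2 => rw [ih1 hf, ih2 hf]

/-- The iterated partial derivative of `f` at `x` along a multiset of directions. The list is
an arbitrary ordering of the multiset, which is immaterial for smooth `f`. -/
def jet (x : Fin n → ℝ) (f : (Fin n → ℝ) → ℝ) (s : Multiset (Fin n)) : ℝ := jetList x s.toList f

lemma jet_congr (s : Multiset (Fin n)) (h : f =ᶠ[nhds x] g) : jet x f s = jet x g s :=
  jetList_congr _ h

lemma jet_coe (l : List (Fin n)) (hf : ContDiffAt ℝ ∞ f x) : jet x f l = jetList x l f :=
  jetList_perm (Multiset.coe_eq_coe.mp (Multiset.coe_toList _)) hf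

lemma jet_cons (i : Fin n) (s : Multiset (Fin n)) (hf : ContDiffAt ℝ ∞ f x) :
    jet x f (i ::ₘ s) = jet x (pd i f) s := by
  induction s using Quotient.inductionOn with
  | h l =>
    change jet x f ((i :: l : List (Fin n)) : Multiset (Fin n)) = jet x (pd i f) (l : Multiset _)
    rw [jet_coe _ hf, jet_coe _ (contDiffAt_pd i hf)]
    rfl

lemma jet_zero : jet x f 0 = f x := by simp [jet, jetList]

lemma Flat.jet_eq_zero (hf : Flat (N + 1) f x) {s : Multiset (Fin n)} (hs : s.card = N) :
    jet x f s = 0 := by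
  induction N generalizing f s with
  | zero =>
    rw [Multiset.card_eq_zero.mp hs, jet_zero]
    exact hf.2.1
  | succ N ih =>
    obtain ⟨i, hi⟩ := (Multiset.card_pos_iff_exists_mem (s := s)).mp (by omega)
    obtain ⟨s', rfl⟩ := Multiset.exists_cons_of_mem hi
    rw [jet_cons _ _ hf.1]
    exact ih (hf.2.2 i) (by simpa using hs)

lemma Flat.succ_of_jet (hf : Flat N f x)
    (h : ∀ s : Multiset (Fin n), s.card = N → jet x f s = 0) : Flat (N + 1) f x := by
  induction N generalizing f with
  | zero =>
    refine ⟨hf, ?_, fun i => contDiffAt_pd i hf⟩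
    rw [← jet_zero (f := f)]
    exact h 0 rfl
  | succ N ih =>
    refine ⟨hf.1, hf.2.1, fun i => ih (hf.2.2 i) fun s hs => ?_⟩
    rw [← jet_cons _ _ hf.1]
    exact h _ (by simp [hs])

lemma jet_add (s : Multiset (Fin n)) (hf : ContDiffAt ℝ ∞ f x) (hg : ContDiffAt ℝ ∞ g x) :
    jet x (fun y => f y + g y) s = jet x f s + jet x g s := by
  induction s using Multiset.induction_on generalizing f g with
  | empty => simp only [jet_zero]
  | cons i s ih =>
    rw [jet_cons _ _ hf, jet_cons _ _ hg, jet_cons _ _ (hf.add hg),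
      ← ih (contDiffAt_pd i hf) (contDiffAt_pd i hg)]
    refine jet_congr s ?_
    filter_upwards [hf.eventually_infty, hg.eventually_infty] with y h1 h2
    exact pd_add i h1 h2

lemma jet_const_mul (s : Multiset (Fin n)) (r : ℝ) (hf : ContDiffAt ℝ ∞ f x) :
    jet x (fun y => r * f y) s = r * jet x f s := by
  induction s using Multiset.induction_on generalizing f with
  | empty => simp only [jet_zero]
  | cons i s ih =>
    rw [jet_cons _ _ hf, jet_cons _ _ (contDiffAt_const.mul hf), ← ih (contDiffAt_pd i hf)]
    refine jet_congr s ?_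
    filter_upwards [hf.eventually_infty] with y h1
    rw [pd_mul i (differentiableAt_const _) h1, pd_const]
    ring

lemma jet_sub (s : Multiset (Fin n)) (hf : ContDiffAt ℝ ∞ f x) (hg : ContDiffAt ℝ ∞ g x) :
    jet x (fun y => f y - g y) s = jet x f s - jet x g s := by
  have e : (fun y => f y - g y) = fun y => f y + (-1) * g y := by funext y; ring
  rw [e, jet_add s hf (contDiffAt_const.mul hg), jet_const_mul s _ hg]
  ring

/-- The leading jet of a multiple. -/
lemma Flat.jet_mul (hf : Flat N f x) (hc : ContDiffAt ℝ ∞ c x) {s : Multiset (Fin n)}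
    (hs : s.card = N) : jet x (fun y => c y * f y) s = c x * jet x f s := by
  have h1 : Flat (N + 1) (fun y => (c y - c x) * f y) x :=
    hf.mul_of_eq_zero (hc.sub contDiffAt_const) (sub_self _)
  have h2 := h1.jet_eq_zero hs
  have e : (fun y => (c y - c x) * f y) = fun y => c y * f y - c x * f y := by
    funext y; ring
  rw [e, jet_sub s (hc.mul hf.contDiffAt) (contDiffAt_const.mul hf.contDiffAt),
    jet_const_mul s _ hf.contDiffAt] at h2
  linarith

/-! ### Polynomials with prescribed leading jet -/

/-- The homogeneous polynomial of degree `K` in `y - x` whose iterated partial derivative along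
each multiset `s` of `K` directions is `φ s`, built by Euler's formula. -/
def jetPoly (x : Fin n → ℝ) : ℕ → (Multiset (Fin n) → ℝ) → (Fin n → ℝ) → ℝ
  | 0, φ => fun _ => φ 0
  | K + 1, φ => fun y =>
      ((K : ℝ) + 1)⁻¹ * ∑ i, (y i - x i) * jetPoly x K (fun s => φ (i ::ₘ s)) y

lemma contDiff_jetPoly (K : ℕ) (φ : Multiset (Fin n) → ℝ) : ContDiff ℝ ∞ (jetPoly x K φ) := by
  induction K generalizing φ with
  | zero => exact contDiff_const
  | succ K ih =>
    refine contDiff_const.mul (ContDiff.sum fun i _ => ContDiff.mul ?_ (ih _))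
    exact (contDiff_apply ℝ ℝ i).sub contDiff_const

lemma pd_jetPoly (K : ℕ) (φ : Multiset (Fin n) → ℝ) (j : Fin n) :
    pd j (jetPoly x (K + 1) φ) = jetPoly x K fun s => φ (j ::ₘ s) := by
  have hcoord : ∀ (i : Fin n) (y : Fin n → ℝ), HasFDerivAt (fun y : Fin n → ℝ => y i - x i)
      (ContinuousLinearMap.proj i : (Fin n → ℝ) →L[ℝ] ℝ) y := fun i y =>
    (ContinuousLinearMap.proj (R := ℝ) (φ := fun _ : Fin n => ℝ) i).hasFDerivAt.sub_const (x i)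
  have hstep : ∀ (K : ℕ) (φ : Multiset (Fin n) → ℝ) (y : Fin n → ℝ),
      pd j (jetPoly x (K + 1) φ) y = ((K : ℝ) + 1)⁻¹ *
        (jetPoly x K (fun s => φ (j ::ₘ s)) y
          + ∑ i, (y i - x i) * pd j (jetPoly x K fun s => φ (i ::ₘ s)) y) := by
    intro K φ y
    have hd : ∀ i, HasFDerivAt (jetPoly x K fun s => φ (i ::ₘ s)) _ y := fun i =>
      ((contDiff_jetPoly K fun s => φ (i ::ₘ s)).contDiffAt.differentiableAt_infty
        (x := y)).hasFDerivAt
    have := (HasFDerivAt.fun_sum (u := Finset.univ) fun i _ =>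
      (hcoord i y).fun_mul (hd i)).const_mul ((K : ℝ) + 1)⁻¹
    have h2 : HasFDerivAt (jetPoly x (K + 1) φ) _ y := this
    rw [pd, h2.fderiv]
    simp only [smul_apply, smul_eq_mul, sum_apply, add_apply, ContinuousLinearMap.proj_apply,
      Pi.single_apply, mul_ite, mul_one, mul_zero, Finset.sum_add_distrib, Finset.sum_ite_eq',
      Finset.mem_univ, if_true]
    congr 1
    exact add_comm _ _
  induction K generalizing φ with
  | zero =>
    funext y
    rw [hstep]
    simp [jetPoly, pd_const]
  | succ K ih =>
    funext y
    rw [hstep]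
    simp only [ih]
    have e : ∑ i, (y i - x i) * jetPoly x K (fun s => φ (i ::ₘ j ::ₘ s)) y
        = ((K : ℝ) + 1) * jetPoly x (K + 1) (fun s => φ (j ::ₘ s)) y := by
      have hK : (K : ℝ) + 1 ≠ 0 := by positivity
      simp only [jetPoly]
      rw [mul_inv_cancel_left₀ hK]
      exact Finset.sum_congr rfl fun i _ => by simp only [Multiset.cons_swap j i]
    rw [e]
    have hK : (K : ℝ) + 1 + 1 ≠ 0 := by positivity
    push_cast
    field_simp
    ring

lemma flat_jetPoly (K : ℕ) (φ : Multiset (Fin n) → ℝ) : Flat K (jetPoly x K φ) x := by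
  induction K generalizing φ with
  | zero => exact (contDiff_jetPoly 0 φ).contDiffAt
  | succ K ih =>
    refine ⟨(contDiff_jetPoly _ φ).contDiffAt, by simp [jetPoly], fun i => ?_⟩
    rw [pd_jetPoly]
    exact ih _

lemma jet_jetPoly (φ : Multiset (Fin n) → ℝ) (s : Multiset (Fin n)) :
    jet x (jetPoly x s.card φ) s = φ s := by
  induction s using Multiset.induction_on generalizing φ with
  | empty => rw [jet_zero]; rfl
  | cons i s ih =>
    rw [jet_cons _ _ (contDiff_jetPoly _ φ).contDiffAt, Multiset.card_cons, pd_jetPoly, ih]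

end Jets

/-! ### The algebra of prolongation -/

section Prolongation

variable {n : ℕ}

/-- The cyclic sum `𝔖 (aᵢ-aⱼ)(aₖ-aₗ)(Mᵢⱼ+Mₖₗ)` over `(j, k, l)`. -/
def quad (a : Fin n → ℝ) (M : Fin n → Fin n → ℝ) (i j k l : Fin n) : ℝ :=
  (a i - a j) * (a k - a l) * (M i j + M k l) + (a i - a k) * (a l - a j) * (M i k + M l j)
    + (a i - a l) * (a j - a k) * (M i l + M j k)

/-- The algebraic relations between the components `Tᵢⱼₖₗ` of a 4-form `T = ω ∧ τ ∧ A`, where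
`ω = ∑ eⁱ` and `τ = ∑ aᵢ eⁱ`: it is alternating, `ω ∧ T = 0` and `τ ∧ T = 0`. -/
structure IsWedge (a : Fin n → ℝ) (T : Fin n → Fin n → Fin n → Fin n → ℝ) : Prop where
  alt₁₂ : ∀ i j k l, T j i k l = - T i j k l
  alt₂₃ : ∀ i j k l, T i k j l = - T i j k l
  alt₃₄ : ∀ i j k l, T i j l k = - T i j k l
  omega_wedge : ∀ i j k l m, T j k l m - T i k l m + T i j l m - T i j k m + T i j k l = 0
  tau_wedge : ∀ i j k l m,
    a i * T j k l m - a j * T i k l m + a k * T i j l m - a l * T i j k m + a m * T i j k l = 0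

variable {a : Fin n → ℝ}

lemma isWedge_quad {M : Fin n → Fin n → ℝ} (hM : ∀ i j, M i j = M j i) :
    IsWedge a (quad a M) where
  alt₁₂ i j k l := by
    simp only [quad]
    rw [hM j i, hM l i, hM l j]
    ring
  alt₂₃ i j k l := by
    simp only [quad]
    rw [hM k j, hM j l, hM k l]
    ring
  alt₃₄ i j k l := by
    simp only [quad]
    rw [hM l k, hM k j, hM j l]
    ring
  omega_wedge i j k l m := by
    simp only [quad]
    rw [hM m k, hM m j, hM l j]
    ring
  tau_wedge i j k l m := by
    simp only [quad]
    rw [hM m k, hM m j, hM l j]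
    ring

lemma IsWedge.add {T T' : Fin n → Fin n → Fin n → Fin n → ℝ} (h : IsWedge a T)
    (h' : IsWedge a T') : IsWedge a (fun i j k l => T i j k l + T' i j k l) where
  alt₁₂ i j k l := by rw [h.alt₁₂, h'.alt₁₂]; ring
  alt₂₃ i j k l := by rw [h.alt₂₃, h'.alt₂₃]; ring
  alt₃₄ i j k l := by rw [h.alt₃₄, h'.alt₃₄]; ring
  omega_wedge i j k l m := by
    linear_combination h.omega_wedge i j k l m + h'.omega_wedge i j k l m
  tau_wedge i j k l m := by
    linear_combination h.tau_wedge i j k l m + h'.tau_wedge i j k l m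

lemma IsWedge.eq_zero_of_not_distinct {T : Fin n → Fin n → Fin n → Fin n → ℝ}
    (h : IsWedge a T) {i j k l : Fin n} (hd : ¬ Distinct4 i j k l) : T i j k l = 0 := by
  have e12 : ∀ i k l, T i i k l = 0 := fun i k l => self_eq_neg.mp (h.alt₁₂ i i k l)
  have e23 : ∀ i j l, T i j j l = 0 := fun i j l => self_eq_neg.mp (h.alt₂₃ i j j l)
  have e34 : ∀ i j k, T i j k k = 0 := fun i j k => self_eq_neg.mp (h.alt₃₄ i j k k)
  have e13 : ∀ i j l, T i j i l = 0 := fun i j l => by rw [h.alt₂₃ i i j l, e12, neg_zero]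
  have e24 : ∀ i j k, T i j k j = 0 := fun i j k => by rw [h.alt₃₄ i j j k, e23, neg_zero]
  have e14 : ∀ i j k, T i j k i = 0 := fun i j k => by rw [h.alt₃₄ i j i k, e13, neg_zero]
  by_contra hT
  refine hd ⟨?_, ?_, ?_, ?_, ?_, ?_⟩ <;> rintro rfl <;> simp_all

/-- The components with two fixed indices determine all the others. -/
lemma IsWedge.eq_zero {T : Fin n → Fin n → Fin n → Fin n → ℝ} (h : IsWedge a T) {z o : Fin n}
    (hzo : a z ≠ a o)
    (h0 : ∀ k l, k ≠ l → k ≠ z → k ≠ o → l ≠ z → l ≠ o → T z o k l = 0) (i j k l : Fin n) :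
    T i j k l = 0 := by
  have h1 : ∀ k l, T z o k l = 0 := by
    intro k l
    by_cases hd : Distinct4 z o k l
    · exact h0 k l hd.2.2.2.2.2 hd.2.1.symm hd.2.2.2.1.symm hd.2.2.1.symm hd.2.2.2.2.1.symm
    · exact h.eq_zero_of_not_distinct hd
  have h2 : ∀ k l m, T z k l m = 0 := by
    intro k l m
    have r1 := h.omega_wedge z o k l m
    have r2 := h.tau_wedge z o k l m
    rw [h1, h1, h1] at r1 r2
    have : (a z - a o) * T z k l m = 0 := by linear_combination r2 - a z * r1
    exact (mul_eq_zero.mp this).resolve_left (sub_ne_zero.mpr hzo)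
  have r := h.omega_wedge z i j k l
  rw [h2, h2, h2, h2] at r
  linarith

variable (a) (U : Fin n → ℝ) (φ ψ : Multiset (Fin n) → ℝ)

/-- The symbol of `(2uᵢⱼ - (aᵢ+aⱼ)vᵢⱼ) / (uᵢuⱼ)` applied to jets `φ` and `ψ`. -/
def symbE (s : Multiset (Fin n)) (i j : Fin n) : ℝ :=
  (2 * φ (i ::ₘ j ::ₘ s) - (a i + a j) * ψ (i ::ₘ j ::ₘ s)) / (U i * U j)

/-- The symbol of `(2aᵢaⱼvᵢⱼ - (aᵢ+aⱼ)uᵢⱼ) / (uᵢuⱼ)` applied to jets `φ` and `ψ`. -/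
def symbF (s : Multiset (Fin n)) (i j : Fin n) : ℝ :=
  (2 * (a i * a j) * ψ (i ::ₘ j ::ₘ s) - (a i + a j) * φ (i ::ₘ j ::ₘ s)) / (U i * U j)

/-- The alternating sum over five indices
`∑ ± (t-aₘ)²/uₘ Gᵢⱼₖₗ(m)`, which expresses the differential syzygy of the system when `G(m)` is the
derivative of `tE + F` in the direction `m`. -/
def syzygy (t : ℝ) (G : Fin n → Fin n → Fin n → Fin n → Fin n → ℝ) (i j k l m : Fin n) : ℝ :=
  (t - a i) ^ 2 / U i * G j k l m i - (t - a j) ^ 2 / U j * G i k l m j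
    + (t - a k) ^ 2 / U k * G i j l m k - (t - a l) ^ 2 / U l * G i j k m l
    + (t - a m) ^ 2 / U m * G i j k l m

variable {a U φ ψ}

lemma symbE_comm (s : Multiset (Fin n)) (i j : Fin n) :
    symbE a U φ ψ s i j = symbE a U φ ψ s j i := by
  simp only [symbE]
  rw [Multiset.cons_swap i j, add_comm (a i), mul_comm (U i)]

lemma symbF_comm (s : Multiset (Fin n)) (i j : Fin n) :
    symbF a U φ ψ s i j = symbF a U φ ψ s j i := by
  simp only [symbF]
  rw [Multiset.cons_swap i j, add_comm (a i), mul_comm (U i), mul_comm (a i)]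

/-- The symbol satisfies the syzygy. -/
lemma syzygy_symb (hU : ∀ i, U i ≠ 0) (s : Multiset (Fin n)) (t : ℝ) (i j k l m : Fin n) :
    syzygy a U t (fun i j k l r => t * quad a (symbE a U φ ψ (r ::ₘ s)) i j k l
      + quad a (symbF a U φ ψ (r ::ₘ s)) i j k l) i j k l m = 0 := by
  have hE : ∀ r i j, t * symbE a U φ ψ (r ::ₘ s) i j + symbF a U φ ψ (r ::ₘ s) i j
      = ((2 * t - a i - a j) * φ (i ::ₘ j ::ₘ r ::ₘ s)
        - (t * (a i + a j) - 2 * (a i * a j)) * ψ (i ::ₘ j ::ₘ r ::ₘ s)) / (U i * U j) := by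
    intro r i j
    simp only [symbE, symbF]
    ring
  have hq : ∀ r i j k l, t * quad a (symbE a U φ ψ (r ::ₘ s)) i j k l
      + quad a (symbF a U φ ψ (r ::ₘ s)) i j k l
      = quad a (fun i j => ((2 * t - a i - a j) * φ (i ::ₘ j ::ₘ r ::ₘ s)
        - (t * (a i + a j) - 2 * (a i * a j)) * ψ (i ::ₘ j ::ₘ r ::ₘ s)) / (U i * U j))
          i j k l := by
    intro r i j k l
    simp only [← hE, quad]
    ring
  simp only [syzygy]
  simp only [hq]
  simp only [quad]
  have := hU i; have := hU j; have := hU k; have := hU l; have := hU m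
  simp only [Multiset.cons_swap]
  field_simp
  ring

end Prolongation

/-! ### Solving the prolonged equations -/

section ProlongationSolve

variable {n : ℕ} {a U : Fin n → ℝ}

lemma eq_zero_of_square_mul_affine {a b e f e' f' : ℝ} (hab : a ≠ b)
    (h : ∀ t : ℝ, (t - a) ^ 2 * (t * e + f) = (t - b) ^ 2 * (t * e' + f')) :
    (e = 0 ∧ f = 0) ∧ (e' = 0 ∧ f' = 0) := by
  have hd := sub_ne_zero.mpr hab
  have h1 : a * e' + f' = 0 := by
    have := h a
    rw [sub_self, zero_pow two_ne_zero, zero_mul] at this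
    exact (mul_eq_zero.mp this.symm).resolve_left (pow_ne_zero 2 hd)
  have h2 : b * e + f = 0 := by
    have := h b
    rw [sub_self, zero_pow two_ne_zero, zero_mul] at this
    exact (mul_eq_zero.mp this).resolve_left (pow_ne_zero 2 (sub_ne_zero.mpr hab.symm))
  have h3 : (a - b) ^ 3 * (e + e') = 0 := by
    linear_combination 8 * (h ((a + b) / 2)) - 2 * (a - b) ^ 2 * h2 + 2 * (a - b) ^ 2 * h1
  have h4 : (a - b) ^ 3 * (2 * e - e') = 0 := by
    have := h (2 * b - a)
    linear_combination (-1 / 2) * this + 2 * (a - b) ^ 2 * h2 - (1 / 2) * (a - b) ^ 2 * h1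
  have h3' := (mul_eq_zero.mp h3).resolve_left (pow_ne_zero 3 hd)
  have h4' := (mul_eq_zero.mp h4).resolve_left (pow_ne_zero 3 hd)
  have he : e = 0 := by linarith
  have he' : e' = 0 := by linarith
  subst he he'
  exact ⟨⟨rfl, by linarith⟩, rfl, by linarith⟩

/-- The pair `(2x - (a+b)y, 2aby - (a+b)x)` takes all values when `a ≠ b`. -/
lemma exists_pair_eq {a b : ℝ} (hab : a ≠ b) (e f : ℝ) :
    ∃ x y : ℝ, 2 * x - (a + b) * y = e ∧ 2 * (a * b) * y - (a + b) * x = f := by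
  have hd := sub_ne_zero.mpr hab
  refine ⟨-(2 * (a * b) * e + (a + b) * f) / (a - b) ^ 2, -(2 * f + (a + b) * e) / (a - b) ^ 2,
    ?_, ?_⟩ <;> · field_simp; ring

variable (z o : Fin n)

/-- An index other than the two distinguished ones. -/
def Regular (k : Fin n) : Prop := k ≠ z ∧ k ≠ o

open Classical in
/-- The number of regular indices in a multiset. -/
def weight (s : Multiset (Fin n)) : ℕ := s.countP (Regular z o)

variable {z o}

lemma weight_cons_regular {k : Fin n} (hk : Regular z o k) (s : Multiset (Fin n)) :
    weight z o (k ::ₘ s) = weight z o s + 1 := by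
  classical
  exact Multiset.countP_cons_of_pos _ hk

lemma weight_cons_left (s : Multiset (Fin n)) : weight z o (z ::ₘ s) = weight z o s := by
  classical
  exact Multiset.countP_cons_of_neg _ fun h => h.1 rfl

lemma weight_cons_right (s : Multiset (Fin n)) : weight z o (o ::ₘ s) = weight z o s := by
  classical
  exact Multiset.countP_cons_of_neg _ fun h => h.2 rfl

lemma weight_le_card (s : Multiset (Fin n)) : weight z o s ≤ s.card := by
  classical
  exact Multiset.countP_le_card _ _

/-- With `z` and `o` as the two distinguished indices, the symbol with indices `z o k l` at `s`
involves `φ` and `ψ` only at `{k, l} + s` and at multisets of smaller weight. -/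
lemma quad_symb_congr {φ ψ φ' ψ' : Multiset (Fin n) → ℝ} {w : ℕ}
    (h : ∀ β, weight z o β ≤ w → φ β = φ' β ∧ ψ β = ψ' β) {s : Multiset (Fin n)}
    (hs : weight z o s + 1 ≤ w) {k l : Fin n} (hk : Regular z o k) (hl : Regular z o l)
    (hkl : φ (k ::ₘ l ::ₘ s) = φ' (k ::ₘ l ::ₘ s) ∧ ψ (k ::ₘ l ::ₘ s) = ψ' (k ::ₘ l ::ₘ s)) :
    quad a (symbE a U φ ψ s) z o k l = quad a (symbE a U φ' ψ' s) z o k l ∧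
      quad a (symbF a U φ ψ s) z o k l = quad a (symbF a U φ' ψ' s) z o k l := by
  have h1 := h (z ::ₘ o ::ₘ s) (by rw [weight_cons_left, weight_cons_right]; omega)
  have h2 := h (z ::ₘ k ::ₘ s) (by rw [weight_cons_left, weight_cons_regular hk]; omega)
  have h3 := h (l ::ₘ o ::ₘ s) (by rw [weight_cons_regular hl, weight_cons_right]; omega)
  have h4 := h (z ::ₘ l ::ₘ s) (by rw [weight_cons_left, weight_cons_regular hl]; omega)
  have h5 := h (o ::ₘ k ::ₘ s) (by rw [weight_cons_right, weight_cons_regular hk]; omega)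
  simp only [quad, symbE, symbF, hkl.1, hkl.2, h1.1, h1.2, h2.1, h2.2, h3.1, h3.2, h4.1, h4.2,
    h5.1, h5.2, and_self]

/-- The effect on the symbol with indices `z o k l` at `s` of changing `φ` and `ψ` at
`{k, l} + s` but not at multisets of smaller weight. -/
lemma quad_symb_update {φ ψ φ' ψ' : Multiset (Fin n) → ℝ} {w : ℕ}
    (h : ∀ β, weight z o β ≤ w → φ β = φ' β ∧ ψ β = ψ' β) {s : Multiset (Fin n)}
    (hs : weight z o s + 1 ≤ w) {k l : Fin n} (hk : Regular z o k) (hl : Regular z o l)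
    {x y : ℝ} (hx : φ' (k ::ₘ l ::ₘ s) = φ (k ::ₘ l ::ₘ s) + x)
    (hy : ψ' (k ::ₘ l ::ₘ s) = ψ (k ::ₘ l ::ₘ s) + y) :
    quad a (symbE a U φ' ψ' s) z o k l = quad a (symbE a U φ ψ s) z o k l
        + (a z - a o) * (a k - a l) / (U k * U l) * (2 * x - (a k + a l) * y) ∧
      quad a (symbF a U φ' ψ' s) z o k l = quad a (symbF a U φ ψ s) z o k l
        + (a z - a o) * (a k - a l) / (U k * U l) * (2 * (a k * a l) * y - (a k + a l) * x) := by
  have h1 := h (z ::ₘ o ::ₘ s) (by rw [weight_cons_left, weight_cons_right]; omega)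
  have h2 := h (z ::ₘ k ::ₘ s) (by rw [weight_cons_left, weight_cons_regular hk]; omega)
  have h3 := h (l ::ₘ o ::ₘ s) (by rw [weight_cons_regular hl, weight_cons_right]; omega)
  have h4 := h (z ::ₘ l ::ₘ s) (by rw [weight_cons_left, weight_cons_regular hl]; omega)
  have h5 := h (o ::ₘ k ::ₘ s) (by rw [weight_cons_right, weight_cons_regular hk]; omega)
  simp only [quad, symbE, symbF, hx, hy, h1.1, h1.2, h2.1, h2.2, h3.1, h3.2, h4.1, h4.2,
    h5.1, h5.2]
  constructor <;> ring

variable {N : ℕ} {hE hF : Fin n → Fin n → Fin n → Fin n → Multiset (Fin n) → ℝ}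

/-- The inhomogeneous linear equations for the leading jets `φ` and `ψ` at the multiset `s`, for
one choice of indices. -/
def SolvesAt (a U : Fin n → ℝ) (hE hF : Fin n → Fin n → Fin n → Fin n → Multiset (Fin n) → ℝ)
    (φ ψ : Multiset (Fin n) → ℝ) (s : Multiset (Fin n)) (i j k l : Fin n) : Prop :=
  quad a (symbE a U φ ψ s) i j k l + hE i j k l s = 0 ∧
    quad a (symbF a U φ ψ s) i j k l + hF i j k l s = 0

variable {φ ψ : Multiset (Fin n) → ℝ}

/-- The equations with indices `z, o` imply all the others. -/
lemma SolvesAt.of_regular (ha : ∀ i j, i ≠ j → a i ≠ a j) (hzo : z ≠ o) {s : Multiset (Fin n)}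
    (hEw : IsWedge a fun i j k l => hE i j k l s) (hFw : IsWedge a fun i j k l => hF i j k l s)
    (h : ∀ k l, k ≠ l → Regular z o k → Regular z o l → SolvesAt a U hE hF φ ψ s z o k l)
    (i j k l : Fin n) : SolvesAt a U hE hF φ ψ s i j k l := by
  have hE' := (isWedge_quad (a := a) (symbE_comm (a := a) (U := U) (φ := φ) (ψ := ψ) s)).add hEw
  have hF' := (isWedge_quad (a := a) (symbF_comm (a := a) (U := U) (φ := φ) (ψ := ψ) s)).add hFw
  exact ⟨hE'.eq_zero (ha z o hzo) (fun k l hkl h1 h2 h3 h4 => (h k l hkl ⟨h1, h2⟩ ⟨h3, h4⟩).1)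
      i j k l,
    hF'.eq_zero (ha z o hzo) (fun k l hkl h1 h2 h3 h4 => (h k l hkl ⟨h1, h2⟩ ⟨h3, h4⟩).2) i j k l⟩

lemma SolvesAt.symm {s : Multiset (Fin n)}
    (hEw : IsWedge a fun i j k l => hE i j k l s) (hFw : IsWedge a fun i j k l => hF i j k l s)
    {i j k l : Fin n} (h : SolvesAt a U hE hF φ ψ s i j k l) :
    SolvesAt a U hE hF φ ψ s i j l k := by
  have hE' := (isWedge_quad (a := a) (symbE_comm (a := a) (U := U) (φ := φ) (ψ := ψ) s)).alt₃₄
  have hF' := (isWedge_quad (a := a) (symbF_comm (a := a) (U := U) (φ := φ) (ψ := ψ) s)).alt₃₄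
  have h1 := hEw.alt₃₄ i j k l
  have h2 := hFw.alt₃₄ i j k l
  constructor
  · rw [hE', h1]; linarith [h.1]
  · rw [hF', h2]; linarith [h.2]

/-- The syzygy makes the equations for the value at `{k, l, m} + s` consistent: the equation with
`(k, l)` implies those with `(k, m)` and `(l, m)`, because `(t-aₖ)² X = (t-aₗ)² Y` has no nonzero
solutions `X`, `Y` that are affine in `t`. -/
lemma SolvesAt.exchange
    (hEw : ∀ s, s.card = N → IsWedge a fun i j k l => hE i j k l s)
    (hFw : ∀ s, s.card = N → IsWedge a fun i j k l => hF i j k l s)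
    (hS : ∀ s, s.card + 1 = N → ∀ i j k l m : Fin n, [i, j, k, l, m].Nodup → ∀ t : ℝ,
      syzygy a U t (fun i j k l r => t * hE i j k l (r ::ₘ s) + hF i j k l (r ::ₘ s)) i j k l m = 0)
    (ha : ∀ i j, i ≠ j → a i ≠ a j) (hU : ∀ i, U i ≠ 0) (hzo : z ≠ o)
    {s : Multiset (Fin n)} (hs : s.card + 1 = N)
    (hz : ∀ k l, k ≠ l → Regular z o k → Regular z o l →
      SolvesAt a U hE hF φ ψ (z ::ₘ s) z o k l)
    (ho : ∀ k l, k ≠ l → Regular z o k → Regular z o l →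
      SolvesAt a U hE hF φ ψ (o ::ₘ s) z o k l)
    {k l m : Fin n} (hkl : k ≠ l) (hkm : k ≠ m) (hlm : l ≠ m) (hk : Regular z o k)
    (hl : Regular z o l) (hm : Regular z o m)
    (h : SolvesAt a U hE hF φ ψ (m ::ₘ s) z o k l) :
    SolvesAt a U hE hF φ ψ (l ::ₘ s) z o k m ∧ SolvesAt a U hE hF φ ψ (k ::ₘ s) z o l m := by
  have hcz : (z ::ₘ s).card = N := by simpa using hs
  have hco : (o ::ₘ s).card = N := by simpa using hs
  have h1 := SolvesAt.of_regular ha hzo (hEw _ hcz) (hFw _ hcz) hz o k l m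
  have h2 := SolvesAt.of_regular ha hzo (hEw _ hco) (hFw _ hco) ho z k l m
  have hnd : [z, o, k, l, m].Nodup := by
    simp [hzo, hk.1.symm, hk.2.symm, hl.1.symm, hl.2.symm, hm.1.symm, hm.2.symm, hkl, hkm, hlm]
  have key := eq_zero_of_square_mul_affine (ha k l hkl)
    (e := (quad a (symbE a U φ ψ (k ::ₘ s)) z o l m + hE z o l m (k ::ₘ s)) / U k)
    (f := (quad a (symbF a U φ ψ (k ::ₘ s)) z o l m + hF z o l m (k ::ₘ s)) / U k)
    (e' := (quad a (symbE a U φ ψ (l ::ₘ s)) z o k m + hE z o k m (l ::ₘ s)) / U l)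
    (f' := (quad a (symbF a U φ ψ (l ::ₘ s)) z o k m + hF z o k m (l ::ₘ s)) / U l) fun t => by
      have e1 := hS s hs z o k l m hnd t
      have e2 := syzygy_symb (a := a) (φ := φ) (ψ := ψ) hU s t z o k l m
      simp only [syzygy] at e1 e2
      linear_combination e1 + e2 - (t - a z) ^ 2 / U z * (t * h1.1 + h1.2)
        + (t - a o) ^ 2 / U o * (t * h2.1 + h2.2) - (t - a m) ^ 2 / U m * (t * h.1 + h.2)
  obtain ⟨⟨k1, k2⟩, k3, k4⟩ := key
  rw [div_eq_zero_iff, or_iff_left (hU _)] at k1 k2 k3 k4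
  exact ⟨⟨k3, k4⟩, k1, k2⟩

/-- The value of the jets at one multiset `α` of weight `w + 1` can be chosen so that all the
equations that involve it hold. -/
lemma exists_value
    (hEw : ∀ s, s.card = N → IsWedge a fun i j k l => hE i j k l s)
    (hFw : ∀ s, s.card = N → IsWedge a fun i j k l => hF i j k l s)
    (hS : ∀ s, s.card + 1 = N → ∀ i j k l m : Fin n, [i, j, k, l, m].Nodup → ∀ t : ℝ,
      syzygy a U t (fun i j k l r => t * hE i j k l (r ::ₘ s) + hF i j k l (r ::ₘ s)) i j k l m = 0)
    (ha : ∀ i j, i ≠ j → a i ≠ a j) (hU : ∀ i, U i ≠ 0) (hzo : z ≠ o) {w : ℕ}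
    (hφ : ∀ s, s.card = N → weight z o s + 2 ≤ w → ∀ k l, k ≠ l → Regular z o k → Regular z o l →
      SolvesAt a U hE hF φ ψ s z o k l)
    {α : Multiset (Fin n)} (hα : α.card = N + 2) (hw : weight z o α = w + 1) :
    ∃ x y : ℝ, ∀ k l s, α = k ::ₘ l ::ₘ s → k ≠ l → Regular z o k → Regular z o l →
      ∀ φ' ψ' : Multiset (Fin n) → ℝ, (∀ β, weight z o β ≤ w → φ β = φ' β ∧ ψ β = ψ' β) →
        φ' α = x → ψ' α = y → SolvesAt a U hE hF φ' ψ' s z o k l := by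
  by_cases hex : ∃ k l s, α = k ::ₘ l ::ₘ s ∧ k ≠ l ∧ Regular z o k ∧ Regular z o l
  swap
  · exact ⟨0, 0, fun k l s h1 h2 h3 h4 => absurd ⟨k, l, s, h1, h2, h3, h4⟩ hex⟩
  obtain ⟨k₀, l₀, s₀, hα₀, hkl₀, hk₀, hl₀⟩ := hex
  have hw₀ : ∀ {k l s}, α = k ::ₘ l ::ₘ s → Regular z o k → Regular z o l →
      weight z o s + 1 ≤ w := by
    intro k l s h1 hk hl
    rw [h1, weight_cons_regular hk, weight_cons_regular hl] at hw
    omega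
  have hcard : ∀ {k l s}, α = k ::ₘ l ::ₘ s → s.card = N := by
    intro k l s h1
    rw [h1, Multiset.card_cons, Multiset.card_cons] at hα
    omega
  have hκ : (a z - a o) * (a k₀ - a l₀) / (U k₀ * U l₀) ≠ 0 :=
    div_ne_zero (mul_ne_zero (sub_ne_zero.mpr (ha z o hzo)) (sub_ne_zero.mpr (ha _ _ hkl₀)))
      (mul_ne_zero (hU _) (hU _))
  obtain ⟨x, y, hx, hy⟩ := exists_pair_eq (ha _ _ hkl₀)
    (-(quad a (symbE a U φ ψ s₀) z o k₀ l₀ + hE z o k₀ l₀ s₀)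
      / ((a z - a o) * (a k₀ - a l₀) / (U k₀ * U l₀)))
    (-(quad a (symbF a U φ ψ s₀) z o k₀ l₀ + hF z o k₀ l₀ s₀)
      / ((a z - a o) * (a k₀ - a l₀) / (U k₀ * U l₀)))
  refine ⟨φ α + x, ψ α + y, ?_⟩
  intro k l s hα₁ hkl hk hl φ' ψ' hφ' hx' hy'
  -- the equations that hold for `φ'` and `ψ'` at `α`
  let Good : Fin n → Fin n → Prop := fun k l =>
    ∃ s, α = k ::ₘ l ::ₘ s ∧ SolvesAt a U hE hF φ' ψ' s z o k l
  have hgood₀ : Good k₀ l₀ := by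
    refine ⟨s₀, hα₀, ?_⟩
    obtain ⟨h1, h2⟩ := quad_symb_update (a := a) (U := U) hφ' (hw₀ hα₀ hk₀ hl₀) hk₀ hl₀
      (hα₀ ▸ hx') (hα₀ ▸ hy')
    refine ⟨?_, ?_⟩
    · rw [h1, hx, mul_div_cancel₀ _ hκ]; ring
    · rw [h2, hy, mul_div_cancel₀ _ hκ]; ring
  have hsymm : ∀ {k l}, Good k l → Good l k := by
    rintro k l ⟨s, h1, h2⟩
    exact ⟨s, by rw [h1, Multiset.cons_swap],
      h2.symm (hEw _ (hcard h1)) (hFw _ (hcard h1))⟩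
  have hlow : ∀ s, s.card = N → weight z o s + 2 ≤ w → ∀ k l, k ≠ l → Regular z o k →
      Regular z o l → SolvesAt a U hE hF φ' ψ' s z o k l := by
    intro s hs hws k l hkl hk hl
    have h0 := hφ s hs hws k l hkl hk hl
    have h1 := quad_symb_congr (a := a) (U := U) hφ' (s := s) (by omega) hk hl
      (hφ' _ (by rw [weight_cons_regular hk, weight_cons_regular hl]; omega))
    exact ⟨by rw [← h1.1]; exact h0.1, by rw [← h1.2]; exact h0.2⟩
  have hexch : ∀ {k l m}, k ≠ l → k ≠ m → l ≠ m → Regular z o k → Regular z o l →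
      Regular z o m → m ∈ α → Good k l → Good k m ∧ Good l m := by
    rintro k l m hkl hkm hlm hk hl hm hmα ⟨s, h1, h2⟩
    have hms : m ∈ s := by
      rw [h1, Multiset.mem_cons, Multiset.mem_cons] at hmα
      exact (hmα.resolve_left hkm.symm).resolve_left hlm.symm
    obtain ⟨s', rfl⟩ := Multiset.exists_cons_of_mem hms
    have hc := hcard h1
    have hws := hw₀ h1 hk hl
    rw [Multiset.card_cons] at hc
    rw [weight_cons_regular hm] at hws
    have := SolvesAt.exchange hEw hFw hS ha hU hzo hc
      (hlow _ (by simpa using hc) (by rw [weight_cons_left]; omega))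
      (hlow _ (by simpa using hc) (by rw [weight_cons_right]; omega)) hkl hkm hlm hk hl hm h2
    refine ⟨⟨_, ?_, this.1⟩, ⟨_, ?_, this.2⟩⟩
    · rw [h1, Multiset.cons_swap l m]
    · rw [h1, Multiset.cons_swap k l, Multiset.cons_swap k m]
  have hkα : k ∈ α := by rw [hα₁]; simp
  have hlα : l ∈ α := by rw [hα₁]; simp
  have hmain : Good k l := by
    by_cases hk1 : k = k₀
    · subst hk1
      by_cases hl1 : l = l₀
      · subst hl1; exact hgood₀
      · exact (hexch hkl₀ hkl (Ne.symm hl1) hk₀ hl₀ hl hlα hgood₀).1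
    by_cases hk2 : k = l₀
    · subst hk2
      by_cases hl1 : l = k₀
      · subst hl1; exact hsymm hgood₀
      · exact (hexch hkl₀ (Ne.symm hl1) hkl hk₀ hl₀ hl hlα hgood₀).2
    obtain ⟨g1, g2⟩ := hexch hkl₀ (Ne.symm hk1) (Ne.symm hk2) hk₀ hl₀ hk hkα hgood₀
    by_cases hl1 : l = k₀
    · subst hl1; exact hsymm g1
    by_cases hl2 : l = l₀
    · subst hl2; exact hsymm g2
    exact (hexch (Ne.symm hk1) (Ne.symm hl1) hkl hk₀ hk hl hlα g1).2
  obtain ⟨s', h1, h2⟩ := hmain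
  have : s' = s := by
    rw [h1] at hα₁
    simpa using hα₁
  rw [← this]
  exact h2

/-- The inhomogeneous linear equations for the leading jets are solvable. The equations determine
the value of the jets at a multiset of weight at least two from the values at multisets of smaller
weight, so that they are solved by induction on the weight. -/
theorem exists_prolongation
    (hEw : ∀ s, s.card = N → IsWedge a fun i j k l => hE i j k l s)
    (hFw : ∀ s, s.card = N → IsWedge a fun i j k l => hF i j k l s)
    (hS : ∀ s, s.card + 1 = N → ∀ i j k l m : Fin n, [i, j, k, l, m].Nodup → ∀ t : ℝ,
      syzygy a U t (fun i j k l r => t * hE i j k l (r ::ₘ s) + hF i j k l (r ::ₘ s)) i j k l m = 0)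
    (ha : ∀ i j, i ≠ j → a i ≠ a j) (hU : ∀ i, U i ≠ 0) (hzo : z ≠ o) :
    ∃ φ ψ : Multiset (Fin n) → ℝ, ∀ s, s.card = N → ∀ i j k l,
      SolvesAt a U hE hF φ ψ s i j k l := by
  have step : ∀ w : ℕ, ∃ φ ψ : Multiset (Fin n) → ℝ, ∀ s, s.card = N → weight z o s + 2 ≤ w →
      ∀ k l, k ≠ l → Regular z o k → Regular z o l → SolvesAt a U hE hF φ ψ s z o k l := by
    intro w
    induction w with
    | zero => exact ⟨0, 0, fun s _ h => absurd h (by omega)⟩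
    | succ w ih =>
      obtain ⟨φ, ψ, hφ⟩ := ih
      have hv := fun (α : Multiset (Fin n)) (hα : α.card = N + 2) (hw : weight z o α = w + 1) =>
        exists_value hEw hFw hS ha hU hzo hφ hα hw
      choose X Y hXY using hv
      classical
      let φ' : Multiset (Fin n) → ℝ := fun β =>
        if h : β.card = N + 2 ∧ weight z o β = w + 1 then X β h.1 h.2 else φ β
      let ψ' : Multiset (Fin n) → ℝ := fun β =>
        if h : β.card = N + 2 ∧ weight z o β = w + 1 then Y β h.1 h.2 else ψ β
      have hag : ∀ β, weight z o β ≤ w → φ β = φ' β ∧ ψ β = ψ' β := by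
        intro β hβ
        have : ¬ (β.card = N + 2 ∧ weight z o β = w + 1) := fun h => by omega
        simp only [φ', ψ', dif_neg this, and_self]
      refine ⟨φ', ψ', fun s hs hws k l hkl hk hl => ?_⟩
      by_cases hws' : weight z o s + 2 ≤ w
      · have h0 := hφ s hs hws' k l hkl hk hl
        have h1 := quad_symb_congr (a := a) (U := U) hag (s := s) (by omega) hk hl
          (hag _ (by rw [weight_cons_regular hk, weight_cons_regular hl]; omega))
        exact ⟨by rw [← h1.1]; exact h0.1, by rw [← h1.2]; exact h0.2⟩
      · have hα : (k ::ₘ l ::ₘ s).card = N + 2 ∧ weight z o (k ::ₘ l ::ₘ s) = w + 1 := by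
          rw [Multiset.card_cons, Multiset.card_cons, weight_cons_regular hk,
            weight_cons_regular hl]
          omega
        exact hXY _ hα.1 hα.2 k l s rfl hkl hk hl φ' ψ' hag (dif_pos hα) (dif_pos hα)
  obtain ⟨φ, ψ, h⟩ := step (N + 2)
  refine ⟨φ, ψ, fun s hs => SolvesAt.of_regular ha hzo (hEw s hs) (hFw s hs) (h s hs ?_)⟩
  have := weight_le_card (z := z) (o := o) s
  omega

end ProlongationSolve

/-! ### The differential syzygy of the system -/

section Bianchi

variable {n : ℕ}

/-- The component `(A ∧ B)ᵢⱼₖₗ` of the product of two 2-forms. -/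
def wedge22 (A B : Fin n → Fin n → ℝ) (i j k l : Fin n) : ℝ :=
  A i j * B k l - A i k * B j l + A i l * B j k + A j k * B i l - A j l * B i k + A k l * B i j

/-- The component of `c ∧ Ξ` for a 1-form `c` and a 4-form `Ξ`. -/
def wedge14 (c : Fin n → ℝ) (Ξ : Fin n → Fin n → Fin n → Fin n → ℝ) (i j k l m : Fin n) : ℝ :=
  c i * Ξ j k l m - c j * Ξ i k l m + c k * Ξ i j l m - c l * Ξ i j k m + c m * Ξ i j k l

/-- The component of `c ∧ A` for a 1-form `c` and a 2-form `A`. -/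
def wedge12 (c : Fin n → ℝ) (A : Fin n → Fin n → ℝ) (i j k : Fin n) : ℝ :=
  c i * A j k - c j * A i k + c k * A i j

/-- If `ω ∧ τ ∧ A = 0` and `ω ∧ τ ∧ B = 0` then `ω ∧ A ∧ B = 0`, with the coefficients that express
the latter form through the former ones. -/
lemma omega_wedge_wedge (p : Fin n → ℝ) (A B : Fin n → Fin n → ℝ) (i j k l m : Fin n) :
    (p j - p i) * wedge14 (fun _ => 1) (wedge22 A B) i j k l m
      = wedge4 p A i j k l * wedge12 (fun _ => 1) B i j m
        - wedge4 p A i j k m * wedge12 (fun _ => 1) B i j l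
        + wedge4 p A i j l m * wedge12 (fun _ => 1) B i j k
        + wedge4 p B i j k l * wedge12 (fun _ => 1) A i j m
        - wedge4 p B i j k m * wedge12 (fun _ => 1) A i j l
        + wedge4 p B i j l m * wedge12 (fun _ => 1) A i j k := by
  simp only [wedge14, wedge22, wedge4, wedge12]
  ring

/-- If `ω ∧ τ ∧ A = 0` then `τ ∧ A ∧ A = 0`, with the coefficients. -/
lemma tau_wedge_wedge (p : Fin n → ℝ) (A : Fin n → Fin n → ℝ) (i j k l m : Fin n) :
    (p j - p i) * wedge14 p (wedge22 A A) i j k l m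
      = 2 * (wedge4 p A i j k l * wedge12 p A i j m
        - wedge4 p A i j k m * wedge12 p A i j l
        + wedge4 p A i j l m * wedge12 p A i j k) := by
  simp only [wedge14, wedge22, wedge4, wedge12]
  ring

/-- The component of `ω ∧ τ ∧ dω` for the 1-forms `ω = ∑ qᵢ dxⁱ` and `τ = ∑ rᵢ dxⁱ`. -/
def wedgeD (q r : Fin n → (Fin n → ℝ) → ℝ) (i j k l : Fin n) (y : Fin n → ℝ) : ℝ :=
  (q i y * r j y - q j y * r i y) * (pd k (q l) y - pd l (q k) y)
    - (q i y * r k y - q k y * r i y) * (pd j (q l) y - pd l (q j) y)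
    + (q i y * r l y - q l y * r i y) * (pd j (q k) y - pd k (q j) y)
    + (q j y * r k y - q k y * r j y) * (pd i (q l) y - pd l (q i) y)
    - (q j y * r l y - q l y * r j y) * (pd i (q k) y - pd k (q i) y)
    + (q k y * r l y - q l y * r k y) * (pd i (q j) y - pd j (q i) y)

/-- `d(ω ∧ τ ∧ dω) = τ ∧ dω ∧ dω - ω ∧ dω ∧ dτ`. -/
lemma d_wedgeD {q r : Fin n → (Fin n → ℝ) → ℝ} {y : Fin n → ℝ}
    (hq : ∀ i, ContDiffAt ℝ ∞ (q i) y) (hr : ∀ i, ContDiffAt ℝ ∞ (r i) y) (i j k l m : Fin n) :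
    pd i (wedgeD q r j k l m) y - pd j (wedgeD q r i k l m) y + pd k (wedgeD q r i j l m) y
        - pd l (wedgeD q r i j k m) y + pd m (wedgeD q r i j k l) y
      = wedge14 (fun i => r i y) (wedge22 (fun i j => pd i (q j) y - pd j (q i) y)
          fun i j => pd i (q j) y - pd j (q i) y) i j k l m
        - wedge14 (fun i => q i y) (wedge22 (fun i j => pd i (q j) y - pd j (q i) y)
          fun i j => pd i (r j) y - pd j (r i) y) i j k l m := by
  have hqd := fun i => (hq i).differentiableAt_infty
  have hrd := fun i => (hr i).differentiableAt_infty
  have hqq := fun i j => (contDiffAt_pd i (hq j)).differentiableAt_infty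
  have ht : ∀ b i j k l, DifferentiableAt ℝ (fun y => (q i y * r j y - q j y * r i y)
      * (pd k (q l) y - pd l (q k) y)) y ∧
      pd b (fun y => (q i y * r j y - q j y * r i y) * (pd k (q l) y - pd l (q k) y)) y
      = (pd b (q i) y * r j y + q i y * pd b (r j) y
            - (pd b (q j) y * r i y + q j y * pd b (r i) y))
          * (pd k (q l) y - pd l (q k) y)
        + (q i y * r j y - q j y * r i y) * (pd2 k b (q l) y - pd2 l b (q k) y) := by
    intro b i j k l
    have d1 : DifferentiableAt ℝ (fun y => q i y * r j y) y := (hqd i).fun_mul (hrd j)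
    have d2 : DifferentiableAt ℝ (fun y => q j y * r i y) y := (hqd j).fun_mul (hrd i)
    have d3 : DifferentiableAt ℝ (fun y => q i y * r j y - q j y * r i y) y := d1.fun_sub d2
    have d4 : DifferentiableAt ℝ (fun y => pd k (q l) y - pd l (q k) y) y :=
      (hqq k l).fun_sub (hqq l k)
    refine ⟨d3.fun_mul d4, ?_⟩
    rw [pd_mul b d3 d4, pd_sub b d1 d2, pd_mul b (hqd i) (hrd j), pd_mul b (hqd j) (hrd i),
      pd_sub b (hqq k l) (hqq l k)]
    rfl
  have hw : ∀ b i j k l, pd b (wedgeD q r i j k l) y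
      = pd b (fun y => (q i y * r j y - q j y * r i y) * (pd k (q l) y - pd l (q k) y)) y
        - pd b (fun y => (q i y * r k y - q k y * r i y) * (pd j (q l) y - pd l (q j) y)) y
        + pd b (fun y => (q i y * r l y - q l y * r i y) * (pd j (q k) y - pd k (q j) y)) y
        + pd b (fun y => (q j y * r k y - q k y * r j y) * (pd i (q l) y - pd l (q i) y)) y
        - pd b (fun y => (q j y * r l y - q l y * r j y) * (pd i (q k) y - pd k (q i) y)) y
        + pd b (fun y => (q k y * r l y - q l y * r k y) * (pd i (q j) y - pd j (q i) y)) y := by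
    intro b i j k l
    have d := fun i j k l => (ht b i j k l).1
    unfold wedgeD
    rw [pd_add b (((((d _ _ _ _).fun_sub (d _ _ _ _)).fun_add (d _ _ _ _)).fun_add
        (d _ _ _ _)).fun_sub (d _ _ _ _)) (d _ _ _ _),
      pd_sub b ((((d _ _ _ _).fun_sub (d _ _ _ _)).fun_add (d _ _ _ _)).fun_add
        (d _ _ _ _)) (d _ _ _ _),
      pd_add b (((d _ _ _ _).fun_sub (d _ _ _ _)).fun_add (d _ _ _ _)) (d _ _ _ _),
      pd_add b ((d _ _ _ _).fun_sub (d _ _ _ _)) (d _ _ _ _), pd_sub b (d _ _ _ _) (d _ _ _ _)]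
  simp only [hw, fun b i j k l => (ht b i j k l).2]
  have hs : ∀ b c i, pd2 b c (q i) y = pd2 c b (q i) y := fun b c i => pd2_comm b c (hq i)
  simp only [wedge14, wedge22]
  rw [hs j i, hs j i, hs j i, hs k i, hs k i, hs k i, hs l i, hs l i, hs l i, hs m i, hs m i,
    hs m i, hs k j, hs k j, hs k j, hs l j, hs l j, hs l j, hs m j, hs m j, hs m j, hs l k,
    hs l k, hs l k, hs m k, hs m k, hs m k, hs m l, hs m l, hs m l]
  ring

end Bianchi

section Syzygy

variable {n : ℕ} {u v : (Fin n → ℝ) → ℝ} {x : Fin n → ℝ} {t : ℝ}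

/-- `rᵢ = uᵢ / (λ - aᵢ)²`, the coefficient of `dxⁱ` in `-∂_λ ω(λ)`. -/
def coeffR (u v : (Fin n → ℝ) → ℝ) (x : Fin n → ℝ) (t : ℝ) (i : Fin n) : ℝ :=
  pole u v x t i * coeffQ u v x t i

lemma contDiffAt_slice_pole (hu : ContDiffAt ℝ ∞ u x) (hv : ContDiffAt ℝ ∞ v x) {i : Fin n}
    (hx : pd i v x ≠ 0) (ht : t ≠ aRatio u v i x) :
    ContDiffAt ℝ ∞ (fun y => pole u v y t i) x :=
  (contDiffAt_const.sub (contDiffAt_aRatio hu hv hx)).inv (sub_ne_zero.mpr ht)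

lemma contDiffAt_slice_coeffQ (hu : ContDiffAt ℝ ∞ u x) (hv : ContDiffAt ℝ ∞ v x) {i : Fin n}
    (hx : pd i v x ≠ 0) (ht : t ≠ aRatio u v i x) :
    ContDiffAt ℝ ∞ (fun y => coeffQ u v y t i) x :=
  (contDiffAt_pd i hu).mul (contDiffAt_slice_pole hu hv hx ht)

lemma contDiffAt_slice_coeffR (hu : ContDiffAt ℝ ∞ u x) (hv : ContDiffAt ℝ ∞ v x) {i : Fin n}
    (hx : pd i v x ≠ 0) (ht : t ≠ aRatio u v i x) :
    ContDiffAt ℝ ∞ (fun y => coeffR u v y t i) x :=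
  (contDiffAt_slice_pole hu hv hx ht).mul (contDiffAt_slice_coeffQ hu hv hx ht)

lemma pd_coeffQ (hu : ContDiffAt ℝ ∞ u x) (hv : ContDiffAt ℝ ∞ v x) {i : Fin n}
    (hx : pd i v x ≠ 0) (ht : t ≠ aRatio u v i x) (j : Fin n) :
    pd j (fun y => coeffQ u v y t i) x
      = pole u v x t i ^ 2 * (t * pd2 i j u x - aRatio u v i x ^ 2 * pd2 i j v x) := by
  have h1 := (contDiffAt_coeffQ hu hv hx ht).differentiableAt_infty.hasFDerivAt
  have h3 := HasFDerivAt.comp (f := fun y : Fin n → ℝ => (y, t)) x h1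
    ((hasFDerivAt_id x).prodMk (hasFDerivAt_const t x))
  have e : (fun y => coeffQ u v y t i)
      = (fun p : (Fin n → ℝ) × ℝ => coeffQ u v p.1 p.2 i) ∘ fun y => (y, t) := rfl
  rw [pd, e, h3.fderiv, ContinuousLinearMap.comp_apply, fderiv_coeffQ hu hv hx ht]
  simp [Pi.single_apply]

lemma pd_coeffR (hu : ContDiffAt ℝ ∞ u x) (hv : ContDiffAt ℝ ∞ v x)
    (hx : NondegenerateAt u v x) (ht : ∀ i, t ≠ aRatio u v i x) (i j : Fin n) :
    pd j (fun y => coeffR u v y t i) x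
      = 2 * pole u v x t i * (pole u v x t i ^ 2 *
          (t * pd2 i j u x - aRatio u v i x ^ 2 * pd2 i j v x))
        - pole u v x t i ^ 2 * pd2 i j u x := by
  have hq := contDiffAt_slice_coeffQ hu hv (hx.2.1 i) (ht i)
  have hr := contDiffAt_slice_coeffR hu hv (hx.2.1 i) (ht i)
  have hui := contDiffAt_pd i hu
  -- differentiate `uᵢ rᵢ = qᵢ²`
  have e : (fun y => pd i u y * coeffR u v y t i)
      = fun y => coeffQ u v y t i * coeffQ u v y t i := by
    funext y
    simp only [coeffR, coeffQ]
    ring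
  have h1 : pd j (fun y => pd i u y * coeffR u v y t i) x
      = pd j (fun y => coeffQ u v y t i * coeffQ u v y t i) x := by rw [e]
  rw [pd_mul j hui.differentiableAt_infty hr.differentiableAt_infty,
    pd_mul j hq.differentiableAt_infty hq.differentiableAt_infty,
    pd_coeffQ hu hv (hx.2.1 i) (ht i)] at h1
  have h0 := hx.1 i
  refine mul_left_cancel₀ h0 ?_
  have h2 : pd j (pd i u) x = pd2 i j u x := rfl
  rw [h2] at h1
  simp only [coeffR, coeffQ] at h1 ⊢
  linear_combination h1

/-- The components `(pⱼ-pᵢ)(t termEᵢⱼ + termFᵢⱼ)`, which are those of `dω` for fixed `λ = t` up to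
a factor `t`. -/
def formA (u v : (Fin n → ℝ) → ℝ) (t : ℝ) (x : Fin n → ℝ) (i j : Fin n) : ℝ :=
  (pole u v x t j - pole u v x t i) * (t * termE u v i j x + termF u v i j x)

/-- The components `(pⱼ-pᵢ) termEᵢⱼ`, which appear besides those of `formA` in `dτ`. -/
def formB (u v : (Fin n → ℝ) → ℝ) (t : ℝ) (x : Fin n → ℝ) (i j : Fin n) : ℝ :=
  (pole u v x t j - pole u v x t i) * termE u v i j x

lemma aRatio_eq_pole (i : Fin n) :
    aRatio u v i x = t - (pole u v x t i)⁻¹ := by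
  simp only [pole, inv_inv]; ring

lemma curl_coeffQ (hu : ContDiffAt ℝ ∞ u x) (hv : ContDiffAt ℝ ∞ v x)
    (hx : NondegenerateAt u v x) (ht : ∀ i, t ≠ aRatio u v i x) (i j : Fin n) :
    pd i (fun y => coeffQ u v y t j) x - pd j (fun y => coeffQ u v y t i) x
      = coeffQ u v x t i * coeffQ u v x t j * (t * formA u v t x i j) := by
  rw [pd_coeffQ hu hv (hx.2.1 i) (ht i), pd_coeffQ hu hv (hx.2.1 j) (ht j), pd2_comm j i hu,
    pd2_comm j i hv]
  have h1 := hx.1 i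
  have h2 := hx.1 j
  have h3 := pole_ne_zero (ht i)
  have h4 := pole_ne_zero (ht j)
  simp only [formA, coeffQ, termE, termF, aRatio_eq_pole (t := t)]
  field_simp
  ring

lemma curl_coeffR (hu : ContDiffAt ℝ ∞ u x) (hv : ContDiffAt ℝ ∞ v x)
    (hx : NondegenerateAt u v x) (ht : ∀ i, t ≠ aRatio u v i x) (i j : Fin n) :
    pd i (fun y => coeffR u v y t j) x - pd j (fun y => coeffR u v y t i) x
      = coeffQ u v x t i * coeffQ u v x t j *
        ((2 * t * (pole u v x t i + pole u v x t j) - 1) * formA u v t x i j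
          - t * formB u v t x i j) := by
  rw [pd_coeffR hu hv hx ht, pd_coeffR hu hv hx ht, pd2_comm j i hu, pd2_comm j i hv]
  have h1 := hx.1 i
  have h2 := hx.1 j
  have h3 := pole_ne_zero (ht i)
  have h4 := pole_ne_zero (ht j)
  simp only [formA, formB, coeffQ, termE, termF, aRatio_eq_pole (t := t)]
  field_simp
  ring

lemma wedge4_formA (hu : ContDiffAt ℝ ∞ u x) (hv : ContDiffAt ℝ ∞ v x)
    (hx : NondegenerateAt u v x) (ht : ∀ i, t ≠ aRatio u v i x) (i j k l : Fin n) :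
    wedge4 (pole u v x t) (formA u v t x) i j k l
      = (pole u v x t i * pole u v x t j * pole u v x t k * pole u v x t l)
        * (t * exprE u v i j k l x + scaledF u v i j k l x) := by
  have h := fun i j => pole_sub_pole (ht i) (ht j)
  rw [scaledF_eq hx, exprE]
  simp only [summandE_eq, wedge4, formA, h]
  rw [termE_comm hu hv l j, termF_comm hu hv l j]
  ring

lemma wedge4_formB (hu : ContDiffAt ℝ ∞ u x) (hv : ContDiffAt ℝ ∞ v x)
    (ht : ∀ i, t ≠ aRatio u v i x) (i j k l : Fin n) :
    wedge4 (pole u v x t) (formB u v t x) i j k l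
      = (pole u v x t i * pole u v x t j * pole u v x t k * pole u v x t l)
        * exprE u v i j k l x := by
  have h := fun i j => pole_sub_pole (ht i) (ht j)
  rw [exprE]
  simp only [summandE_eq, wedge4, formB, h]
  rw [termE_comm hu hv l j]
  ring

/-- The components of `ω ∧ τ ∧ dω` are `tE + aᵢaⱼaₖaₗ F` up to factors without zeros off `t = 0`. -/
lemma wedgeD_coeff (hu : ContDiffAt ℝ ∞ u x) (hv : ContDiffAt ℝ ∞ v x)
    (hx : NondegenerateAt u v x) (ht : ∀ i, t ≠ aRatio u v i x) (i j k l : Fin n) :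
    wedgeD (fun i y => coeffQ u v y t i) (fun i y => coeffR u v y t i) i j k l x
      = (t * (coeffR u v x t i * coeffR u v x t j * coeffR u v x t k * coeffR u v x t l))
        * (t * exprE u v i j k l x + scaledF u v i j k l x) := by
  have h1 := wedge4_formA hu hv hx ht i j k l
  simp only [wedgeD, curl_coeffQ hu hv hx ht]
  simp only [wedge4] at h1
  simp only [coeffR]
  linear_combination t * (coeffQ u v x t i * coeffQ u v x t j * coeffQ u v x t k
    * coeffQ u v x t l) * h1

/-- The exterior derivative of `ω ∧ τ ∧ dω` is a combination of the equations and not of their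
derivatives, after multiplication by `pⱼ - pᵢ`. -/
lemma d_wedgeD_coeff (hu : ContDiffAt ℝ ∞ u x) (hv : ContDiffAt ℝ ∞ v x)
    (hx : NondegenerateAt u v x) (ht : ∀ i, t ≠ aRatio u v i x) (i j k l m : Fin n) :
    let q : Fin n → (Fin n → ℝ) → ℝ := fun i y => coeffQ u v y t i
    let r : Fin n → (Fin n → ℝ) → ℝ := fun i y => coeffR u v y t i
    let p := pole u v x t
    let A := formA u v t x
    let B := formB u v t x
    let σ := p i + p j + p k + p l + p m
    (p j - p i) * (pd i (wedgeD q r j k l m) x - pd j (wedgeD q r i k l m) x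
        + pd k (wedgeD q r i j l m) x - pd l (wedgeD q r i j k m) x + pd m (wedgeD q r i j k l) x)
      = coeffQ u v x t i * coeffQ u v x t j * coeffQ u v x t k * coeffQ u v x t l
          * coeffQ u v x t m *
        ((4 * t ^ 2 * wedge12 p A i j m + (2 * t - 2 * t ^ 2 * σ) * wedge12 (fun _ => 1) A i j m
            + t ^ 2 * wedge12 (fun _ => 1) B i j m) * wedge4 p A i j k l
          - (4 * t ^ 2 * wedge12 p A i j l + (2 * t - 2 * t ^ 2 * σ) * wedge12 (fun _ => 1) A i j l
            + t ^ 2 * wedge12 (fun _ => 1) B i j l) * wedge4 p A i j k m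
          + (4 * t ^ 2 * wedge12 p A i j k + (2 * t - 2 * t ^ 2 * σ) * wedge12 (fun _ => 1) A i j k
            + t ^ 2 * wedge12 (fun _ => 1) B i j k) * wedge4 p A i j l m
          + t ^ 2 * wedge12 (fun _ => 1) A i j m * wedge4 p B i j k l
          - t ^ 2 * wedge12 (fun _ => 1) A i j l * wedge4 p B i j k m
          + t ^ 2 * wedge12 (fun _ => 1) A i j k * wedge4 p B i j l m) := by
  intro q r p A B σ
  have hq : ∀ i, ContDiffAt ℝ ∞ (q i) x := fun i =>
    contDiffAt_slice_coeffQ hu hv (hx.2.1 i) (ht i)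
  have hr : ∀ i, ContDiffAt ℝ ∞ (r i) x := fun i =>
    contDiffAt_slice_coeffR hu hv (hx.2.1 i) (ht i)
  have hGq : ∀ i j, pd i (q j) x - pd j (q i) x
      = coeffQ u v x t i * coeffQ u v x t j * (t * A i j) := curl_coeffQ hu hv hx ht
  have hGr : ∀ i j, pd i (r j) x - pd j (r i) x = coeffQ u v x t i * coeffQ u v x t j *
      ((2 * t * (p i + p j) - 1) * A i j - t * B i j) := curl_coeffR hu hv hx ht
  have hr' : ∀ i, r i x = p i * coeffQ u v x t i := fun i => rfl
  have hq' : ∀ i, q i x = coeffQ u v x t i := fun i => rfl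
  rw [d_wedgeD hq hr]
  simp only [hGq, hGr, hr', hq']
  -- normalise by the coframe
  have e1 : wedge14 (fun i => p i * coeffQ u v x t i)
        (wedge22 (fun i j => coeffQ u v x t i * coeffQ u v x t j * (t * A i j))
          fun i j => coeffQ u v x t i * coeffQ u v x t j * (t * A i j)) i j k l m
      - wedge14 (fun i => coeffQ u v x t i)
        (wedge22 (fun i j => coeffQ u v x t i * coeffQ u v x t j * (t * A i j))
          fun i j => coeffQ u v x t i * coeffQ u v x t j *
            ((2 * t * (p i + p j) - 1) * A i j - t * B i j)) i j k l m
      = coeffQ u v x t i * coeffQ u v x t j * coeffQ u v x t k * coeffQ u v x t l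
          * coeffQ u v x t m *
        (2 * t ^ 2 * wedge14 p (wedge22 A A) i j k l m
          + (t - t ^ 2 * σ) * wedge14 (fun _ => 1) (wedge22 A A) i j k l m
          + t ^ 2 * wedge14 (fun _ => 1) (wedge22 A B) i j k l m) := by
    simp only [wedge14, wedge22, σ]
    ring
  rw [e1]
  have i1 := tau_wedge_wedge p A i j k l m
  have i2 := omega_wedge_wedge p A A i j k l m
  have i3 := omega_wedge_wedge p A B i j k l m
  linear_combination coeffQ u v x t i * coeffQ u v x t j * coeffQ u v x t k * coeffQ u v x t l
    * coeffQ u v x t m * (2 * t ^ 2 * i1 + (t - t ^ 2 * σ) * i2 + t ^ 2 * i3)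

end Syzygy

section SyzygyJets

variable {n : ℕ} {u v : (Fin n → ℝ) → ℝ} {x : Fin n → ℝ} {t : ℝ}

lemma NondegenerateAt.eventually (hx : NondegenerateAt u v x) (hu : ContDiffAt ℝ ∞ u x)
    (hv : ContDiffAt ℝ ∞ v x) : ∀ᶠ y in nhds x, NondegenerateAt u v y := by
  have h1 : ∀ᶠ y in nhds x, ∀ i, pd i u y ≠ 0 := Filter.eventually_all.mpr fun i =>
    (contDiffAt_pd i hu).continuousAt.eventually_ne (hx.1 i)
  have h2 : ∀ᶠ y in nhds x, ∀ i, pd i v y ≠ 0 := Filter.eventually_all.mpr fun i =>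
    (contDiffAt_pd i hv).continuousAt.eventually_ne (hx.2.1 i)
  have h3 : ∀ᶠ y in nhds x, ∀ i j, i ≠ j → aRatio u v i y ≠ aRatio u v j y := by
    refine Filter.eventually_all.mpr fun i => Filter.eventually_all.mpr fun j => ?_
    by_cases hij : i = j
    · exact Filter.Eventually.of_forall fun y h => absurd hij h
    have hc := ((contDiffAt_aRatio hu hv (hx.2.1 i)).sub
      (contDiffAt_aRatio hu hv (hx.2.1 j))).continuousAt
    filter_upwards [hc.eventually_ne (sub_ne_zero.mpr (hx.2.2 i j hij))] with y hy _
    exact sub_ne_zero.mp hy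
  filter_upwards [h1, h2, h3] with y a b c
  exact ⟨a, b, c⟩

lemma ne_aRatio_eventually (hu : ContDiffAt ℝ ∞ u x) (hv : ContDiffAt ℝ ∞ v x)
    (hx : NondegenerateAt u v x) (ht : ∀ i, t ≠ aRatio u v i x) :
    ∀ᶠ y in nhds x, ∀ i, t ≠ aRatio u v i y :=
  Filter.eventually_all.mpr fun i =>
    ((contDiffAt_aRatio hu hv (hx.2.1 i)).continuousAt.eventually_ne (ht i).symm).mono
      fun _ h => h.symm

/-- Where the equations vanish to order `N`, so does `d(ω ∧ τ ∧ dω)`, although it is built from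
the first derivatives of the equations. -/
lemma flat_d_wedgeD {N : ℕ} (hu : ContDiff ℝ ∞ u) (hv : ContDiff ℝ ∞ v)
    (hx : NondegenerateAt u v x) (ht : ∀ i, t ≠ aRatio u v i x)
    (hE : ∀ i j k l, Flat N (exprE u v i j k l) x) (hF : ∀ i j k l, Flat N (scaledF u v i j k l) x)
    {i j : Fin n} (hij : i ≠ j) (k l m : Fin n) :
    let q : Fin n → (Fin n → ℝ) → ℝ := fun i y => coeffQ u v y t i
    let r : Fin n → (Fin n → ℝ) → ℝ := fun i y => coeffR u v y t i
    Flat N (fun y => pd i (wedgeD q r j k l m) y - pd j (wedgeD q r i k l m) y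
        + pd k (wedgeD q r i j l m) y - pd l (wedgeD q r i j k m) y
        + pd m (wedgeD q r i j k l) y) x := by
  intro q r
  have hp : ∀ i, ContDiffAt ℝ ∞ (fun y => pole u v y t i) x := fun i =>
    contDiffAt_slice_pole hu.contDiffAt hv.contDiffAt (hx.2.1 i) (ht i)
  have hq : ∀ i, ContDiffAt ℝ ∞ (fun y => coeffQ u v y t i) x := fun i =>
    contDiffAt_slice_coeffQ hu.contDiffAt hv.contDiffAt (hx.2.1 i) (ht i)
  have hA : ∀ i j, ContDiffAt ℝ ∞ (fun y => formA u v t y i j) x := fun i j =>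
    ((hp j).sub (hp i)).mul ((contDiffAt_const.mul
      (contDiffAt_termE hu.contDiffAt hv.contDiffAt hx i j)).add
      (contDiffAt_termF hu.contDiffAt hv.contDiffAt hx i j))
  have hB : ∀ i j, ContDiffAt ℝ ∞ (fun y => formB u v t y i j) x := fun i j =>
    ((hp j).sub (hp i)).mul (contDiffAt_termE hu.contDiffAt hv.contDiffAt hx i j)
  have near : ∀ᶠ y in nhds x, NondegenerateAt u v y ∧ ∀ i, t ≠ aRatio u v i y :=
    (hx.eventually hu.contDiffAt hv.contDiffAt).and
      (ne_aRatio_eventually hu.contDiffAt hv.contDiffAt hx ht)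
  have hWA : ∀ i j k l, Flat N (fun y => wedge4 (pole u v y t) (formA u v t y) i j k l) x := by
    intro i j k l
    refine Flat.congr (((hE i j k l).smooth_mul (c := fun _ => t) contDiffAt_const |>.add
      (hF i j k l)).smooth_mul ((((hp i).mul (hp j)).mul (hp k)).mul (hp l))) ?_
    filter_upwards [near] with y ⟨h3, h4⟩
    exact (wedge4_formA hu.contDiffAt hv.contDiffAt h3 h4 i j k l).symm
  have hWB : ∀ i j k l, Flat N (fun y => wedge4 (pole u v y t) (formB u v t y) i j k l) x := by
    intro i j k l
    refine Flat.congr ((hE i j k l).smooth_mul ((((hp i).mul (hp j)).mul (hp k)).mul (hp l))) ?_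
    filter_upwards [near] with y ⟨h3, h4⟩
    exact (wedge4_formB hu.contDiffAt hv.contDiffAt h4 i j k l).symm
  have hpA : ∀ i j k, ContDiffAt ℝ ∞ (fun y => wedge12 (pole u v y t) (formA u v t y) i j k) x :=
    fun i j k => (((hp i).mul (hA j k)).sub ((hp j).mul (hA i k))).add ((hp k).mul (hA i j))
  have h1A : ∀ i j k, ContDiffAt ℝ ∞ (fun y => wedge12 (fun _ => 1) (formA u v t y) i j k) x :=
    fun i j k => ((contDiffAt_const.mul (hA j k)).sub (contDiffAt_const.mul (hA i k))).add
      (contDiffAt_const.mul (hA i j))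
  have h1B : ∀ i j k, ContDiffAt ℝ ∞ (fun y => wedge12 (fun _ => 1) (formB u v t y) i j k) x :=
    fun i j k => ((contDiffAt_const.mul (hB j k)).sub (contDiffAt_const.mul (hB i k))).add
      (contDiffAt_const.mul (hB i j))
  have hσ : ContDiffAt ℝ ∞ (fun y => pole u v y t i + pole u v y t j + pole u v y t k
      + pole u v y t l + pole u v y t m) x :=
    ((((hp i).add (hp j)).add (hp k)).add (hp l)).add (hp m)
  have hc : ∀ b, ContDiffAt ℝ ∞ (fun y => 4 * t ^ 2 * wedge12 (pole u v y t) (formA u v t y) i j b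
      + (2 * t - 2 * t ^ 2 * (pole u v y t i + pole u v y t j + pole u v y t k
      + pole u v y t l + pole u v y t m)) * wedge12 (fun _ => 1) (formA u v t y) i j b
      + t ^ 2 * wedge12 (fun _ => 1) (formB u v t y) i j b) x := fun b =>
    ((contDiffAt_const.mul (hpA i j b)).add ((contDiffAt_const.sub
      (contDiffAt_const.mul hσ)).mul (h1A i j b))).add (contDiffAt_const.mul (h1B i j b))
  have hc' : ∀ b, ContDiffAt ℝ ∞ (fun y => t ^ 2 * wedge12 (fun _ => 1) (formA u v t y) i j b) x :=
    fun b => contDiffAt_const.mul (h1A i j b)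
  refine Flat.of_smooth_mul ((hp j).sub (hp i))
    (sub_ne_zero.mpr (pole_injective hx j i hij.symm)) ?_
  refine Flat.congr (((((((hWA i j k l).smooth_mul (hc m)).sub ((hWA i j k m).smooth_mul
    (hc l))).add
    ((hWA i j l m).smooth_mul (hc k))).add ((hWB i j k l).smooth_mul (hc' m))).sub
    ((hWB i j k m).smooth_mul (hc' l))).add ((hWB i j l m).smooth_mul (hc' k)) |>.smooth_mul
    (((((hq i).mul (hq j)).mul (hq k)).mul (hq l)).mul (hq m))) ?_
  filter_upwards [near] with y ⟨h3, h4⟩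
  exact (d_wedgeD_coeff hu.contDiffAt hv.contDiffAt h3 h4 i j k l m).symm

/-- The leading part of a derivative of `ω ∧ τ ∧ dω` comes from the derivatives of the equations
alone. -/
lemma jet_pd_wedgeD {N : ℕ} (hu : ContDiff ℝ ∞ u) (hv : ContDiff ℝ ∞ v)
    (hx : NondegenerateAt u v x) (ht : ∀ i, t ≠ aRatio u v i x) {i j k l : Fin n}
    (hE : Flat (N + 1) (exprE u v i j k l) x) (hF : Flat (N + 1) (scaledF u v i j k l) x)
    (m : Fin n) {s : Multiset (Fin n)} (hs : s.card = N) :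
    ContDiffAt ℝ ∞ (pd m (wedgeD (fun i y => coeffQ u v y t i)
      (fun i y => coeffR u v y t i) i j k l)) x ∧
    jet x (pd m (wedgeD (fun i y => coeffQ u v y t i) (fun i y => coeffR u v y t i) i j k l)) s
      = (t * (coeffR u v x t i * coeffR u v x t j * coeffR u v x t k * coeffR u v x t l))
        * (t * jet x (exprE u v i j k l) (m ::ₘ s) + jet x (scaledF u v i j k l) (m ::ₘ s)) := by
  have hr : ∀ i, ContDiffAt ℝ ∞ (fun y => coeffR u v y t i) x := fun i =>
    contDiffAt_slice_coeffR hu.contDiffAt hv.contDiffAt (hx.2.1 i) (ht i)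
  have hc : ContDiffAt ℝ ∞ (fun y => t * (coeffR u v y t i * coeffR u v y t j * coeffR u v y t k
      * coeffR u v y t l)) x :=
    contDiffAt_const.mul ((((hr i).mul (hr j)).mul (hr k)).mul (hr l))
  have hX : Flat (N + 1) (fun y => t * exprE u v i j k l y + scaledF u v i j k l y) x :=
    (hE.smooth_mul contDiffAt_const).add hF
  have e : wedgeD (fun i y => coeffQ u v y t i) (fun i y => coeffR u v y t i) i j k l
      =ᶠ[nhds x] fun y => (t * (coeffR u v y t i * coeffR u v y t j * coeffR u v y t k
        * coeffR u v y t l)) * (t * exprE u v i j k l y + scaledF u v i j k l y) := by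
    filter_upwards [hx.eventually hu.contDiffAt hv.contDiffAt,
      ne_aRatio_eventually hu.contDiffAt hv.contDiffAt hx ht] with y h3 h4
    exact wedgeD_coeff hu.contDiffAt hv.contDiffAt h3 h4 i j k l
  have e' := (pd_congr m e).trans (pd_mul_eventuallyEq m hc hX.1)
  have h1 : Flat (N + 1) _ x := hX.smooth_mul (contDiffAt_pd m hc)
  have h2 := (hX.2.2 m).contDiffAt
  refine ⟨(h1.1.add (hc.mul h2)).congr_of_eventuallyEq e', ?_⟩
  rw [jet_congr s e', jet_add s h1.1 (hc.mul h2), h1.jet_eq_zero hs, (hX.2.2 m).jet_mul hc hs,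
    ← jet_cons m s hX.1, jet_add _ (contDiffAt_const.mul hE.1) hF.1, jet_const_mul _ _ hE.1,
    zero_add]

/-- The leading jets of the equations satisfy the syzygy: for generic `t` it is the leading part
of the identity for `d(ω ∧ τ ∧ dω)`, and both sides are polynomials in `t`. -/
theorem syzygy_jet {N : ℕ} (hu : ContDiff ℝ ∞ u) (hv : ContDiff ℝ ∞ v)
    (hx : NondegenerateAt u v x)
    (hE : ∀ i j k l, Flat (N + 1) (exprE u v i j k l) x)
    (hF : ∀ i j k l, Flat (N + 1) (scaledF u v i j k l) x)
    {s : Multiset (Fin n)} (hs : s.card = N) {i j : Fin n} (hij : i ≠ j) (k l m : Fin n) (t : ℝ) :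
    syzygy (fun i => aRatio u v i x) (fun i => pd i u x) t
      (fun i j k l r => t * jet x (exprE u v i j k l) (r ::ₘ s)
        + jet x (scaledF u v i j k l) (r ::ₘ s)) i j k l m = 0 := by
  have generic : ∀ t : ℝ, t ≠ 0 → (∀ i, t ≠ aRatio u v i x) →
      syzygy (fun i => aRatio u v i x) (fun i => pd i u x) t
        (fun i j k l r => t * jet x (exprE u v i j k l) (r ::ₘ s)
          + jet x (scaledF u v i j k l) (r ::ₘ s)) i j k l m = 0 := by
    intro t ht0 ht
    have hW := fun i j k l m => jet_pd_wedgeD hu hv hx ht (hE i j k l) (hF i j k l) m hs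
    have h := (flat_d_wedgeD hu hv hx ht hE hF hij k l m).jet_eq_zero hs
    have w1 := hW j k l m i
    have w2 := hW i k l m j
    have w3 := hW i j l m k
    have w4 := hW i j k m l
    have w5 := hW i j k l m
    rw [jet_add s (((w1.1.sub w2.1).add w3.1).sub w4.1) w5.1,
      jet_sub s ((w1.1.sub w2.1).add w3.1) w4.1, jet_add s (w1.1.sub w2.1) w3.1,
      jet_sub s w1.1 w2.1, w1.2, w2.2, w3.2, w4.2, w5.2] at h
    have hr : ∀ i, coeffR u v x t i ≠ 0 := fun i =>
      mul_ne_zero (pole_ne_zero (ht i)) (coeffQ_ne_zero hx (ht i))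
    have hinv : ∀ i, (t - aRatio u v i x) ^ 2 / pd i u x * coeffR u v x t i = 1 := by
      intro i
      have := sub_ne_zero.mpr (ht i)
      have := hx.1 i
      simp only [coeffR, coeffQ, pole]
      field_simp
    refine (mul_eq_zero.mp (?_ : t * (coeffR u v x t i * coeffR u v x t j * coeffR u v x t k
      * coeffR u v x t l * coeffR u v x t m) * _ = 0)).resolve_left
      (mul_ne_zero ht0 (mul_ne_zero (mul_ne_zero (mul_ne_zero (mul_ne_zero (hr i) (hr j)) (hr k))
        (hr l)) (hr m)))
    rw [← h]
    simp only [syzygy]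
    have hG : ∀ i₁ i₂ i₃ i₄ i₅, t * (coeffR u v x t i₁ * coeffR u v x t i₂ * coeffR u v x t i₃
        * coeffR u v x t i₄) * (coeffR u v x t i₅ * ((t - aRatio u v i₅ x) ^ 2 / pd i₅ u x))
        = t * (coeffR u v x t i₁ * coeffR u v x t i₂ * coeffR u v x t i₃ * coeffR u v x t i₄) := by
      intro i₁ i₂ i₃ i₄ i₅
      rw [mul_comm (coeffR u v x t i₅), hinv, mul_one]
    rw [← hG j k l m i, ← hG i k l m j, ← hG i j l m k, ← hG i j k m l, ← hG i j k l m]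
    ring
  have hfin : (insert 0 (Set.range fun i => aRatio u v i x)).Finite :=
    (Set.finite_range _).insert 0
  have hcont : Continuous fun t : ℝ => syzygy (fun i => aRatio u v i x) (fun i => pd i u x) t
      (fun i j k l r => t * jet x (exprE u v i j k l) (r ::ₘ s)
        + jet x (scaledF u v i j k l) (r ::ₘ s)) i j k l m := by
    simp only [syzygy]
    fun_prop
  refine congrFun (Continuous.ext_on (hfin.countable.dense_compl ℝ) hcont continuous_const ?_) t
  intro t ht
  simp only [Set.mem_compl_iff, Set.mem_insert_iff, Set.mem_range, not_or, not_exists] at ht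
  exact generic t ht.1 fun i h => ht.2 i h.symm

end SyzygyJets

/-! ### Compatibility -/

section Compatibility

variable {n : ℕ} {f f' g g' h : (Fin n → ℝ) → ℝ} {x : Fin n → ℝ} {N : ℕ}

/-- `f` and `g` are smooth near `x` and their derivatives at `x` of order less than `N` agree. -/
def FlatEq (N : ℕ) (f g : (Fin n → ℝ) → ℝ) (x : Fin n → ℝ) : Prop :=
  ContDiffAt ℝ ∞ g x ∧ Flat N (fun y => f y - g y) x

lemma FlatEq.contDiffAt_left (h : FlatEq N f g x) : ContDiffAt ℝ ∞ f x :=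
  (h.2.contDiffAt.add h.1).congr_of_eventuallyEq (Filter.Eventually.of_forall fun y => by
    change f y = f y - g y + g y
    ring)

lemma FlatEq.refl (hf : ContDiffAt ℝ ∞ f x) : FlatEq N f f x :=
  ⟨hf, (flat_zero N).congr (Filter.Eventually.of_forall fun y => (sub_self (f y)).symm)⟩

lemma FlatEq.add (h₁ : FlatEq N f f' x) (h₂ : FlatEq N g g' x) :
    FlatEq N (fun y => f y + g y) (fun y => f' y + g' y) x :=
  ⟨h₁.1.add h₂.1, (h₁.2.add h₂.2).congr (Filter.Eventually.of_forall fun y => by ring)⟩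

lemma FlatEq.mul (h₁ : FlatEq N f f' x) (h₂ : FlatEq N g g' x) :
    FlatEq N (fun y => f y * g y) (fun y => f' y * g' y) x :=
  ⟨h₁.1.mul h₂.1, ((h₁.2.smooth_mul h₂.contDiffAt_left).add (h₂.2.smooth_mul h₁.1)).congr
    (Filter.Eventually.of_forall fun y => by ring)⟩

lemma FlatEq.sub (h₁ : FlatEq N f f' x) (h₂ : FlatEq N g g' x) :
    FlatEq N (fun y => f y - g y) (fun y => f' y - g' y) x :=
  ⟨h₁.1.sub h₂.1, (h₁.2.sub h₂.2).congr (Filter.Eventually.of_forall fun y => by ring)⟩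

lemma FlatEq.inv (h : FlatEq N f g x) (hf : f x ≠ 0) (hg : g x ≠ 0) :
    FlatEq N (fun y => (f y)⁻¹) (fun y => (g y)⁻¹) x := by
  refine ⟨h.1.inv hg, (h.2.neg.smooth_mul ((h.contDiffAt_left.inv hf).mul (h.1.inv hg))).congr ?_⟩
  filter_upwards [h.contDiffAt_left.continuousAt.eventually_ne hf,
    h.1.continuousAt.eventually_ne hg] with y h1 h2
  simp only [Pi.inv_apply]
  field_simp
  ring

lemma FlatEq.div (h₁ : FlatEq N f f' x) (h₂ : FlatEq N g g' x) (hg : g x ≠ 0) (hg' : g' x ≠ 0) :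
    FlatEq N (fun y => f y / g y) (fun y => f' y / g' y) x := by
  simp only [div_eq_mul_inv]
  exact h₁.mul (h₂.inv hg hg')

lemma FlatEq.congr (h : FlatEq N f g x) (hf : f =ᶠ[nhds x] f') (hg : g =ᶠ[nhds x] g') :
    FlatEq N f' g' x :=
  ⟨h.1.congr_of_eventuallyEq hg.symm, h.2.congr (hf.sub hg)⟩

lemma FlatEq.quad {a a' : Fin n → (Fin n → ℝ) → ℝ} {M M' : Fin n → Fin n → (Fin n → ℝ) → ℝ}
    (ha : ∀ i, FlatEq N (a i) (a' i) x) (hM : ∀ i j, FlatEq N (M i j) (M' i j) x)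
    (i j k l : Fin n) :
    FlatEq N (fun y => quad (fun i => a i y) (fun i j => M i j y) i j k l)
      (fun y => quad (fun i => a' i y) (fun i j => M' i j y) i j k l) x :=
  have hs : ∀ i j k l, FlatEq N (fun y => (a i y - a j y) * (a k y - a l y) * (M i j y + M k l y))
      (fun y => (a' i y - a' j y) * (a' k y - a' l y) * (M' i j y + M' k l y)) x := fun i j k l =>
    (((ha i).sub (ha j)).mul ((ha k).sub (ha l))).mul ((hM i j).add (hM k l))
  ((hs i j k l).add (hs i k l j)).add (hs i l j k)

lemma jet_quad {a : Fin n → (Fin n → ℝ) → ℝ} {M : Fin n → Fin n → (Fin n → ℝ) → ℝ}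
    (ha : ∀ i, ContDiffAt ℝ ∞ (a i) x) (hM : ∀ i j, Flat N (M i j) x) (i j k l : Fin n)
    {s : Multiset (Fin n)} (hs : s.card = N) :
    ContDiffAt ℝ ∞ (fun y => quad (fun i => a i y) (fun i j => M i j y) i j k l) x ∧
    jet x (fun y => quad (fun i => a i y) (fun i j => M i j y) i j k l) s
      = quad (fun i => a i x) (fun i j => jet x (M i j) s) i j k l := by
  have hc : ∀ i j k l, ContDiffAt ℝ ∞ (fun y => (a i y - a j y) * (a k y - a l y)) x :=
    fun i j k l => ((ha i).sub (ha j)).mul ((ha k).sub (ha l))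
  have hA : ∀ i j k l, Flat N (fun y => M i j y + M k l y) x := fun i j k l =>
    (hM i j).add (hM k l)
  have h1 : ∀ i j k l, Flat N (fun y => (a i y - a j y) * (a k y - a l y)
      * (M i j y + M k l y)) x := fun i j k l => (hA i j k l).smooth_mul (hc i j k l)
  have h2 : ∀ i j k l, jet x (fun y => (a i y - a j y) * (a k y - a l y)
      * (M i j y + M k l y)) s
      = (a i x - a j x) * (a k x - a l x) * (jet x (M i j) s + jet x (M k l) s) := by
    intro i j k l
    rw [(hA i j k l).jet_mul (hc i j k l) hs, jet_add s (hM i j).contDiffAt (hM k l).contDiffAt]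
  refine ⟨(((h1 i j k l).add (h1 i k l j)).add (h1 i l j k)).contDiffAt, ?_⟩
  simp only [_root_.quad, ← h2]
  rw [jet_add s ((h1 i j k l).add (h1 i k l j)).contDiffAt (h1 i l j k).contDiffAt,
    jet_add s (h1 i j k l).contDiffAt (h1 i k l j).contDiffAt]

variable {u v : (Fin n → ℝ) → ℝ}

/-- The variation of `termE` in the direction of `(f, g)`, up to the terms with first derivatives
of `f` and `g`. -/
def varE (u v f g : (Fin n → ℝ) → ℝ) (i j : Fin n) (y : Fin n → ℝ) : ℝ :=
  (2 * pd2 i j f y - (aRatio u v i y + aRatio u v j y) * pd2 i j g y) / (pd i u y * pd j u y)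

lemma flatEq_pd_add (hu : ContDiffAt ℝ ∞ u x) (hf : Flat (N + 2) f x) (i : Fin n) :
    FlatEq (N + 1) (pd i fun y => u y + f y) (pd i u) x := by
  refine ⟨contDiffAt_pd i hu, (hf.2.2 i).congr ?_⟩
  filter_upwards [hu.eventually_infty, hf.1.eventually_infty] with y h1 h2
  rw [pd_add i h1 h2]
  ring

lemma pd2_add_eventuallyEq (hu : ContDiffAt ℝ ∞ u x) (hf : ContDiffAt ℝ ∞ f x) (i j : Fin n) :
    (fun y => pd2 i j u y + pd2 i j f y) =ᶠ[nhds x] pd2 i j fun y => u y + f y := by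
  have h1 : pd i (fun y => u y + f y) =ᶠ[nhds x] fun y => pd i u y + pd i f y := by
    filter_upwards [hu.eventually_infty, hf.eventually_infty] with y h1 h2
    exact pd_add i h1 h2
  refine ((pd_congr j h1).trans ?_).symm
  filter_upwards [(contDiffAt_pd i hu).eventually_infty, (contDiffAt_pd i hf).eventually_infty]
    with y h1 h2
  exact pd_add j h1 h2

lemma pd_add_flat (hu : ContDiffAt ℝ ∞ u x) (hf : Flat (N + 2) f x) (i : Fin n) :
    pd i (fun y => u y + f y) x = pd i u x := by
  rw [pd_add i hu.differentiableAt_infty hf.1.differentiableAt_infty, (hf.2.2 i).2.1, add_zero]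

lemma NondegenerateAt.add_flat (hx : NondegenerateAt u v x) (hu : ContDiffAt ℝ ∞ u x)
    (hv : ContDiffAt ℝ ∞ v x) (hf : Flat (N + 2) f x) (hg : Flat (N + 2) g x) :
    NondegenerateAt (fun y => u y + f y) (fun y => v y + g y) x := by
  simp only [NondegenerateAt, aRatio, pd_add_flat hu hf, pd_add_flat hv hg]
  exact hx

/-- Adding functions `(f, g)` that vanish to order `N + 2` changes `exprE` by the linear terms in
their second derivatives, up to terms that vanish to order `N + 1`. -/
lemma flatEq_exprE (hu : ContDiffAt ℝ ∞ u x) (hv : ContDiffAt ℝ ∞ v x)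
    (hx : NondegenerateAt u v x) (hf : Flat (N + 2) f x) (hg : Flat (N + 2) g x)
    (i j k l : Fin n) :
    FlatEq (N + 1) (exprE (fun y => u y + f y) (fun y => v y + g y) i j k l)
      (fun y => exprE u v i j k l y
        + quad (fun i => aRatio u v i y) (fun i j => varE u v f g i j y) i j k l) x := by
  have hx' := hx.add_flat hu hv hf hg
  have hpu := flatEq_pd_add hu hf
  have hpv := flatEq_pd_add hv hg
  have ha : ∀ i, FlatEq (N + 1) (aRatio (fun y => u y + f y) (fun y => v y + g y) i)
      (aRatio u v i) x := fun i => (hpu i).div (hpv i) (hx'.2.1 i) (hx.2.1 i)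
  have h2u : ∀ i j, FlatEq (N + 1) (pd2 i j fun y => u y + f y)
      (fun y => pd2 i j u y + pd2 i j f y) x := fun i j =>
    (FlatEq.refl ((contDiffAt_pd2 i j hu).add (contDiffAt_pd2 i j hf.1))).congr
      (pd2_add_eventuallyEq hu hf.1 i j) (Filter.EventuallyEq.refl _ _)
  have h2v : ∀ i j, FlatEq (N + 1) (pd2 i j fun y => v y + g y)
      (fun y => pd2 i j v y + pd2 i j g y) x := fun i j =>
    (FlatEq.refl ((contDiffAt_pd2 i j hv).add (contDiffAt_pd2 i j hg.1))).congr
      (pd2_add_eventuallyEq hv hg.1 i j) (Filter.EventuallyEq.refl _ _)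
  have hM : ∀ i j, FlatEq (N + 1) (termE (fun y => u y + f y) (fun y => v y + g y) i j)
      (fun y => (2 * (pd2 i j u y + pd2 i j f y) - (aRatio u v i y + aRatio u v j y)
        * (pd2 i j v y + pd2 i j g y)) / (pd i u y * pd j u y)) x := fun i j =>
    (((FlatEq.refl contDiffAt_const).mul (h2u i j)).sub (((ha i).add (ha j)).mul (h2v i j))).div
      ((hpu i).mul (hpu j)) (mul_ne_zero (hx'.1 i) (hx'.1 j)) (mul_ne_zero (hx.1 i) (hx.1 j))
  refine (FlatEq.quad ha hM i j k l).congr (Filter.Eventually.of_forall fun y => rfl)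
    (Filter.Eventually.of_forall fun y => ?_)
  simp only [exprE, summandE_eq, quad, varE, termE]
  ring

lemma jet_pd2 (s : Multiset (Fin n)) (hf : ContDiffAt ℝ ∞ f x) (i j : Fin n) :
    jet x (pd2 i j f) s = jet x f (i ::ₘ j ::ₘ s) := by
  rw [jet_cons _ _ hf, jet_cons _ _ (contDiffAt_pd i hf)]
  rfl

lemma flat_varE (hu : ContDiffAt ℝ ∞ u x) (hv : ContDiffAt ℝ ∞ v x)
    (hx : NondegenerateAt u v x) (hf : Flat (N + 2) f x) (hg : Flat (N + 2) g x) (i j : Fin n) :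
    Flat N (varE u v f g i j) x ∧ ∀ s : Multiset (Fin n), s.card = N →
      jet x (varE u v f g i j) s
        = symbE (fun i => aRatio u v i x) (fun i => pd i u x) (jet x f) (jet x g) s i j := by
  have ha := fun i => contDiffAt_aRatio hu hv (hx.2.1 i)
  have hf2 : Flat N (pd2 i j f) x := (hf.2.2 i).2.2 j
  have hg2 : Flat N (pd2 i j g) x := (hg.2.2 i).2.2 j
  have hd := (((contDiffAt_pd i hu).mul (contDiffAt_pd j hu))).inv (mul_ne_zero (hx.1 i) (hx.1 j))
  have h1 : Flat N (fun y => 2 * pd2 i j f y) x := hf2.smooth_mul contDiffAt_const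
  have h2 : Flat N (fun y => (aRatio u v i y + aRatio u v j y) * pd2 i j g y) x :=
    hg2.smooth_mul ((ha i).add (ha j))
  have e : varE u v f g i j = fun y => (fun y => pd i u y * pd j u y)⁻¹ y
      * (2 * pd2 i j f y - (aRatio u v i y + aRatio u v j y) * pd2 i j g y) := by
    funext y
    simp only [varE, div_eq_inv_mul, Pi.inv_apply]
  refine ⟨e ▸ (h1.sub h2).smooth_mul hd, fun s hs => ?_⟩
  rw [e, (h1.sub h2).jet_mul hd hs, jet_sub s h1.contDiffAt h2.contDiffAt,
    jet_const_mul s _ hf2.contDiffAt, hg2.jet_mul ((ha i).add (ha j)) hs, jet_pd2 s hf.1,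
    jet_pd2 s hg.1, symbE, div_eq_inv_mul]
  rfl

/-- If the leading jets of `(f, g)` solve the linearised equation then `(u + f, v + g)` solves the
equation to one order more than `(u, v)`. -/
lemma flat_exprE_add (hu : ContDiffAt ℝ ∞ u x) (hv : ContDiffAt ℝ ∞ v x)
    (hx : NondegenerateAt u v x) (hf : Flat (N + 2) f x) (hg : Flat (N + 2) g x)
    {i j k l : Fin n} (hE : Flat N (exprE u v i j k l) x)
    (h : ∀ s : Multiset (Fin n), s.card = N → quad (fun i => aRatio u v i x)
      (symbE (fun i => aRatio u v i x) (fun i => pd i u x) (jet x f) (jet x g) s) i j k l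
        + jet x (exprE u v i j k l) s = 0) :
    Flat (N + 1) (exprE (fun y => u y + f y) (fun y => v y + g y) i j k l) x := by
  have ha := fun i => contDiffAt_aRatio hu hv (hx.2.1 i)
  have hq := flatEq_exprE hu hv hx hf hg i j k l
  have hv := flat_varE hu hv hx hf hg
  have hj := fun s hs => jet_quad (N := N) (s := s) ha (fun i j => (hv i j).1) i j k l hs
  have h0 : Flat N (fun y => quad (fun i => aRatio u v i y) (fun i j => varE u v f g i j y)
      i j k l) x := by
    have hs : ∀ i j k l, Flat N (fun y => (aRatio u v i y - aRatio u v j y)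
        * (aRatio u v k y - aRatio u v l y) * (varE u v f g i j y + varE u v f g k l y)) x :=
      fun i j k l => ((hv i j).1.add (hv k l).1).smooth_mul
        (((ha i).sub (ha j)).mul ((ha k).sub (ha l)))
    exact ((hs i j k l).add (hs i k l j)).add (hs i l j k)
  have h1 : Flat (N + 1) (fun y => exprE u v i j k l y + quad (fun i => aRatio u v i y)
      (fun i j => varE u v f g i j y) i j k l) x := by
    refine (hE.add h0).succ_of_jet fun s hs => ?_
    rw [jet_add s hE.contDiffAt h0.contDiffAt, (hj s hs).2]
    simp only [(hv _ _).2 s hs]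
    rw [add_comm]
    exact h s hs
  exact (hq.2.add h1).congr (Filter.Eventually.of_forall fun y => by ring)

/-- The leading jets of components that satisfy the relations near `x` satisfy them at `x`. -/
lemma isWedge_jet {a : Fin n → (Fin n → ℝ) → ℝ}
    {T : Fin n → Fin n → Fin n → Fin n → (Fin n → ℝ) → ℝ} (ha : ∀ i, ContDiffAt ℝ ∞ (a i) x)
    (hT : ∀ i j k l, Flat N (T i j k l) x)
    (h : ∀ᶠ y in nhds x, IsWedge (fun i => a i y) fun i j k l => T i j k l y)
    {s : Multiset (Fin n)} (hs : s.card = N) :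
    IsWedge (fun i => a i x) fun i j k l => jet x (T i j k l) s := by
  have hc := fun i j k l => (hT i j k l).contDiffAt
  have hneg : ∀ i j k l i' j' k' l', (∀ᶠ y in nhds x, T i' j' k' l' y = - T i j k l y) →
      jet x (T i' j' k' l') s = - jet x (T i j k l) s := by
    intro i j k l i' j' k' l' h
    rw [← neg_one_mul, ← jet_const_mul s _ (hc i j k l)]
    refine jet_congr s ?_
    filter_upwards [h] with y hy
    rw [hy]
    ring
  have hzero : ∀ f : (Fin n → ℝ) → ℝ, (∀ᶠ y in nhds x, f y = 0) → jet x f s = 0 := by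
    intro f hf
    exact ((flat_zero (N + 1)).congr (hf.mono fun y hy => hy.symm)).jet_eq_zero hs
  refine ⟨fun i j k l => hneg _ _ _ _ _ _ _ _ (h.mono fun y hy => hy.alt₁₂ i j k l),
    fun i j k l => hneg _ _ _ _ _ _ _ _ (h.mono fun y hy => hy.alt₂₃ i j k l),
    fun i j k l => hneg _ _ _ _ _ _ _ _ (h.mono fun y hy => hy.alt₃₄ i j k l),
    fun i j k l m => ?_, fun i j k l m => ?_⟩
  · have := hzero _ (h.mono fun y hy => hy.omega_wedge i j k l m)
    rwa [jet_add s ((((hc j k l m).sub (hc i k l m)).add (hc i j l m)).sub (hc i j k m))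
        (hc i j k l), jet_sub s (((hc j k l m).sub (hc i k l m)).add (hc i j l m)) (hc i j k m),
      jet_add s ((hc j k l m).sub (hc i k l m)) (hc i j l m),
      jet_sub s (hc j k l m) (hc i k l m)] at this
  · have := hzero _ (h.mono fun y hy => hy.tau_wedge i j k l m)
    have hm : ∀ b i j k l, ContDiffAt ℝ ∞ (fun y => a b y * T i j k l y) x := fun b i j k l =>
      (ha b).mul (hc i j k l)
    rwa [jet_add s ((((hm i j k l m).sub (hm j i k l m)).add (hm k i j l m)).sub (hm l i j k m))
        (hm m i j k l),
      jet_sub s (((hm i j k l m).sub (hm j i k l m)).add (hm k i j l m)) (hm l i j k m),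
      jet_add s ((hm i j k l m).sub (hm j i k l m)) (hm k i j l m),
      jet_sub s (hm i j k l m) (hm j i k l m), (hT j k l m).jet_mul (ha i) hs,
      (hT i k l m).jet_mul (ha j) hs, (hT i j l m).jet_mul (ha k) hs,
      (hT i j k m).jet_mul (ha l) hs, (hT i j k l).jet_mul (ha m) hs] at this

/-- The symbol of `aᵢaⱼaₖaₗ Fᵢⱼₖₗ` is obtained from the symbol of `E` by interchanging `u` and
`v`. -/
lemma quad_symbF (hx : NondegenerateAt u v x) (φ ψ : Multiset (Fin n) → ℝ)
    (s : Multiset (Fin n)) (i j k l : Fin n) :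
    aRatio u v i x * aRatio u v j x * aRatio u v k x * aRatio u v l x
      * quad (fun i => aRatio v u i x)
        (symbE (fun i => aRatio v u i x) (fun i => pd i v x) ψ φ s) i j k l
      = quad (fun i => aRatio u v i x)
        (symbF (fun i => aRatio u v i x) (fun i => pd i u x) φ ψ s) i j k l := by
  have key : ∀ i j k l : Fin n, aRatio u v i x * aRatio u v j x * aRatio u v k x * aRatio u v l x
      * ((aRatio v u i x - aRatio v u j x) * (aRatio v u k x - aRatio v u l x)
        * (symbE (fun i => aRatio v u i x) (fun i => pd i v x) ψ φ s i j
          + symbE (fun i => aRatio v u i x) (fun i => pd i v x) ψ φ s k l))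
      = (aRatio u v i x - aRatio u v j x) * (aRatio u v k x - aRatio u v l x)
        * (symbF (fun i => aRatio u v i x) (fun i => pd i u x) φ ψ s i j
          + symbF (fun i => aRatio u v i x) (fun i => pd i u x) φ ψ s k l) := by
    intro i j k l
    have := hx.1 i; have := hx.1 j; have := hx.1 k; have := hx.1 l
    have := hx.2.1 i; have := hx.2.1 j; have := hx.2.1 k; have := hx.2.1 l
    simp only [aRatio, symbE, symbF]
    field_simp
    ring
  simp only [quad]
  rw [← key i j k l, ← key i k l j, ← key i l j k]
  ring

/-- Every nondegenerate jet that solves the system prolongs. -/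
theorem systemCompatible (n : ℕ) : SystemCompatible n := by
  intro x u v k hk hu hv hx hsol
  by_cases hzo : ∃ z o : Fin n, z ≠ o
  swap
  · exact ⟨u, v, hu, hv, fun _ _ => rfl, fun _ _ => rfl, fun i j r s hd =>
      absurd ⟨i, j, hd.1⟩ hzo⟩
  obtain ⟨z, o, hzo⟩ := hzo
  obtain ⟨N, rfl⟩ : ∃ N, k = N + 1 := ⟨k - 1, by omega⟩
  have hua := hu.contDiffAt (x := x)
  have hva := hv.contDiffAt (x := x)
  have ha := fun i => contDiffAt_aRatio hua hva (hx.2.1 i)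
  have hwE : ∀ y, IsWedge (fun i => aRatio u v i y) fun i j k l => exprE u v i j k l y := fun y =>
    isWedge_quad fun i j => termE_comm hu.contDiffAt hv.contDiffAt i j
  have hwF : ∀ᶠ y in nhds x, IsWedge (fun i => aRatio u v i y)
      fun i j k l => scaledF u v i j k l y := by
    filter_upwards [hx.eventually hua hva] with y hy
    simp only [scaledF_eq hy]
    exact isWedge_quad fun i j => termF_comm hu.contDiffAt hv.contDiffAt i j
  have hE : ∀ i j k l, Flat N (exprE u v i j k l) x := by
    intro i j k l
    by_cases hd : Distinct4 i j k l
    · exact (flat_iff_iteratedFDeriv (contDiffAt_exprE hua hva hx i j k l)).mpr fun m hm =>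
        (hsol i j k l hd m (by omega)).1
    · exact (flat_zero N).congr (Filter.Eventually.of_forall fun y =>
        ((hwE y).eq_zero_of_not_distinct hd).symm)
  have hF' : ∀ i j k l, Distinct4 i j k l → Flat N (exprE v u i j k l) x := fun i j k l hd =>
    (flat_iff_iteratedFDeriv (contDiffAt_exprE hva hua hx.swap i j k l)).mpr fun m hm =>
      (hsol i j k l hd m (by omega)).2
  have hc : ∀ i j k l, ContDiffAt ℝ ∞ (fun y => aRatio u v i y * aRatio u v j y * aRatio u v k y
      * aRatio u v l y) x := fun i j k l => (((ha i).mul (ha j)).mul (ha k)).mul (ha l)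
  have hF : ∀ i j k l, Flat N (scaledF u v i j k l) x := by
    intro i j k l
    by_cases hd : Distinct4 i j k l
    · exact (hF' i j k l hd).smooth_mul (hc i j k l)
    · exact (flat_zero N).congr (hwF.mono fun y hy => (hy.eq_zero_of_not_distinct hd).symm)
  obtain ⟨φ, ψ, hφψ⟩ := exists_prolongation (N := N) (a := fun i => aRatio u v i x)
    (U := fun i => pd i u x) (hE := fun i j k l s => jet x (exprE u v i j k l) s)
    (hF := fun i j k l s => jet x (scaledF u v i j k l) s)
    (fun s hs => isWedge_jet ha hE (Filter.Eventually.of_forall hwE) hs)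
    (fun s hs => isWedge_jet ha hF hwF hs)
    (by
      intro s hs i j k l m hnd t
      subst hs
      have hij : i ≠ j := by
        rintro rfl
        simp at hnd
      exact syzygy_jet hu hv hx hE hF rfl hij k l m t)
    hx.2.2 hx.1 hzo
  let f := jetPoly x (N + 2) φ
  let g := jetPoly x (N + 2) ψ
  have hfs : ContDiff ℝ ∞ f := contDiff_jetPoly _ _
  have hgs : ContDiff ℝ ∞ g := contDiff_jetPoly _ _
  have hf : Flat (N + 2) f x := flat_jetPoly _ _
  have hg : Flat (N + 2) g x := flat_jetPoly _ _
  have hjf : ∀ i j s, s.card = N → jet x f (i ::ₘ j ::ₘ s) = φ (i ::ₘ j ::ₘ s) := by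
    intro i j s hs
    have := jet_jetPoly (x := x) φ (i ::ₘ j ::ₘ s)
    rwa [Multiset.card_cons, Multiset.card_cons, hs] at this
  have hjg : ∀ i j s, s.card = N → jet x g (i ::ₘ j ::ₘ s) = ψ (i ::ₘ j ::ₘ s) := by
    intro i j s hs
    have := jet_jetPoly (x := x) ψ (i ::ₘ j ::ₘ s)
    rwa [Multiset.card_cons, Multiset.card_cons, hs] at this
  have hsame : ∀ w d : (Fin n → ℝ) → ℝ, ContDiff ℝ ∞ w → ContDiff ℝ ∞ d → Flat (N + 2) d x →
      SameJet (N + 1) (fun y => w y + d y) w x := by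
    intro w d hw hd hdf m hm
    have hm' : (m : WithTop ℕ∞) ≤ ∞ := WithTop.coe_le_coe.mpr le_top
    have h0 := (flat_iff_iteratedFDeriv hd.contDiffAt).mp hdf m (by omega)
    have h1 := iteratedFDeriv_add_apply (x := x) (hw.of_le hm').contDiffAt (hd.of_le hm').contDiffAt
    rw [h0, add_zero] at h1
    exact h1
  refine ⟨fun y => u y + f y, fun y => v y + g y, hu.add hfs, hv.add hgs,
    hsame u f hu hfs hf, hsame v g hv hgs hg, ?_⟩
  intro i j k l hd m hm
  have hsymE : ∀ s : Multiset (Fin n), s.card = N → ∀ a U : Fin n → ℝ,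
      symbE a U (jet x f) (jet x g) s = symbE a U φ ψ s := by
    intro s hs a U
    funext i j
    simp only [symbE, hjf i j s hs, hjg i j s hs]
  have hsymF : ∀ s : Multiset (Fin n), s.card = N → ∀ a U : Fin n → ℝ,
      symbE a U (jet x g) (jet x f) s = symbE a U ψ φ s := by
    intro s hs a U
    funext i j
    simp only [symbE, hjf i j s hs, hjg i j s hs]
  have h1 : Flat (N + 1) (exprE (fun y => u y + f y) (fun y => v y + g y) i j k l) x := by
    refine flat_exprE_add hua hva hx hf hg (hE i j k l) fun s hs => ?_
    rw [hsymE s hs]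
    exact (hφψ s hs i j k l).1
  have h2 : Flat (N + 1) (exprE (fun y => v y + g y) (fun y => u y + f y) i j k l) x := by
    refine flat_exprE_add hva hua hx.swap hg hf (hF' i j k l hd) fun s hs => ?_
    rw [hsymF s hs]
    have h3 : _ + jet x (scaledF u v i j k l) s = 0 := (hφψ s hs i j k l).2
    have h4 : jet x (scaledF u v i j k l) s = aRatio u v i x * aRatio u v j x * aRatio u v k x
        * aRatio u v l x * jet x (exprE v u i j k l) s := (hF' i j k l hd).jet_mul (hc i j k l) hs
    rw [h4, ← quad_symbF hx, ← mul_add] at h3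
    exact (mul_eq_zero.mp h3).resolve_left (mul_ne_zero (mul_ne_zero (mul_ne_zero
      (hx.aRatio_ne_zero i) (hx.aRatio_ne_zero j)) (hx.aRatio_ne_zero k)) (hx.aRatio_ne_zero l))
  exact ⟨(flat_iff_iteratedFDeriv h1.1).mp h1 m (by omega),
    (flat_iff_iteratedFDeriv h2.1).mp h2 m (by omega)⟩

end Compatibility

end

theorem theorem1 :
    -- for every `n`: the system governs involutivity, and has the Lax representation
    (∀ (n : ℕ) (U : Set (Fin n → ℝ)) (u v : (Fin n → ℝ) → ℝ),
      2 ≤ n → IsOpen U → NondegeneratePair U u v →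
        IsGL2Structure U (structureForm u v) ∧
        (SolvesSystem U u v ↔ IsInvolutiveStructure U (structureForm u v)) ∧
        (SolvesSystem U u v ↔ IsIntegrableOn (laxDistribution u v) (corrSpace U u v)) ∧
        (SolvesSystem U u v ↔
          ∀ p ∈ corrSpace U u v, Module.finrank ℝ (laxDistribution u v p) + 2 = n)) ∧
    -- varying `n`: the systems are compatible, and they and their Lax fields are nested
    (∀ n : ℕ, SystemCompatible n) ∧
    (∀ n m : ℕ, NestedStructure n m) := by
  refine ⟨fun n U u v hn hU h => ⟨isGL2Structure_structureForm hU h,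
    (solvesSystem_iff hU h).trans (isInvolutiveStructure_iff hn hU h).symm,
    laxDistribution_integrable_iff hn hU h,
    laxDistribution_rank_iff hn hU h⟩,
    systemCompatible, nestedStructure⟩
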